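/- Let $\phi:\mathbb C\to\mathbb R$ be subharmonic, let $dA$ be Lebesgue measure on $\mathbb C$, and write $\partial=\tfrac12(\partial_x-i\partial_y)$ and $\Delta=\tfrac14(\partial_x^2+\partial_y^2)$, where $\Delta\phi$ is understood in the sense of distributions. Let $\mathcal F_\phi$ be the space of entire functions $f$ with $\|f\|_\phi^2=\int_{\mathbb C}|f|^2e^{-\phi}\,dA<\infty$, and put $\bar\partial^*_\phi f=-e^{\phi}\,\partial(e^{-\phi}f)$. Let $\Lambda\subseteq\mathbb C$ be separated, i.e. $\inf\{|\lambda-\lambda'|:\lambda\neq\lambda'\in\Lambda\}>0$, let $m_\Lambda:\Lambda\to\mathbb N$ be a bounded multiplicity function (the value $0$ is allowed), and let $n_\Lambda=\sup_{\lambda\in\Lambda}m_\Lambda(\lambda)-1$. Assume that $(\Lambda,m_\Lambda)$ and $\phi$ are compatible: $\Delta\phi$ is a function with $m<\Delta\phi<M$ for some constants $m,M>0$, and, in case $n_\Lambda\ge2$, moreover $\phi\in C^{n_\Lambda+1}(\mathbb C)$ and $\sup_{z\in\mathbb C}|\partial^j\Delta\phi(z)|<\infty$ for $j=1,\dots,n_\Lambda-1$.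 Assume in addition that $\Delta\phi$ is continuous. For $r>0$ let $\chi_r=\frac1{\pi r^2}1_{B(0,r)}$, and let $\nu=\sum_{\lambda\in\Lambda}m_\Lambda(\lambda)\,\delta_\lambda$. Suppose that there are $\delta>0$ and $r>0$ such that $$\pi\,(\nu\star\chi_r)(z)>\Delta\phi(z)+\delta\qquad\text{for all }z\in\mathbb C.$$ Then $(\Lambda,m_\Lambda)$ is a sampling set for $\mathcal F_\phi$: there are constants $A,B>0$ such that for all $f\in\mathcal F_\phi$ $$A\|f\|_\phi^2\le\sum_{\lambda\in\Lambda}\ \sum_{j=0}^{m_\Lambda(\lambda)-1}\bigl|(\bar\partial^*_\phi)^{j}f(\lambda)\bigr|^2e^{-\phi(\lambda)}\le B\|f\|_\phi^2 .$$ -/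

import Mathlib

open MeasureTheory
open scoped ContDiff

noncomputable section

namespace FockSampling

/-- A set with multiplicities `(Λ, m_Λ)`: a set `Λ ⊆ ℂ` with a bounded function
`m_Λ : Λ → ℕ`. -/
structure MultSet where
  carrier : Set ℂ
  mult : carrier → ℕ
  bddAbove_mult : BddAbove (Set.range mult)

/-- `n_Λ = sup m_Λ - 1`. -/
def MultSet.n (Λ : MultSet) : ℕ := (⨆ p : Λ.carrier, Λ.mult p) - 1

/-- `Λ` is uniformly separated: distinct points have distances bounded below by some `ρ > 0`. -/
def MultSet.Separated (Λ : MultSet) : Prop :=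
  ∃ ρ : ℝ, 0 < ρ ∧ ∀ p ∈ Λ.carrier, ∀ q ∈ Λ.carrier, p ≠ q → ρ ≤ dist p q

/-- The measure `ν = ∑_{λ ∈ Λ} m_Λ(λ) δ_λ`. -/
def MultSet.nu (Λ : MultSet) : Measure ℂ :=
  Measure.sum fun p : Λ.carrier => Λ.mult p • Measure.dirac (p : ℂ)

/-- The normalized indicator `χ_r = (π r²)⁻¹ 1_{B(0,r)}`. -/
def chi (r : ℝ) : ℂ → ℝ :=
  (Metric.ball (0 : ℂ) r).indicator fun _ => 1 / (Real.pi * r ^ 2)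

/-- The convolution `(ν ⋆ χ_r)(z)`. -/
def MultSet.nuConvChi (Λ : MultSet) (r : ℝ) (z : ℂ) : ℝ := ∫ w, chi r (z - w) ∂Λ.nu

/-- Wirtinger derivative `∂ = (∂_x - i ∂_y) / 2`. -/
def wirtinger (f : ℂ → ℂ) (z : ℂ) : ℂ :=
  (1 / 2) * (fderiv ℝ f z 1 - Complex.I * fderiv ℝ f z Complex.I)

/-- The operator `f ↦ -e^φ ∂(e^{-φ} f)`, the formal adjoint of `∂̄` in `L²(e^{-φ} dA)`.
The `j`-th power is the iterate `(dbarStar φ)^[j]`. -/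
def dbarStar (φ : ℂ → ℝ) (f : ℂ → ℂ) (z : ℂ) : ℂ :=
  -(Real.exp (φ z) : ℂ) * wirtinger (fun w => (Real.exp (-φ w) : ℂ) * f w) z

/-- The normalized pointwise Laplacian `(∂_x² + ∂_y²) / 4`, for functions of class `C²`. -/
def quarterLaplacian (u : ℂ → ℝ) (z : ℂ) : ℝ := (1 / 4) * Laplacian.laplacian u z

/-- `L` is the (normalized) Laplacian of `φ` in the sense of distributions. -/
def IsDistribLaplacian (φ L : ℂ → ℝ) : Prop :=
  LocallyIntegrable φ ∧ LocallyIntegrable L ∧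
    ∀ η : ℂ → ℝ, ContDiff ℝ ∞ η → HasCompactSupport η →
      ∫ z, φ z * quarterLaplacian η z = ∫ z, L z * η z

/-- Real-valued subharmonic functions on `ℂ`: upper semicontinuous with the sub-mean value
property on all circles. (Finite-valued subharmonic functions are integrable on every circle.) -/
def Subharmonic (φ : ℂ → ℝ) : Prop :=
  UpperSemicontinuous φ ∧
    ∀ (c : ℂ) (R : ℝ), 0 < R → CircleIntegrable φ c R ∧ φ c ≤ Real.circleAverage φ c R

/-- Compatibility of `(Λ, m_Λ)` and `φ`: the distributional Laplacian of `φ` is a function bounded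
above and below by positive constants; if `n_Λ ≥ 2`, moreover `φ` is of class `C^{n_Λ + 1}` and
`∂^j Δφ` is bounded for `1 ≤ j ≤ n_Λ - 1`. -/
def Compatible (Λ : MultSet) (φ : ℂ → ℝ) : Prop :=
  (∃ L : ℂ → ℝ, IsDistribLaplacian φ L ∧
    ∃ c C : ℝ, 0 < c ∧ ∀ z, c < L z ∧ L z < C) ∧
  (2 ≤ Λ.n → ContDiff ℝ ((Λ.n + 1 : ℕ) : ℕ∞) φ ∧
    ∀ j : ℕ, 1 ≤ j → j ≤ Λ.n - 1 →
      ∃ C : ℝ, ∀ z, ‖wirtinger^[j] (fun w => (quarterLaplacian φ w : ℂ)) z‖ ≤ C)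

/-- Membership in the weighted Fock space: entire functions with
`∫ |f|² e^{-φ} dA < ∞`. -/
def MemFock (φ : ℂ → ℝ) (f : ℂ → ℂ) : Prop :=
  Differentiable ℂ f ∧ Integrable fun z => ‖f z‖ ^ 2 * Real.exp (-φ z)

/-- The squared norm `‖f‖_φ² = ∫ |f|² e^{-φ} dA`. -/
def fockNormSq (φ : ℂ → ℝ) (f : ℂ → ℂ) : ℝ := ∫ z, ‖f z‖ ^ 2 * Real.exp (-φ z)

/-- `∑_{j < m_Λ(λ)} |(∂̄*_φ)^j f(λ)|² e^{-φ(λ)}`, the contribution of one point `λ ∈ Λ`. -/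
def MultSet.sampleEnergy (Λ : MultSet) (φ : ℂ → ℝ) (f : ℂ → ℂ) (p : Λ.carrier) : ℝ :=
  ∑ j ∈ Finset.range (Λ.mult p), ‖(dbarStar φ)^[j] f p‖ ^ 2 * Real.exp (-φ p)

/-- `(Λ, m_Λ)` is a sampling set for the Fock space with weight `φ`. -/
def IsSampling (Λ : MultSet) (φ : ℂ → ℝ) : Prop :=
  ∃ A B : ℝ, 0 < A ∧ 0 < B ∧ ∀ f : ℂ → ℂ, MemFock φ f →
    Summable (Λ.sampleEnergy φ f) ∧
    A * fockNormSq φ f ≤ ∑' p, Λ.sampleEnergy φ f p ∧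
    ∑' p, Λ.sampleEnergy φ f p ≤ B * fockNormSq φ f

end FockSampling

end

/-!
Near each point `a` the Cauchy transform of a cutoff of `Δφ` solves `∂̄ c = Δφ`, and correcting it
by a polynomial gives `φ = Re g + p` on the unit disc around `a`, with `g` holomorphic, `p` bounded
independently of `a` and all pure `∂`-derivatives of `p` vanishing at `a`. Multiplying `f` by
`e^{-g/2}` thus turns the numbers `(∂̄*_φ)^j f(a)` into Taylor coefficients of a holomorphic
function, so Cauchy's estimates apply with constants independent of `a`. This gives the upper
inequality, and on a disc of radius `ε` around `λ ∈ Λ` it bounds `|f|² e^{-φ}` by the samples at `λ`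
plus `ε^{2 m_Λ(λ)}` times a local norm of `f`.

For the lower inequality, add to `φ` a sum of truncated logarithms `v = ∑ m_Λ(λ) G(|z - λ|²)`. The
density hypothesis leaves room to take `e^{-G}` of size only `ε^{-2κ}` near `λ`, with `κ < 1`, and
still have `Δ(φ + v) ≤ -δ/2` off the discs of radius `ε`. Integrate `|f|² e^{-φ-v}`, whose Laplacian
is at least `-Δ(φ + v)` times itself, against a cutoff at scale `ℓ` and let `ℓ → ∞`: the norm of `f`
is controlled by the discs. On these `Δ(φ + v) = O(ε⁻²)`, which the area `πε²` compensates, and the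
factor `ε^{2 m_Λ(λ)}` above beats `e^{-v}`, so for small `ε` only the samples remain.
-/

noncomputable section

namespace FockSampling

open Filter Topology ComplexConjugate

/-- The Wirtinger derivative `∂̄ = (∂_x + i ∂_y) / 2`, companion of `wirtinger`. -/
def dbar (f : ℂ → ℂ) (z : ℂ) : ℂ :=
  (1 / 2) * (fderiv ℝ f z 1 + Complex.I * fderiv ℝ f z Complex.I)

lemma wirtinger_congr {f g : ℂ → ℂ} {z : ℂ} (h : f =ᶠ[𝓝 z] g) : wirtinger f z = wirtinger g z := by
  simp only [wirtinger, h.fderiv_eq]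

lemma wirtinger_eventuallyEq {f g : ℂ → ℂ} {z : ℂ} (h : f =ᶠ[𝓝 z] g) :
    wirtinger f =ᶠ[𝓝 z] wirtinger g := by
  filter_upwards [h.eventuallyEq_nhds] with w hw using wirtinger_congr hw

lemma wirtinger_iterate_eventuallyEq {f g : ℂ → ℂ} {z : ℂ} (h : f =ᶠ[𝓝 z] g) (j : ℕ) :
    wirtinger^[j] f =ᶠ[𝓝 z] wirtinger^[j] g := by
  induction j with
  | zero => exact h
  | succ j ih =>
    simp only [Function.iterate_succ_apply']
    exact wirtinger_eventuallyEq ih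

lemma fderiv_apply_eq_wirtinger_add_dbar (f : ℂ → ℂ) (z v : ℂ) :
    fderiv ℝ f z v = wirtinger f z * v + dbar f z * conj v := by
  have hv : fderiv ℝ f z v = v.re * fderiv ℝ f z 1 + v.im * fderiv ℝ f z Complex.I := by
    have hdecomp : v = v.re • (1 : ℂ) + v.im • Complex.I := by simp
    conv_lhs => rw [hdecomp, map_add, map_smul, map_smul, Complex.real_smul, Complex.real_smul]
  have hconj : conj v = v.re - v.im * Complex.I := Complex.ext (by simp) (by simp)
  rw [hv, wirtinger, dbar, hconj]
  nth_rewrite 3 [← Complex.re_add_im v]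
  linear_combination (v.im * fderiv ℝ f z Complex.I) * Complex.I_mul_I

lemma fderiv_const_mul_apply (c : ℂ) (f : ℂ → ℂ) (z v : ℂ) :
    fderiv ℝ (fun w => c * f w) z v = c * fderiv ℝ f z v := by
  have h : fderiv ℝ (fun w => c * f w) z = c • fderiv ℝ f z :=
    congrFun (fderiv_const_smul_field (𝕜 := ℝ) (f := f) c) z
  simp only [h, _root_.smul_apply, smul_eq_mul]

lemma wirtinger_const_mul (c : ℂ) (f : ℂ → ℂ) (z : ℂ) :
    wirtinger (fun w => c * f w) z = c * wirtinger f z := by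
  simp only [wirtinger, fderiv_const_mul_apply]
  ring

lemma dbar_const_mul (c : ℂ) (f : ℂ → ℂ) (z : ℂ) :
    dbar (fun w => c * f w) z = c * dbar f z := by
  simp only [dbar, fderiv_const_mul_apply]
  ring

lemma wirtinger_neg (f : ℂ → ℂ) (z : ℂ) : wirtinger (fun w => -f w) z = -wirtinger f z := by
  simpa using wirtinger_const_mul (-1) f z

section Leibniz

variable {f g : ℂ → ℂ} {z : ℂ} (hf : DifferentiableAt ℝ f z) (hg : DifferentiableAt ℝ g z)
include hf hg

lemma wirtinger_add : wirtinger (fun w => f w + g w) z = wirtinger f z + wirtinger g z := by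
  simp only [wirtinger, fderiv_fun_add hf hg, _root_.add_apply]
  ring

lemma dbar_sub : dbar (fun w => f w - g w) z = dbar f z - dbar g z := by
  simp only [dbar, fderiv_fun_sub hf hg, _root_.sub_apply]
  ring

lemma wirtinger_mul :
    wirtinger (fun w => f w * g w) z = wirtinger f z * g z + f z * wirtinger g z := by
  simp only [wirtinger, fderiv_fun_mul hf hg, _root_.add_apply, _root_.smul_apply, smul_eq_mul]
  ring

lemma dbar_mul : dbar (fun w => f w * g w) z = dbar f z * g z + f z * dbar g z := by
  simp only [dbar, fderiv_fun_mul hf hg, _root_.add_apply, _root_.smul_apply, smul_eq_mul]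
  ring

end Leibniz

lemma wirtinger_cexp {g : ℂ → ℂ} {z : ℂ} (hg : DifferentiableAt ℝ g z) :
    wirtinger (fun w => Complex.exp (g w)) z = Complex.exp (g z) * wirtinger g z := by
  simp only [wirtinger, hg.hasFDerivAt.cexp.fderiv, _root_.smul_apply, smul_eq_mul]
  ring

section Holomorphic

variable {f : ℂ → ℂ} {z : ℂ}

lemma fderiv_real_apply_of_holomorphic (hf : DifferentiableAt ℂ f z) (v : ℂ) :
    fderiv ℝ f z v = v * deriv f z := by
  have h : fderiv ℝ f z = (fderiv ℂ f z).restrictScalars ℝ := hf.fderiv_restrictScalars ℝ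
  simp [h]

lemma wirtinger_holomorphic (hf : DifferentiableAt ℂ f z) : wirtinger f z = deriv f z := by
  simp only [wirtinger, fderiv_real_apply_of_holomorphic hf]
  linear_combination (-(1 / 2) * deriv f z) * Complex.I_mul_I

lemma dbar_holomorphic (hf : DifferentiableAt ℂ f z) : dbar f z = 0 := by
  simp only [dbar, fderiv_real_apply_of_holomorphic hf]
  linear_combination ((1 / 2) * deriv f z) * Complex.I_mul_I

lemma fderiv_conj_comp_apply (hf : DifferentiableAt ℝ f z) (v : ℂ) :
    fderiv ℝ (fun w => conj (f w)) z v = conj (fderiv ℝ f z v) := by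
  have h : HasFDerivAt (fun w => conj (f w))
      ((Complex.conjCLE : ℂ →L[ℝ] ℂ).comp (fderiv ℝ f z)) z :=
    (Complex.conjCLE : ℂ →L[ℝ] ℂ).hasFDerivAt.comp z hf.hasFDerivAt
  simp [h.fderiv]

lemma wirtinger_conj_comp (hf : DifferentiableAt ℝ f z) :
    wirtinger (fun w => conj (f w)) z = conj (dbar f z) := by
  simp [wirtinger, dbar, fderiv_conj_comp_apply hf, sub_eq_add_neg, map_ofNat]

lemma dbar_conj_comp (hf : DifferentiableAt ℝ f z) :
    dbar (fun w => conj (f w)) z = conj (wirtinger f z) := by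
  simp [wirtinger, dbar, fderiv_conj_comp_apply hf, sub_eq_add_neg, map_ofNat]

lemma differentiableAt_conj_comp (hf : DifferentiableAt ℝ f z) :
    DifferentiableAt ℝ (fun w => conj (f w)) z :=
  (Complex.conjCLE : ℂ →L[ℝ] ℂ).differentiableAt.comp z hf

lemma differentiableAt_of_dbar_eq_zero (hf : DifferentiableAt ℝ f z) (hdbar : dbar f z = 0) :
    DifferentiableAt ℂ f z := by
  refine (differentiableAt_iff_restrictScalars ℝ hf).2
    ⟨wirtinger f z • ContinuousLinearMap.id ℂ ℂ, ?_⟩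
  ext v
  simp [fderiv_apply_eq_wirtinger_add_dbar f z v, hdbar]

end Holomorphic

section RealValued

variable {u : ℂ → ℝ} {z : ℂ}

lemma fderiv_ofReal_comp (hu : DifferentiableAt ℝ u z) (v : ℂ) :
    fderiv ℝ (fun w => (u w : ℂ)) z v = (fderiv ℝ u z v : ℂ) := by
  have h : HasFDerivAt (fun w => (u w : ℂ)) (Complex.ofRealCLM.comp (fderiv ℝ u z)) z :=
    Complex.ofRealCLM.hasFDerivAt.comp z hu.hasFDerivAt
  simp [h.fderiv]

lemma differentiableAt_ofReal_comp (hu : DifferentiableAt ℝ u z) :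
    DifferentiableAt ℝ (fun w => (u w : ℂ)) z :=
  Complex.ofRealCLM.differentiableAt.comp z hu

lemma wirtinger_ofReal (hu : DifferentiableAt ℝ u z) :
    wirtinger (fun w => (u w : ℂ)) z =
      (1 / 2) * ((fderiv ℝ u z 1 : ℂ) - Complex.I * (fderiv ℝ u z Complex.I : ℂ)) := by
  rw [wirtinger, fderiv_ofReal_comp hu, fderiv_ofReal_comp hu]

lemma dbar_ofReal (hu : DifferentiableAt ℝ u z) :
    dbar (fun w => (u w : ℂ)) z = conj (wirtinger (fun w => (u w : ℂ)) z) := by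
  simp [wirtinger_ofReal hu, dbar, fderiv_ofReal_comp hu, map_ofNat]

lemma fderiv_apply_eq_re_wirtinger (hu : DifferentiableAt ℝ u z) (v : ℂ) :
    fderiv ℝ u z v = (2 * wirtinger (fun w => (u w : ℂ)) z * v).re := by
  have h : (fderiv ℝ u z v : ℂ) = wirtinger (fun w => (u w : ℂ)) z * v +
      conj (wirtinger (fun w => (u w : ℂ)) z * v) := by
    rw [← fderiv_ofReal_comp hu, fderiv_apply_eq_wirtinger_add_dbar, dbar_ofReal hu, map_mul]
  rw [Complex.add_conj, Complex.ofReal_inj] at h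
  rw [h, mul_assoc, Complex.mul_re]
  simp

lemma wirtinger_real_comp {G : ℝ → ℝ} (hG : DifferentiableAt ℝ G (u z))
    (hu : DifferentiableAt ℝ u z) :
    wirtinger (fun w => (G (u w) : ℂ)) z =
      ((deriv G (u z) : ℝ) : ℂ) * wirtinger (fun w => (u w : ℂ)) z := by
  have hcomp : HasFDerivAt (fun w => G (u w)) (deriv G (u z) • fderiv ℝ u z) z :=
    hG.hasDerivAt.comp_hasFDerivAt z hu.hasFDerivAt
  rw [wirtinger_ofReal hcomp.differentiableAt, wirtinger_ofReal hu, hcomp.fderiv]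
  simp only [_root_.smul_apply, smul_eq_mul, Complex.ofReal_mul]
  ring

lemma dbar_real_comp {G : ℝ → ℝ} (hG : DifferentiableAt ℝ G (u z))
    (hu : DifferentiableAt ℝ u z) :
    dbar (fun w => (G (u w) : ℂ)) z = ((deriv G (u z) : ℝ) : ℂ) * dbar (fun w => (u w : ℂ)) z := by
  rw [dbar_ofReal (u := fun w => G (u w)) (hG.comp z hu), wirtinger_real_comp hG hu, dbar_ofReal hu]
  simp

end RealValued

lemma contDiff_ofReal_comp {u : ℂ → ℝ} {n : WithTop ℕ∞} (hu : ContDiff ℝ n u) :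
    ContDiff ℝ n fun w => (u w : ℂ) :=
  Complex.ofRealCLM.contDiff.comp hu

section Regularity

variable {f : ℂ → ℂ} {z : ℂ} {n m : WithTop ℕ∞}

lemma contDiffAt_wirtinger (hf : ContDiffAt ℝ n f z) (hmn : m + 1 ≤ n) :
    ContDiffAt ℝ m (wirtinger f) z := by
  have h : ContDiffAt ℝ m (fderiv ℝ f) z := hf.fderiv_right hmn
  exact contDiffAt_const.mul ((h.clm_apply contDiffAt_const).sub
    (contDiffAt_const.mul (h.clm_apply contDiffAt_const)))

lemma contDiff_wirtinger (hf : ContDiff ℝ n f) (hmn : m + 1 ≤ n) : ContDiff ℝ m (wirtinger f) :=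
  contDiff_iff_contDiffAt.2 fun _ => contDiffAt_wirtinger hf.contDiffAt hmn

lemma contDiff_dbar (hf : ContDiff ℝ n f) (hmn : m + 1 ≤ n) : ContDiff ℝ m (dbar f) := by
  have h : ContDiff ℝ m (fderiv ℝ f) := hf.fderiv_right hmn
  exact contDiff_const.mul ((h.clm_apply contDiff_const).add
    (contDiff_const.mul (h.clm_apply contDiff_const)))

lemma contDiffAt_wirtinger_iterate {k j : ℕ} (hf : ContDiffAt ℝ (k + j : ℕ) f z) :
    ContDiffAt ℝ k (wirtinger^[j] f) z := by
  induction j generalizing f with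
  | zero => exact hf
  | succ j ih =>
    rw [Function.iterate_succ_apply]
    exact ih (contDiffAt_wirtinger hf (by norm_cast))

lemma eventually_differentiableAt (hf : ContDiffAt ℝ n f z) (hn : 1 ≤ n) :
    ∀ᶠ w in 𝓝 z, DifferentiableAt ℝ f w := by
  filter_upwards [(hf.of_le hn).eventually (by simp)] with w hw using hw.differentiableAt (by simp)

lemma hasCompactSupport_wirtinger (hf : HasCompactSupport f) :
    HasCompactSupport (wirtinger f) :=
  HasCompactSupport.intro hf fun z hz => by
    simp [wirtinger, (notMem_tsupport_iff_eventuallyEq.1 hz).fderiv_eq]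

end Regularity

section QuarterLaplacian

lemma dbar_wirtinger {f : ℂ → ℂ} {z : ℂ} (hf : ContDiffAt ℝ 2 f z) :
    dbar (wirtinger f) z = (1 / 4) * Laplacian.laplacian f z := by
  have hD2 : HasFDerivAt (fderiv ℝ f) (fderiv ℝ (fderiv ℝ f) z) z :=
    ((hf.fderiv_right (m := 1) (by norm_num)).differentiableAt (by simp)).hasFDerivAt
  have hD2_apply (v : ℂ) : HasFDerivAt (fun w => fderiv ℝ f w v)
      ((fderiv ℝ (fderiv ℝ f) z).flip v) z := by
    simpa using hD2.clm_apply (hasFDerivAt_const v z)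
  have hwirtinger : HasFDerivAt (wirtinger f) _ z :=
    ((hD2_apply 1).sub ((hD2_apply Complex.I).const_mul Complex.I)).const_mul (1 / 2)
  have hsymm : fderiv ℝ (fderiv ℝ f) z Complex.I 1 = fderiv ℝ (fderiv ℝ f) z 1 Complex.I :=
    (hf.isSymmSndFDerivAt (by simp)).eq _ _
  rw [dbar, hwirtinger.fderiv, InnerProductSpace.laplacian_eq_iteratedFDeriv_complexPlane]
  simp only [_root_.smul_apply, _root_.sub_apply, ContinuousLinearMap.flip_apply, smul_eq_mul,
    hsymm, iteratedFDeriv_two_apply, Matrix.cons_val_zero, Matrix.cons_val_one]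
  linear_combination (-(1 / 4) * fderiv ℝ (fderiv ℝ f) z Complex.I Complex.I) * Complex.I_mul_I

lemma dbar_wirtinger_ofReal {u : ℂ → ℝ} {z : ℂ} (hu : ContDiffAt ℝ 2 u z) :
    dbar (wirtinger fun w => (u w : ℂ)) z = quarterLaplacian u z := by
  have hu' : ContDiffAt ℝ 2 (fun w => (u w : ℂ)) z :=
    Complex.ofRealCLM.contDiff.contDiffAt.comp z hu
  have h : Laplacian.laplacian (fun w => (u w : ℂ)) z = (Laplacian.laplacian u z : ℝ) :=
    hu.laplacian_CLM_comp_left (l := Complex.ofRealCLM)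
  rw [dbar_wirtinger hu', h, quarterLaplacian]
  push_cast
  ring

lemma contDiff_quarterLaplacian {u : ℂ → ℝ} {n m : WithTop ℕ∞} (hu : ContDiff ℝ n u)
    (hmn : m + 2 ≤ n) : ContDiff ℝ m (quarterLaplacian u) := by
  have h2 : ContDiff ℝ 2 u := hu.of_le (le_add_self.trans hmn)
  have heq : quarterLaplacian u = fun z => (dbar (wirtinger fun w => (u w : ℂ)) z).re := by
    ext z
    rw [dbar_wirtinger_ofReal h2.contDiffAt, Complex.ofReal_re]
  rw [heq]
  refine Complex.reCLM.contDiff.comp (contDiff_dbar (n := m + 1) ?_ le_rfl)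
  exact contDiff_wirtinger (contDiff_ofReal_comp hu) (by rwa [add_assoc, one_add_one_eq_two])

lemma continuous_quarterLaplacian {u : ℂ → ℝ} (hu : ContDiff ℝ 2 u) :
    Continuous (quarterLaplacian u) :=
  (contDiff_quarterLaplacian (m := 0) hu (by simp)).continuous

lemma hasCompactSupport_quarterLaplacian {u : ℂ → ℝ} (hu : HasCompactSupport u) :
    HasCompactSupport (quarterLaplacian u) :=
  HasCompactSupport.intro hu fun z hz => by
    have h : u =ᶠ[𝓝 z] fun _ => 0 := notMem_tsupport_iff_eventuallyEq.1 hz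
    simp [quarterLaplacian, (InnerProductSpace.laplacian_congr_nhds h).eq_of_nhds]

lemma quarterLaplacian_add {u v : ℂ → ℝ} {z : ℂ} (hu : ContDiffAt ℝ 2 u z)
    (hv : ContDiffAt ℝ 2 v z) :
    quarterLaplacian (fun w => u w + v w) z = quarterLaplacian u z + quarterLaplacian v z := by
  have h : Laplacian.laplacian (fun w => u w + v w) z = _ := hu.laplacian_add hv
  simp only [quarterLaplacian, h, mul_add]

lemma quarterLaplacian_const_mul {u : ℂ → ℝ} {z : ℂ} (c : ℝ) (hu : ContDiffAt ℝ 2 u z) :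
    quarterLaplacian (fun w => c * u w) z = c * quarterLaplacian u z := by
  have h : Laplacian.laplacian (fun w => c * u w) z = c • Laplacian.laplacian u z :=
    InnerProductSpace.laplacian_smul c hu
  simp only [quarterLaplacian, h, smul_eq_mul, mul_left_comm]

lemma quarterLaplacian_sum {ι : Type*} (s : Finset ι) {u : ι → ℂ → ℝ} {z : ℂ}
    (hu : ∀ i ∈ s, ContDiffAt ℝ 2 (u i) z) :
    quarterLaplacian (fun w => ∑ i ∈ s, u i w) z = ∑ i ∈ s, quarterLaplacian (u i) z := by
  classical
  induction s using Finset.induction_on with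
  | empty => simp [quarterLaplacian]
  | insert a s ha ih =>
    simp only [Finset.sum_insert ha]
    rw [quarterLaplacian_add (hu a (by simp))
      (ContDiffAt.sum fun i hi => hu i (by simp [hi])), ih fun i hi => hu i (by simp [hi])]

lemma fderiv_comp_affine_apply {F : ℂ → ℂ} (hF : Differentiable ℝ F) (c : ℝ) (a z v : ℂ) :
    fderiv ℝ (fun w => F (c • w + a)) z v = c * fderiv ℝ F (c • z + a) v := by
  have haffine : HasFDerivAt (fun w : ℂ => c • w + a) (c • ContinuousLinearMap.id ℝ ℂ) z :=
    ((hasFDerivAt_id z).const_smul c).add_const a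
  have h : HasFDerivAt (fun w => F (c • w + a)) _ z := (hF _).hasFDerivAt.comp z haffine
  rw [h.fderiv, ContinuousLinearMap.comp_apply, _root_.smul_apply, map_smul,
    ContinuousLinearMap.id_apply, Complex.real_smul]

lemma wirtinger_comp_affine {F : ℂ → ℂ} (hF : Differentiable ℝ F) (c : ℝ) (a z : ℂ) :
    wirtinger (fun w => F (c • w + a)) z = c * wirtinger F (c • z + a) := by
  simp only [wirtinger, fderiv_comp_affine_apply hF]
  ring

lemma dbar_comp_affine {F : ℂ → ℂ} (hF : Differentiable ℝ F) (c : ℝ) (a z : ℂ) :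
    dbar (fun w => F (c • w + a)) z = c * dbar F (c • z + a) := by
  simp only [dbar, fderiv_comp_affine_apply hF]
  ring

lemma quarterLaplacian_comp_affine {u : ℂ → ℝ} (hu : ContDiff ℝ 2 u) (c : ℝ) (a z : ℂ) :
    quarterLaplacian (fun w => u (c • w + a)) z = c ^ 2 * quarterLaplacian u (c • z + a) := by
  have hu' : ContDiff ℝ 2 fun w => (u w : ℂ) := contDiff_ofReal_comp hu
  have hdiff : Differentiable ℝ (wirtinger fun w => (u w : ℂ)) :=
    (contDiff_wirtinger (m := 1) hu' (by norm_num)).differentiable (by simp)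
  have hdiff' : Differentiable ℝ fun w => (c : ℂ) * wirtinger (fun w => (u w : ℂ)) w :=
    hdiff.const_mul _
  have hcomp : ContDiff ℝ 2 fun w => u (c • w + a) :=
    hu.comp ((contDiff_id.const_smul c).add contDiff_const)
  have hwirtinger : (wirtinger fun w => (u (c • w + a) : ℂ)) =
      fun w => c * wirtinger (fun w => (u w : ℂ)) (c • w + a) :=
    funext fun w => wirtinger_comp_affine (hu'.differentiable (by simp)) c a w
  rw [← Complex.ofReal_inj, ← dbar_wirtinger_ofReal hcomp.contDiffAt, hwirtinger,
    dbar_comp_affine hdiff', dbar_const_mul]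
  rw [dbar_wirtinger_ofReal hu.contDiffAt]
  push_cast
  ring

lemma wirtinger_norm_sub_sq (a z : ℂ) :
    wirtinger (fun w => ((‖w - a‖ ^ 2 : ℝ) : ℂ)) z = conj (z - a) := by
  have hid : DifferentiableAt ℂ (fun w => w - a) z := differentiableAt_id.sub_const a
  have heq : (fun w => ((‖w - a‖ ^ 2 : ℝ) : ℂ)) = fun w => (w - a) * conj (w - a) := by
    ext w
    rw [Complex.mul_conj, Complex.sq_norm]
  have hid' := hid.restrictScalars ℝ
  rw [heq, wirtinger_mul hid' (differentiableAt_conj_comp hid'), wirtinger_conj_comp hid',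
    dbar_holomorphic hid, wirtinger_holomorphic hid]
  simp

/-- With `t = |z - a|²`, this is `∂̄ (G'(t) conj (z - a)) = G''(t) |z - a|² + G'(t)`. -/
lemma quarterLaplacian_radial {G : ℝ → ℝ} (hG : ContDiff ℝ 2 G) (a z : ℂ) :
    quarterLaplacian (fun w => G (‖w - a‖ ^ 2)) z =
      deriv G (‖z - a‖ ^ 2) + ‖z - a‖ ^ 2 * deriv (deriv G) (‖z - a‖ ^ 2) := by
  have hnorm : ContDiff ℝ 2 fun w : ℂ => ‖w - a‖ ^ 2 := (contDiff_id.sub contDiff_const).norm_sq ℝ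
  have hcomp : ContDiff ℝ 2 fun w => G (‖w - a‖ ^ 2) := hG.comp hnorm
  have hnormd := hnorm.differentiable (by simp)
  have hG' : ContDiff ℝ 1 (deriv G) := ((contDiff_succ_iff_deriv (n := 1)).1 hG).2.2
  have hG'd := hG'.differentiable (by simp)
  have hwirtinger : (wirtinger fun w => (G (‖w - a‖ ^ 2) : ℂ)) =
      fun w => ((deriv G (‖w - a‖ ^ 2) : ℝ) : ℂ) * conj (w - a) := by
    ext w
    rw [wirtinger_real_comp (u := fun w => ‖w - a‖ ^ 2) (hG.differentiable (by simp) _) (hnormd w),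
      wirtinger_norm_sub_sq]
  have hid : DifferentiableAt ℂ (fun w => w - a) z := differentiableAt_id.sub_const a
  have hid' := hid.restrictScalars ℝ
  have hG'comp : DifferentiableAt ℝ (fun w => ((deriv G (‖w - a‖ ^ 2) : ℝ) : ℂ)) z :=
    differentiableAt_ofReal_comp ((hG'd _).comp z (hnormd z))
  rw [← Complex.ofReal_inj, ← dbar_wirtinger_ofReal hcomp.contDiffAt, hwirtinger,
    dbar_mul hG'comp (differentiableAt_conj_comp hid'), dbar_conj_comp hid',
    dbar_real_comp (u := fun w => ‖w - a‖ ^ 2) (hG'd _) (hnormd z), dbar_ofReal (hnormd z),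
    wirtinger_norm_sub_sq, wirtinger_holomorphic hid]
  have hsq : ((‖z - a‖ ^ 2 : ℝ) : ℂ) = (z - a) * conj (z - a) := by
    rw [Complex.mul_conj, Complex.sq_norm]
  push_cast at hsq ⊢
  rw [hsq]
  simp
  ring

end QuarterLaplacian

section PureDerivatives

variable {z : ℂ}

lemma wirtinger_iterate_add {i : ℕ} {u v : ℂ → ℂ} (hu : ContDiffAt ℝ i u z)
    (hv : ContDiffAt ℝ i v z) :
    wirtinger^[i] (fun w => u w + v w) z = wirtinger^[i] u z + wirtinger^[i] v z := by
  induction i generalizing u v with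
  | zero => rfl
  | succ i ih =>
    simp only [Function.iterate_succ_apply]
    have hwirtinger : wirtinger (fun w => u w + v w) =ᶠ[𝓝 z]
        fun w => wirtinger u w + wirtinger v w := by
      filter_upwards [eventually_differentiableAt hu (by simp),
        eventually_differentiableAt hv (by simp)] with w h1 h2 using wirtinger_add h1 h2
    rw [(wirtinger_iterate_eventuallyEq hwirtinger i).eq_of_nhds]
    exact ih (contDiffAt_wirtinger hu (by simp)) (contDiffAt_wirtinger hv (by simp))

lemma wirtinger_iterate_mul_eq_zero {k : ℕ} {a b : ℂ → ℂ} (ha : ContDiffAt ℝ k a z)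
    (hb : ContDiffAt ℝ k b z) (hzero : ∀ i ≤ k, wirtinger^[i] a z = 0) :
    ∀ i ≤ k, wirtinger^[i] (fun w => a w * b w) z = 0 := by
  induction k generalizing a b with
  | zero =>
    intro i hi
    obtain rfl : i = 0 := by omega
    have ha0 : a z = 0 := hzero 0 le_rfl
    simp [ha0]
  | succ k ih =>
    intro i hi
    have ha' : ContDiffAt ℝ k a z := ha.of_le (by norm_cast; omega)
    have hb' : ContDiffAt ℝ k b z := hb.of_le (by norm_cast; omega)
    rcases i with _ | i
    · exact ih ha' hb' (fun i hi => hzero i (by omega)) 0 (by omega)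
    have hleibniz : wirtinger (fun w => a w * b w) =ᶠ[𝓝 z]
        fun w => wirtinger a w * b w + a w * wirtinger b w := by
      filter_upwards [eventually_differentiableAt ha (by simp),
        eventually_differentiableAt hb (by simp)] with w h1 h2 using wirtinger_mul h1 h2
    have hda : ContDiffAt ℝ k (wirtinger a) z := contDiffAt_wirtinger ha (by simp)
    have hdb : ContDiffAt ℝ k (wirtinger b) z := contDiffAt_wirtinger hb (by simp)
    have hik : (i : WithTop ℕ∞) ≤ k := by norm_cast; omega
    rw [Function.iterate_succ_apply, (wirtinger_iterate_eventuallyEq hleibniz i).eq_of_nhds,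
      wirtinger_iterate_add ((hda.mul hb').of_le hik) ((ha'.mul hdb).of_le hik),
      ih hda hb' (fun l hl => hzero (l + 1) (by omega)) i (by omega),
      ih ha' hdb (fun l hl => hzero l (by omega)) i (by omega), add_zero]

lemma wirtinger_iterate_conj_mul {h Q : ℂ → ℂ} {j : ℕ} (hh : AnalyticAt ℂ h z)
    (hQ : ContDiffAt ℝ j Q z) :
    wirtinger^[j] (fun w => conj (h w) * Q w) =ᶠ[𝓝 z] fun w => conj (h w) * wirtinger^[j] Q w := by
  induction j with
  | zero => exact EventuallyEq.rfl
  | succ j ih =>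
    simp only [Function.iterate_succ_apply']
    have hQ' : ContDiffAt ℝ (1 : ℕ) (wirtinger^[j] Q) z :=
      contDiffAt_wirtinger_iterate (by rwa [add_comm 1 j])
    refine (wirtinger_eventuallyEq (ih (hQ.of_le (by norm_cast; omega)))).trans ?_
    filter_upwards [hh.eventually_analyticAt, eventually_differentiableAt hQ' (by simp)]
      with w hhw hQw
    have hhw' := hhw.differentiableAt.restrictScalars ℝ
    rw [wirtinger_mul (differentiableAt_conj_comp hhw') hQw, wirtinger_conj_comp hhw',
      dbar_holomorphic hhw.differentiableAt, map_zero, zero_mul, zero_add]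

lemma wirtinger_exp_neg_mul {p : ℂ → ℂ} {F : ℂ → ℂ} (hp : DifferentiableAt ℝ p z)
    (hF : DifferentiableAt ℂ F z) :
    wirtinger (fun w => Complex.exp (-p w) * F w) z =
      Complex.exp (-p z) * deriv F z + wirtinger p z * -(Complex.exp (-p z) * F z) := by
  rw [wirtinger_mul (f := fun w => Complex.exp (-p w)) hp.neg.cexp (hF.restrictScalars ℝ),
    wirtinger_holomorphic hF,
    wirtinger_cexp (g := fun w => -p w) hp.neg, wirtinger_neg]
  ring

/-- Every `∂` falling on `e^{-p}` produces a factor `∂p`, whose pure `∂`-derivatives vanish at `z`;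
so only the terms with all derivatives on `F` survive. -/
lemma wirtinger_iterate_exp_neg_mul {p F : ℂ → ℂ} {n j : ℕ} (hp : ContDiffAt ℝ n p z)
    (hzero : ∀ i < n, wirtinger^[i] (wirtinger p) z = 0) (hj : j ≤ n) (hF : AnalyticAt ℂ F z) :
    wirtinger^[j] (fun w => Complex.exp (-p w) * F w) z =
      Complex.exp (-p z) * iteratedDeriv j F z := by
  induction j generalizing F with
  | zero => simp
  | succ j ih =>
    have hF' : ContDiffAt ℝ n F z := hF.contDiffAt.restrict_scalars ℝ
    have hdF : ContDiffAt ℝ n (deriv F) z := hF.deriv.contDiffAt.restrict_scalars ℝ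
    have hexp : ContDiffAt ℝ n (fun w => Complex.exp (-p w)) z :=
      Complex.contDiff_exp.contDiffAt.comp z hp.neg
    have hdp : ContDiffAt ℝ j (wirtinger p) z := contDiffAt_wirtinger hp (by norm_cast)
    have hjn : (j : WithTop ℕ∞) ≤ n := by norm_cast; omega
    have hn : (1 : WithTop ℕ∞) ≤ n := by norm_cast; omega
    have hleibniz : wirtinger (fun w => Complex.exp (-p w) * F w) =ᶠ[𝓝 z] fun w =>
        Complex.exp (-p w) * deriv F w + wirtinger p w * -(Complex.exp (-p w) * F w) := by
      filter_upwards [eventually_differentiableAt hp hn, hF.eventually_analyticAt]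
        with w hpw hFw using wirtinger_exp_neg_mul hpw hFw.differentiableAt
    rw [Function.iterate_succ_apply, (wirtinger_iterate_eventuallyEq hleibniz j).eq_of_nhds,
      wirtinger_iterate_add ((hexp.mul hdF).of_le hjn) (hdp.mul ((hexp.mul hF').neg.of_le hjn)),
      wirtinger_iterate_mul_eq_zero hdp ((hexp.mul hF').neg.of_le hjn)
        (fun i hi => hzero i (by omega)) j le_rfl, add_zero, ih (by omega) hF.deriv,
      iteratedDeriv_succ']

end PureDerivatives

section Gauge

lemma dbarStar_iterate (φ : ℂ → ℝ) (f : ℂ → ℂ) (j : ℕ) (z : ℂ) :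
    (dbarStar φ)^[j] f z = (-1) ^ j * (Real.exp (φ z) : ℂ) *
      wirtinger^[j] (fun w => (Real.exp (-φ w) : ℂ) * f w) z := by
  have hexp (w : ℂ) : (Real.exp (-φ w) : ℂ) * (Real.exp (φ w) : ℂ) = 1 := by
    rw [← Complex.ofReal_mul, ← Real.exp_add]
    simp
  induction j generalizing z with
  | zero => simp [← mul_assoc, ← Complex.exp_add]
  | succ j ih =>
    have hweight : (fun w => (Real.exp (-φ w) : ℂ) * (dbarStar φ)^[j] f w) = fun w =>
        (-1) ^ j * wirtinger^[j] (fun w => (Real.exp (-φ w) : ℂ) * f w) w := by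
      ext w
      rw [ih w]
      linear_combination
        ((-1) ^ j * wirtinger^[j] (fun w => (Real.exp (-φ w) : ℂ) * f w) w) * hexp w
    rw [Function.iterate_succ_apply', dbarStar, hweight, wirtinger_const_mul,
      Function.iterate_succ_apply']
    ring

/-- The factor by which one multiplies entire functions to pass from the weight `Re h` to the
weight `0`. -/
def gaugeFactor (h : ℂ → ℂ) (w : ℂ) : ℂ := Complex.exp (-h w / 2)

lemma analyticAt_gaugeFactor {h : ℂ → ℂ} {z : ℂ} (hh : AnalyticAt ℂ h z) :
    AnalyticAt ℂ (gaugeFactor h) z :=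
  (hh.neg.div analyticAt_const (by norm_num)).cexp

lemma norm_gaugeFactor (h : ℂ → ℂ) (w : ℂ) : ‖gaugeFactor h w‖ = Real.exp (-(h w).re / 2) := by
  rw [gaugeFactor, Complex.norm_exp]
  simp

lemma exp_neg_eq_conj_gaugeFactor_mul (φ : ℂ → ℝ) (h : ℂ → ℂ) (w : ℂ) :
    (Real.exp (-φ w) : ℂ) = conj (gaugeFactor h w) *
      (Complex.exp (-((φ w - (h w).re : ℝ) : ℂ)) * gaugeFactor h w) := by
  have hconj : conj (h w) = 2 * ((h w).re : ℂ) - h w := by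
    have hadd := Complex.add_conj (h w)
    push_cast at hadd
    linear_combination hadd
  simp only [gaugeFactor]
  rw [← Complex.exp_conj, ← Complex.exp_add, ← Complex.exp_add, Complex.ofReal_exp]
  simp only [map_div₀, map_neg, hconj, map_ofNat]
  congr 1
  push_cast
  ring

/-- A gauge `φ = Re h + p` with vanishing pure `∂`-derivatives of `p` at `z` turns `(∂̄*_φ)^j` at
`z` into ordinary complex differentiation. -/
lemma sq_norm_dbarStar_iterate_of_gauge {z : ℂ} {φ : ℂ → ℝ} {h f : ℂ → ℂ} {n j : ℕ}
    (hφ : ContDiffAt ℝ n φ z) (hh : AnalyticAt ℂ h z) (hf : AnalyticAt ℂ f z)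
    (h0 : φ z = (h z).re)
    (hzero : ∀ i < n, wirtinger^[i] (wirtinger fun w => ((φ w - (h w).re : ℝ) : ℂ)) z = 0)
    (hj : j ≤ n) :
    ‖(dbarStar φ)^[j] f z‖ ^ 2 * Real.exp (-φ z) =
      ‖iteratedDeriv j (fun w => f w * gaugeFactor h w) z‖ ^ 2 := by
  set F := fun w => f w * gaugeFactor h w
  have hE := analyticAt_gaugeFactor hh
  have hF : AnalyticAt ℂ F z := hf.mul hE
  have hp : ContDiffAt ℝ n (fun w => ((φ w - (h w).re : ℝ) : ℂ)) z :=
    Complex.ofRealCLM.contDiff.contDiffAt.comp z (hφ.sub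
      (Complex.reCLM.contDiff.contDiffAt.comp z (hh.contDiffAt.restrict_scalars ℝ)))
  have hexpF : ContDiffAt ℝ n (fun w => Complex.exp (-((φ w - (h w).re : ℝ) : ℂ)) * F w) z :=
    (Complex.contDiff_exp.contDiffAt.comp z hp.neg).mul (hF.contDiffAt.restrict_scalars ℝ)
  have hfactor : (fun w => (Real.exp (-φ w) : ℂ) * f w) = fun w =>
      conj (gaugeFactor h w) * (Complex.exp (-((φ w - (h w).re : ℝ) : ℂ)) * F w) := by
    ext w
    rw [exp_neg_eq_conj_gaugeFactor_mul φ h w]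
    ring
  rw [dbarStar_iterate, hfactor, (wirtinger_iterate_conj_mul hE
    (hexpF.of_le (by norm_cast))).eq_of_nhds, wirtinger_iterate_exp_neg_mul hp hzero hj hF]
  simp only [norm_mul, norm_pow, norm_neg, norm_one, one_pow, one_mul, RCLike.norm_conj,
    norm_gaugeFactor, h0, sub_self, Complex.ofReal_zero, neg_zero, Complex.exp_zero,
    Complex.norm_real, Real.norm_eq_abs, Real.abs_exp, mul_pow]
  have hexp : Real.exp (h z).re ^ 2 * Real.exp (-(h z).re / 2) ^ 2 * Real.exp (-(h z).re) = 1 := by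
    rw [← Real.exp_nat_mul, ← Real.exp_nat_mul, ← Real.exp_add, ← Real.exp_add,
      Real.exp_eq_one_iff]
    push_cast
    ring
  linear_combination ‖iteratedDeriv j F z‖ ^ 2 * hexp

end Gauge

section WeightedSquare

lemma contDiff_real_of_entire {f : ℂ → ℂ} (hf : Differentiable ℂ f) {n : WithTop ℕ∞} :
    ContDiff ℝ n f :=
  (hf.contDiff (n := n)).restrict_scalars ℝ

variable {f : ℂ → ℂ} {ψ : ℂ → ℝ} (hf : Differentiable ℂ f)
include hf

lemma wirtinger_weighted_sq {z : ℂ} (hψ : DifferentiableAt ℝ ψ z) :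
    wirtinger (fun w => ((‖f w‖ ^ 2 * Real.exp (-ψ w) : ℝ) : ℂ)) z =
      (deriv f z - f z * wirtinger (fun w => (ψ w : ℂ)) z) *
        (conj (f z) * Complex.exp (-(ψ z : ℂ))) := by
  have hfz := (hf z).restrictScalars ℝ
  have hψ' : DifferentiableAt ℝ (fun w => -(ψ w : ℂ)) z := (differentiableAt_ofReal_comp hψ).neg
  have hconj : DifferentiableAt ℝ (fun w => conj (f w) * Complex.exp (-(ψ w : ℂ))) z :=
    (differentiableAt_conj_comp hfz).mul hψ'.cexp
  have heq : (fun w => ((‖f w‖ ^ 2 * Real.exp (-ψ w) : ℝ) : ℂ)) =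
      fun w => f w * (conj (f w) * Complex.exp (-(ψ w : ℂ))) := by
    ext w
    rw [← mul_assoc, Complex.mul_conj, ← Complex.sq_norm]
    push_cast
    rfl
  rw [heq, wirtinger_mul hfz hconj, wirtinger_mul (differentiableAt_conj_comp hfz) hψ'.cexp,
    wirtinger_conj_comp hfz, dbar_holomorphic (hf z), wirtinger_holomorphic (hf z),
    wirtinger_cexp hψ', wirtinger_neg]
  simp only [map_zero]
  ring

omit hf in
lemma dbar_exp_neg_ofReal {z : ℂ} (hψ : DifferentiableAt ℝ ψ z) :
    dbar (fun w => Complex.exp (-(ψ w : ℂ))) z =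
      -conj (wirtinger (fun w => (ψ w : ℂ)) z) * Complex.exp (-(ψ z : ℂ)) := by
  have hcast (w : ℂ) : Complex.exp (-(ψ w : ℂ)) = ((Real.exp (-ψ w) : ℝ) : ℂ) := by push_cast; rfl
  simp only [hcast]
  rw [dbar_real_comp (G := fun t => Real.exp (-t)) (u := ψ) (by fun_prop) hψ, dbar_ofReal hψ]
  simp [deriv_comp_neg]
  ring

lemma quarterLaplacian_weighted_sq (hψ : ContDiff ℝ 2 ψ) (z : ℂ) :
    quarterLaplacian (fun w => ‖f w‖ ^ 2 * Real.exp (-ψ w)) z =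
      ‖deriv f z - f z * wirtinger (fun w => (ψ w : ℂ)) z‖ ^ 2 * Real.exp (-ψ z) -
        quarterLaplacian ψ z * (‖f z‖ ^ 2 * Real.exp (-ψ z)) := by
  have hψd : Differentiable ℝ ψ := hψ.differentiable (by simp)
  have hu : ContDiff ℝ 2 fun w => ‖f w‖ ^ 2 * Real.exp (-ψ w) :=
    ((contDiff_real_of_entire hf).norm_sq ℝ).mul hψ.neg.exp
  have hfz := (hf z).restrictScalars ℝ
  have hf'z := (hf.deriv z).restrictScalars ℝ
  have hexp : DifferentiableAt ℝ (fun w => Complex.exp (-(ψ w : ℂ))) z :=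
    (differentiableAt_ofReal_comp (hψd z)).neg.cexp
  have hdψ : DifferentiableAt ℝ (wirtinger fun w => (ψ w : ℂ)) z :=
    (contDiff_wirtinger (m := 1) (contDiff_ofReal_comp hψ) (by norm_num)).differentiable (by simp) z
  have hmul : DifferentiableAt ℝ (fun w => f w * wirtinger (fun w => (ψ w : ℂ)) w) z :=
    hfz.mul hdψ
  have hsub : DifferentiableAt ℝ
      (fun w => deriv f w - f w * wirtinger (fun w => (ψ w : ℂ)) w) z := hf'z.sub hmul
  have hconj : DifferentiableAt ℝ (fun w => conj (f w) * Complex.exp (-(ψ w : ℂ))) z :=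
    (differentiableAt_conj_comp hfz).mul hexp
  rw [← Complex.ofReal_inj, ← dbar_wirtinger_ofReal hu.contDiffAt,
    show wirtinger (fun w => ((‖f w‖ ^ 2 * Real.exp (-ψ w) : ℝ) : ℂ)) = _ from
      funext fun w => wirtinger_weighted_sq hf (hψd w), dbar_mul hsub hconj,
    dbar_mul (differentiableAt_conj_comp hfz) hexp, dbar_sub hf'z hmul, dbar_mul hfz hdψ,
    dbar_holomorphic (hf z), dbar_holomorphic (hf.deriv z), dbar_conj_comp hfz,
    wirtinger_holomorphic (hf z), dbar_wirtinger_ofReal hψ.contDiffAt,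
    dbar_exp_neg_ofReal (hψd z)]
  push_cast
  rw [← Complex.conj_mul', ← Complex.conj_mul']
  simp only [map_sub, map_mul]
  ring

lemma neg_mul_le_quarterLaplacian_weighted_sq (hψ : ContDiff ℝ 2 ψ) (z : ℂ) :
    -(quarterLaplacian ψ z * (‖f z‖ ^ 2 * Real.exp (-ψ z))) ≤
      quarterLaplacian (fun w => ‖f w‖ ^ 2 * Real.exp (-ψ w)) z := by
  rw [quarterLaplacian_weighted_sq hf hψ z]
  have hnonneg :
      0 ≤ ‖deriv f z - f z * wirtinger (fun w => (ψ w : ℂ)) z‖ ^ 2 * Real.exp (-ψ z) := by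
    positivity
  linarith

end WeightedSquare

section Green

lemma quarterLaplacian_eq {u : ℂ → ℝ} {z : ℂ} (hu : ContDiffAt ℝ 2 u z) :
    quarterLaplacian u z = (1 / 4) * (fderiv ℝ (fun x => fderiv ℝ u x 1) z 1 +
      fderiv ℝ (fun x => fderiv ℝ u x Complex.I) z Complex.I) := by
  have hD2 : DifferentiableAt ℝ (fderiv ℝ u) z :=
    (hu.fderiv_right (m := 1) (by norm_num)).differentiableAt (by simp)
  rw [quarterLaplacian, InnerProductSpace.laplacian_eq_iteratedFDeriv_complexPlane]
  simp [iteratedFDeriv_two_apply, fderiv_clm_apply hD2 (differentiableAt_const _)]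

lemma integral_mul_fderiv_comm {u κ : ℂ → ℝ} (hu : ContDiff ℝ 1 u) (hκ : ContDiff ℝ 1 κ)
    (hc : HasCompactSupport κ) (v : ℂ) :
    ∫ z, κ z * fderiv ℝ u z v = -∫ z, fderiv ℝ κ z v * u z := by
  have hdu : Continuous fun z => fderiv ℝ u z v :=
    (hu.continuous_fderiv (by simp)).clm_apply continuous_const
  have hdκ : Continuous fun z => fderiv ℝ κ z v :=
    (hκ.continuous_fderiv (by simp)).clm_apply continuous_const
  refine integral_mul_fderiv_eq_neg_fderiv_mul_of_integrable ?_ ?_ ?_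
    (fun x _ => hκ.differentiable (by simp) x) (fun x _ => hu.differentiable (by simp) x)
  · exact (hdκ.mul hu.continuous).integrable_of_hasCompactSupport (hc.fderiv_apply ℝ v).mul_right
  · exact (hκ.continuous.mul hdu).integrable_of_hasCompactSupport hc.mul_right
  · exact (hκ.continuous.mul hu.continuous).integrable_of_hasCompactSupport hc.mul_right

lemma integral_mul_quarterLaplacian_comm {u κ : ℂ → ℝ} (hu : ContDiff ℝ 2 u)
    (hκ : ContDiff ℝ 2 κ) (hc : HasCompactSupport κ) :
    ∫ z, κ z * quarterLaplacian u z = ∫ z, u z * quarterLaplacian κ z := by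
  have hderiv {g : ℂ → ℝ} (hg : ContDiff ℝ 2 g) (v : ℂ) : ContDiff ℝ 1 fun x => fderiv ℝ g x v :=
    (hg.fderiv_right (m := 1) (by norm_num)).clm_apply contDiff_const
  have hderiv2 {g : ℂ → ℝ} (hg : ContDiff ℝ 2 g) (v : ℂ) :
      Continuous fun x => fderiv ℝ (fun x => fderiv ℝ g x v) x v :=
    ((hderiv hg v).continuous_fderiv (by simp)).clm_apply continuous_const
  have hdirection (v : ℂ) : ∫ z, κ z * fderiv ℝ (fun x => fderiv ℝ u x v) z v =
      ∫ z, u z * fderiv ℝ (fun x => fderiv ℝ κ x v) z v := by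
    rw [integral_mul_fderiv_comm (hderiv hu v) (hκ.of_le (by norm_num)) hc,
      integral_mul_fderiv_comm (hu.of_le (by norm_num)) (hderiv hκ v) (hc.fderiv_apply ℝ v),
      neg_neg]
    simp only [mul_comm]
  have hint_left (v : ℂ) : Integrable fun z => κ z * fderiv ℝ (fun x => fderiv ℝ u x v) z v :=
    (hκ.continuous.mul (hderiv2 hu v)).integrable_of_hasCompactSupport hc.mul_right
  have hint_right (v : ℂ) : Integrable fun z => u z * fderiv ℝ (fun x => fderiv ℝ κ x v) z v :=
    (hu.continuous.mul (hderiv2 hκ v)).integrable_of_hasCompactSupport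
      ((hc.fderiv_apply ℝ v).fderiv_apply ℝ v).mul_left
  have hdistrib (a b c : ℝ) : a * (1 / 4 * (b + c)) = 1 / 4 * (a * b + a * c) := by ring
  simp only [quarterLaplacian_eq hu.contDiffAt, quarterLaplacian_eq hκ.contDiffAt, hdistrib]
  rw [integral_const_mul, integral_const_mul, integral_add (hint_left 1) (hint_left _),
    integral_add (hint_right 1) (hint_right _), hdirection, hdirection]

lemma integral_weight_nonneg_of_contDiff {f : ℂ → ℂ} (hf : Differentiable ℂ f) {ψ κ : ℂ → ℝ}
    (hψ : ContDiff ℝ 2 ψ) (hκ : ContDiff ℝ 2 κ) (hc : HasCompactSupport κ) (hnonneg : 0 ≤ κ) :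
    0 ≤ ∫ z, (κ z * quarterLaplacian ψ z + quarterLaplacian κ z) *
      (‖f z‖ ^ 2 * Real.exp (-ψ z)) := by
  have hu : ContDiff ℝ 2 fun w => ‖f w‖ ^ 2 * Real.exp (-ψ w) :=
    ((contDiff_real_of_entire hf).norm_sq ℝ).mul hψ.neg.exp
  have hint_ψ : Integrable fun z => κ z * quarterLaplacian ψ z * (‖f z‖ ^ 2 * Real.exp (-ψ z)) :=
    ((hκ.continuous.mul (continuous_quarterLaplacian hψ)).mul
      hu.continuous).integrable_of_hasCompactSupport hc.mul_right.mul_right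
  have hint_κ : Integrable fun z => quarterLaplacian κ z * (‖f z‖ ^ 2 * Real.exp (-ψ z)) :=
    ((continuous_quarterLaplacian hκ).mul hu.continuous).integrable_of_hasCompactSupport
      (hasCompactSupport_quarterLaplacian hc).mul_right
  have hint_u : Integrable fun z => κ z *
      quarterLaplacian (fun w => ‖f w‖ ^ 2 * Real.exp (-ψ w)) z :=
    (hκ.continuous.mul (continuous_quarterLaplacian hu)).integrable_of_hasCompactSupport
      hc.mul_right
  have hgreen : ∫ z, quarterLaplacian κ z * (‖f z‖ ^ 2 * Real.exp (-ψ z)) =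
      ∫ z, κ z * quarterLaplacian (fun w => ‖f w‖ ^ 2 * Real.exp (-ψ w)) z := by
    rw [integral_mul_quarterLaplacian_comm hu hκ hc]
    simp only [mul_comm]
  simp only [add_mul]
  rw [integral_add hint_ψ hint_κ, hgreen, ← integral_add hint_ψ hint_u]
  refine integral_nonneg fun z => ?_
  have hpointwise := mul_le_mul_of_nonneg_left
    (neg_mul_le_quarterLaplacian_weighted_sq hf hψ z) (hnonneg z)
  simp only [Pi.zero_apply]
  linarith

end Green

section Cutoff

/-- The bump, equal to `1` on the unit disc and vanishing outside the disc of radius `2`, whose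
dilations are the cutoffs. -/
def unitBump : ContDiffBump (0 : ℂ) := ⟨1, 2, one_pos, one_lt_two⟩

/-- The cutoff at scale `R > 0`: it is `1` on `|z| ≤ R`, vanishes on `|z| ≥ 2R`, and its Laplacian
is `O(R⁻²)`. -/
def cutoff (R : ℝ) (z : ℂ) : ℝ := unitBump (R⁻¹ • z)

lemma contDiff_cutoff (R : ℝ) {n : ℕ∞} : ContDiff ℝ n (cutoff R) :=
  unitBump.contDiff.comp (contDiff_id.const_smul R⁻¹)

lemma cutoff_nonneg (R : ℝ) (z : ℂ) : 0 ≤ cutoff R z := unitBump.nonneg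

lemma cutoff_le_one (R : ℝ) (z : ℂ) : cutoff R z ≤ 1 := unitBump.le_one

variable {R : ℝ} {z : ℂ}

lemma cutoff_eq_one (hR : 0 < R) (hz : ‖z‖ ≤ R) : cutoff R z = 1 := by
  refine unitBump.one_of_mem_closedBall ?_
  rw [mem_closedBall_zero_iff, norm_smul, norm_inv, Real.norm_of_nonneg hR.le]
  exact inv_mul_le_one_of_le₀ hz hR.le

lemma cutoff_eq_zero (hR : 0 < R) (hz : 2 * R ≤ ‖z‖) : cutoff R z = 0 := by
  refine unitBump.zero_of_le_dist ?_
  rw [dist_zero_right, norm_smul, norm_inv, Real.norm_of_nonneg hR.le]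
  exact (le_inv_mul_iff₀ hR).2 (by rwa [mul_comm])

lemma hasCompactSupport_cutoff (hR : 0 < R) : HasCompactSupport (cutoff R) :=
  HasCompactSupport.intro (isCompact_closedBall (0 : ℂ) (2 * R)) fun z hz =>
    cutoff_eq_zero hR (by simpa using (not_le.1 (mt mem_closedBall_zero_iff.2 hz)).le)

lemma exists_abs_quarterLaplacian_cutoff_le :
    ∃ C : ℝ, 0 < C ∧ ∀ R z, |quarterLaplacian (cutoff R) z| ≤ C / R ^ 2 := by
  obtain ⟨C, hC⟩ := (hasCompactSupport_quarterLaplacian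
    unitBump.hasCompactSupport).exists_bound_of_continuous
      (continuous_quarterLaplacian unitBump.contDiff)
  refine ⟨max C 1, by positivity, fun R z => ?_⟩
  have hscale := quarterLaplacian_comp_affine unitBump.contDiff R⁻¹ 0 z
  simp only [add_zero] at hscale
  rw [show cutoff R = fun w => unitBump (R⁻¹ • w) from rfl, hscale, abs_mul, abs_sq, inv_pow,
    inv_mul_eq_div]
  exact div_le_div_of_nonneg_right ((hC _).trans (le_max_left _ _)) (sq_nonneg R)

end Cutoff

section PolarCoordinates

variable {E : Type*} [NormedAddCommGroup E] [NormedSpace ℝ E]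

lemma complex_polarCoord_symm_eq_circleMap (p : ℝ × ℝ) :
    Complex.polarCoord.symm p = circleMap 0 p.1 p.2 := by
  rw [Complex.polarCoord_symm_apply, circleMap_zero, Complex.exp_mul_I, Complex.ofReal_cos,
    Complex.ofReal_sin]

lemma integrableOn_smul_circleMap {F : ℂ → E} (hF : Integrable F) :
    IntegrableOn (fun p : ℝ × ℝ => p.1 • F (circleMap 0 p.1 p.2)) polarCoord.target := by
  have hreal : Integrable fun p : ℝ × ℝ => F (Complex.measurableEquivRealProd.symm p) :=
    (Complex.volume_preserving_equiv_real_prod.symm.integrable_comp_emb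
      Complex.measurableEquivRealProd.symm.measurableEmbedding).2 hF
  have hjac := (integrableOn_image_iff_integrableOn_abs_det_fderiv_smul volume
    polarCoord.open_target.measurableSet
    (fun p _ => (hasFDerivAt_polarCoord_symm p).hasFDerivWithinAt)
    polarCoord.symm.injOn (fun p => F (Complex.measurableEquivRealProd.symm p))).1
    hreal.integrableOn
  refine hjac.congr_fun (fun p hp => ?_) polarCoord.open_target.measurableSet
  have hpos : 0 < p.1 := by rw [polarCoord_target] at hp; exact hp.1
  dsimp only
  rw [det_fderivPolarCoordSymm, abs_of_pos hpos, ← complex_polarCoord_symm_eq_circleMap]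
  rfl

lemma integral_Ioo_circleMap (F : ℂ → E) (ρ : ℝ) :
    ∫ θ in Set.Ioo (-Real.pi) Real.pi, F (circleMap 0 ρ θ) =
      (2 * Real.pi) • Real.circleAverage F 0 ρ := by
  rw [Real.circleAverage_eq_integral_add (-Real.pi), smul_smul,
    mul_inv_cancel₀ Real.two_pi_pos.ne', one_smul,
    intervalIntegral.integral_comp_add_right fun θ => F (circleMap 0 ρ θ),
    ← integral_Ioc_eq_integral_Ioo,
    ← intervalIntegral.integral_of_le (by linarith [Real.pi_pos])]
  congr 1 <;> ring

lemma integral_eq_integral_smul_circleAverage {F : ℂ → E} (hF : Integrable F) :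
    ∫ z, F z = ∫ ρ in Set.Ioi (0 : ℝ), (2 * Real.pi * ρ) • Real.circleAverage F 0 ρ := by
  have hint := integrableOn_smul_circleMap hF
  rw [polarCoord_target, Measure.volume_eq_prod] at hint
  rw [← Complex.integral_comp_polarCoord_symm]
  simp only [complex_polarCoord_symm_eq_circleMap]
  rw [polarCoord_target, Measure.volume_eq_prod, setIntegral_prod _ hint]
  refine setIntegral_congr_fun measurableSet_Ioi fun ρ _ => ?_
  dsimp only
  rw [integral_smul, integral_Ioo_circleMap, smul_smul, mul_comm ρ]

end PolarCoordinates

section Mollification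

/-- A smooth radial bump supported in the disc of radius `s`, not normalized. -/
def radialBump (s : ℝ) (z : ℂ) : ℝ := Real.smoothTransition (1 - ‖z‖ ^ 2 / s ^ 2)

/-- The radial probability density on the disc of radius `s` that all mollifications use; that it
is radial is what makes the mean value inequalities of subharmonic functions applicable. -/
def mollifier (s : ℝ) (z : ℂ) : ℝ := radialBump s z / ∫ w, radialBump s w

lemma contDiff_radialBump (s : ℝ) : ContDiff ℝ ∞ (radialBump s) :=
  Real.smoothTransition.contDiff.comp (contDiff_const.sub ((contDiff_id.norm_sq ℝ).div_const _))

lemma contDiff_mollifier (s : ℝ) : ContDiff ℝ ∞ (mollifier s) := (contDiff_radialBump s).div_const _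

lemma continuous_mollifier (s : ℝ) : Continuous (mollifier s) := (contDiff_mollifier s).continuous

lemma mollifier_congr_norm (s : ℝ) {z w : ℂ} (h : ‖z‖ = ‖w‖) : mollifier s z = mollifier s w := by
  rw [mollifier, radialBump, h, mollifier, radialBump]

lemma mollifier_neg (s : ℝ) (z : ℂ) : mollifier s (-z) = mollifier s z :=
  mollifier_congr_norm s (norm_neg z)

variable {s : ℝ} (hs : 0 < s)
include hs

lemma radialBump_eq_zero {z : ℂ} (hz : s ≤ ‖z‖) : radialBump s z = 0 := by
  refine Real.smoothTransition.zero_of_nonpos (sub_nonpos.2 ?_)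
  rw [one_le_div (by positivity)]
  gcongr

lemma hasCompactSupport_radialBump : HasCompactSupport (radialBump s) :=
  HasCompactSupport.intro (isCompact_closedBall (0 : ℂ) s) fun _ hz =>
    radialBump_eq_zero hs (by simpa using (not_le.1 (mt mem_closedBall_zero_iff.2 hz)).le)

lemma integral_radialBump_pos : 0 < ∫ w, radialBump s w :=
  (contDiff_radialBump s).continuous.integral_pos_of_hasCompactSupport_nonneg_nonzero (x := 0)
    (hasCompactSupport_radialBump hs) (fun _ => Real.smoothTransition.nonneg _)
    (by simp [radialBump])

lemma mollifier_nonneg (z : ℂ) : 0 ≤ mollifier s z :=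
  div_nonneg (Real.smoothTransition.nonneg _) (integral_radialBump_pos hs).le

lemma mollifier_pos {z : ℂ} (hz : ‖z‖ < s) : 0 < mollifier s z := by
  refine div_pos (Real.smoothTransition.pos_of_pos (sub_pos.2 ?_)) (integral_radialBump_pos hs)
  rw [div_lt_one (by positivity)]
  gcongr

lemma mollifier_eq_zero {z : ℂ} (hz : s ≤ ‖z‖) : mollifier s z = 0 := by
  rw [mollifier, radialBump_eq_zero hs hz, zero_div]

lemma hasCompactSupport_mollifier : HasCompactSupport (mollifier s) :=
  HasCompactSupport.intro (isCompact_closedBall (0 : ℂ) s) fun _ hz =>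
    mollifier_eq_zero hs (by simpa using (not_le.1 (mt mem_closedBall_zero_iff.2 hz)).le)

lemma integrable_mollifier : Integrable (mollifier s) :=
  (continuous_mollifier s).integrable_of_hasCompactSupport (hasCompactSupport_mollifier hs)

lemma integral_mollifier : ∫ z, mollifier s z = 1 := by
  simp only [mollifier]
  rw [integral_div, div_self (integral_radialBump_pos hs).ne']

omit hs

variable {E : Type*} [NormedAddCommGroup E] [NormedSpace ℝ E]

/-- Mollification of `f` at scale `s`. -/
def mollify (s : ℝ) (f : ℂ → E) (z : ℂ) : E := ∫ w, mollifier s w • f (z + w)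

lemma locallyIntegrable_comp_const_add {F : Type*} [NormedAddCommGroup F] {f : ℂ → F}
    (hf : LocallyIntegrable f) (z : ℂ) :
    LocallyIntegrable fun w => f (z + w) := by
  intro x
  obtain ⟨U, hU, hint⟩ := hf (z + x)
  exact ⟨(fun w => z + w) ⁻¹' U, (continuous_const_add z).continuousAt.preimage_mem_nhds hU,
    ((measurePreserving_add_left volume z).integrableOn_comp_preimage
      (measurableEmbedding_addLeft z)).2 hint⟩

include hs

lemma integrable_mollifier_smul {f : ℂ → E} (hf : LocallyIntegrable f) (z : ℂ) :
    Integrable fun w => mollifier s w • f (z + w) :=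
  (locallyIntegrable_comp_const_add hf z).integrable_smul_left_of_hasCompactSupport
    (continuous_mollifier s) (hasCompactSupport_mollifier hs)

lemma integrable_mollifier_smul_of_continuousOn {F : ℂ → E} {z : ℂ}
    (hF : ContinuousOn F (Metric.closedBall z s)) :
    Integrable fun w => mollifier s w • F (z + w) := by
  have hball : IntegrableOn (fun w => mollifier s w • F (z + w)) (Metric.closedBall 0 s) :=
    ((continuous_mollifier s).continuousOn.smul
      (hF.comp (continuous_const_add z).continuousOn fun w hw => by
        simpa using hw)).integrableOn_compact (isCompact_closedBall 0 s)
  refine (integrableOn_iff_integrable_of_support_subset fun w hw => ?_).1 hball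
  contrapose! hw
  rw [Function.notMem_support,
    mollifier_eq_zero hs (by simpa using (not_le.1 (mt mem_closedBall_zero_iff.2 hw)).le),
    zero_smul]

lemma mollify_sub_const [CompleteSpace E] {f : ℂ → E} {z : ℂ}
    (hf : Integrable fun w => mollifier s w • f (z + w)) (a : E) :
    mollify s (fun w => f w - a) z = mollify s f z - a := by
  simp only [mollify, smul_sub]
  rw [integral_sub hf ((integrable_mollifier hs).smul_const a), integral_smul_const,
    integral_mollifier hs, one_smul]

lemma norm_mollify_le {f : ℂ → E} {z : ℂ} {ε : ℝ} (h : ∀ w, ‖w‖ < s → ‖f (z + w)‖ ≤ ε) :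
    ‖mollify s f z‖ ≤ ε := by
  have hε : ∫ w, mollifier s w * ε = ε := by
    rw [integral_mul_const, integral_mollifier hs, one_mul]
  rw [← hε]
  refine norm_integral_le_of_norm_le ((integrable_mollifier hs).mul_const ε)
    (Eventually.of_forall fun w => ?_)
  rw [norm_smul, Real.norm_of_nonneg (mollifier_nonneg hs w)]
  by_cases hw : ‖w‖ < s
  · exact mul_le_mul_of_nonneg_left (h w hw) (mollifier_nonneg hs w)
  · rw [mollifier_eq_zero hs (not_lt.1 hw), zero_mul, zero_mul]

lemma norm_mollify_sub_le [CompleteSpace E] {f : ℂ → E} (hf : LocallyIntegrable f) {z : ℂ} {a : E}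
    {ε : ℝ} (h : ∀ w, ‖w‖ < s → ‖f (z + w) - a‖ ≤ ε) : ‖mollify s f z - a‖ ≤ ε := by
  rw [← mollify_sub_const hs (integrable_mollifier_smul hs hf z)]
  exact norm_mollify_le hs h

lemma mollify_le_of_le {f : ℂ → ℝ} (hf : LocallyIntegrable f) {z : ℂ} {B : ℝ}
    (h : ∀ w, ‖w‖ < s → f (z + w) ≤ B) : mollify s f z ≤ B := by
  have hB : ∫ w, mollifier s w * B = B := by
    rw [integral_mul_const, integral_mollifier hs, one_mul]
  rw [← hB]
  refine integral_mono (integrable_mollifier_smul hs hf z)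
    ((integrable_mollifier hs).mul_const B) fun w => ?_
  by_cases hw : ‖w‖ < s
  · exact mul_le_mul_of_nonneg_left (h w hw) (mollifier_nonneg hs w)
  · simp [mollifier_eq_zero hs (not_lt.1 hw)]

lemma mollify_pos {f : ℂ → ℝ} (hf : Continuous f) {z : ℂ} (hz : 0 ≤ f z)
    (h : ∀ w, w ≠ 0 → ‖w‖ < s → 0 < f (z + w)) : 0 < mollify s f z := by
  have hcont : Continuous fun w => mollifier s w • f (z + w) := by
    have := continuous_mollifier s
    fun_prop
  have hhalf : ‖((s / 2 : ℝ) : ℂ)‖ < s := by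
    rw [Complex.norm_real, Real.norm_of_nonneg (half_pos hs).le]
    exact half_lt_self hs
  refine hcont.integral_pos_of_hasCompactSupport_nonneg_nonzero (x := ((s / 2 : ℝ) : ℂ))
    (hasCompactSupport_mollifier hs).smul_right (fun w => ?_) (smul_pos (mollifier_pos hs hhalf)
      (h _ (Complex.ofReal_ne_zero.2 (half_pos hs).ne') hhalf)).ne'
  rcases le_or_gt s ‖w‖ with hw | hw
  · rw [mollifier_eq_zero hs hw, zero_smul]
    rfl
  · refine smul_nonneg (mollifier_nonneg hs w) ?_
    rcases eq_or_ne w 0 with rfl | hw0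
    · rwa [add_zero]
    · exact (h w hw0 hw).le

omit hs in
lemma mollify_eq_integral_circleAverage {f : ℂ → E} {z : ℂ}
    (hf : Integrable fun w => mollifier s w • f (z + w)) :
    mollify s f z = ∫ ρ in Set.Ioi (0 : ℝ),
      (2 * Real.pi * ρ * mollifier s ρ) • Real.circleAverage f z ρ := by
  rw [mollify, integral_eq_integral_smul_circleAverage hf]
  refine setIntegral_congr_fun measurableSet_Ioi fun ρ _ => ?_
  have hradial : Real.circleAverage (fun w => mollifier s w • f (z + w)) 0 ρ =
      Real.circleAverage (fun w => mollifier s ρ • f (w + z)) 0 ρ :=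
    Real.circleAverage_congr_sphere fun w hw => by
      have hnorm : ‖w‖ = ‖(ρ : ℂ)‖ := by simpa using hw
      simp only [mollifier_congr_norm s hnorm, add_comm]
  rw [hradial, Real.circleAverage_fun_smul, Real.circleAverage_map_add_const, smul_smul]

lemma Subharmonic.le_mollify {φ : ℂ → ℝ} (hφ : Subharmonic φ) (hint : LocallyIntegrable φ)
    (z : ℂ) : φ z ≤ mollify s φ z := by
  have hmul := integrable_mollifier_smul hs hint z
  have hsub : Integrable fun w => mollifier s w • (φ (z + w) - φ z) := by
    simpa only [smul_sub] using! hmul.sub ((integrable_mollifier hs).smul_const (φ z))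
  rw [← sub_nonneg, ← mollify_sub_const hs hmul, mollify_eq_integral_circleAverage hsub]
  refine setIntegral_nonneg measurableSet_Ioi fun ρ hρ => ?_
  have hρ : 0 < ρ := hρ
  obtain ⟨hcircle, hmean⟩ := hφ.2 z ρ hρ
  rw [Real.circleAverage_fun_sub hcircle (circleIntegrable_const _ _ _), Real.circleAverage_const]
  have := mollifier_nonneg hs (ρ : ℂ)
  have := sub_nonneg.2 hmean
  positivity

lemma mollify_eq_self_of_differentiableOn {F : ℂ → ℂ} {z : ℂ} {R : ℝ} (hsR : s < R)
    (hF : DifferentiableOn ℂ F (Metric.ball z R)) : mollify s F z = F z := by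
  have hcont := hF.continuousOn.mono (Metric.closedBall_subset_ball hsR)
  rw [← sub_eq_zero,
    ← mollify_sub_const hs (integrable_mollifier_smul_of_continuousOn hs hcont),
    mollify_eq_integral_circleAverage
      (integrable_mollifier_smul_of_continuousOn (F := fun w => F w - F z) hs
        (hcont.sub continuousOn_const))]
  refine setIntegral_eq_zero_of_forall_eq_zero fun ρ hρ => ?_
  have hρ : 0 < ρ := hρ
  rcases le_or_gt s ρ with hsρ | hρs
  · rw [mollifier_eq_zero hs (by simpa [abs_of_pos hρ] using hsρ), mul_zero, zero_smul]
  · have hdiff : DiffContOnCl ℂ (fun w => F w - F z) (Metric.ball z |ρ|) := by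
      refine (hF.sub_const _).diffContOnCl_ball ?_
      rw [abs_of_pos hρ]
      exact Metric.closedBall_subset_ball (hρs.trans hsR)
    rw [hdiff.circleAverage, sub_self, smul_zero]

omit hs

lemma Subharmonic.tendsto_mollify {φ : ℂ → ℝ} (hφ : Subharmonic φ) (hint : LocallyIntegrable φ)
    (z : ℂ) : Tendsto (fun s => mollify s φ z) (𝓝[>] 0) (𝓝 (φ z)) := by
  refine tendsto_order.2 ⟨fun a ha => ?_, fun b hb => ?_⟩
  · filter_upwards [self_mem_nhdsWithin] with s hs using ha.trans_le (hφ.le_mollify hs hint z)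
  · obtain ⟨c, hφc, hcb⟩ := exists_between hb
    obtain ⟨η, hη, hball⟩ := Metric.eventually_nhds_iff.1 (hφ.1 z c hφc)
    filter_upwards [Ioo_mem_nhdsGT hη] with s hs
    refine (mollify_le_of_le hs.1 hint fun w hw => (hball ?_).le).trans_lt hcb
    simpa [dist_eq_norm] using hw.trans hs.2

lemma tendsto_mollify_of_continuous [CompleteSpace E] {f : ℂ → E} (hf : Continuous f) (z : ℂ) :
    Tendsto (fun s => mollify s f z) (𝓝[>] 0) (𝓝 (f z)) := by
  refine Metric.tendsto_nhds.2 fun ε hε => ?_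
  obtain ⟨η, hη, hball⟩ := Metric.continuous_iff.1 hf z (ε / 2) (half_pos hε)
  filter_upwards [Ioo_mem_nhdsGT hη] with s hs
  rw [dist_eq_norm]
  refine (norm_mollify_sub_le hs.1 hf.locallyIntegrable fun w hw => ?_).trans_lt (half_lt_self hε)
  rw [← dist_eq_norm]
  exact (hball _ (by simpa [dist_eq_norm] using hw.trans hs.2)).le

end Mollification

section Convolution

/-- Convolution of complex functions on the plane. -/
def planeConv (f g : ℂ → ℂ) : ℂ → ℂ := convolution f g (ContinuousLinearMap.mul ℝ ℂ) volume

lemma planeConv_apply (f g : ℂ → ℂ) (z : ℂ) : planeConv f g z = ∫ t, f t * g (z - t) := rfl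

lemma planeConv_comm (f g : ℂ → ℂ) : planeConv f g = planeConv g f := by
  have h := convolution_flip (L := ContinuousLinearMap.mul ℝ ℂ) (μ := (volume : Measure ℂ))
    (f := f) (g := g)
  rw [ContinuousLinearMap.flip_mul] at h
  exact h.symm

lemma hasCompactSupport_planeConv {f g : ℂ → ℂ} (hf : HasCompactSupport f)
    (hg : HasCompactSupport g) : HasCompactSupport (planeConv f g) :=
  HasCompactSupport.convolution (ContinuousLinearMap.mul ℝ ℂ) hf hg

lemma continuous_fderiv_apply_const {g : ℂ → ℂ} (hg : ContDiff ℝ 1 g) (v : ℂ) :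
    Continuous fun x => fderiv ℝ g x v :=
  (hg.continuous_fderiv one_ne_zero).clm_apply continuous_const

variable {f g h : ℂ → ℂ} (hf : LocallyIntegrable f)
include hf

lemma integrable_mul_comp_sub (hg : Continuous g) (hc : HasCompactSupport g) (z : ℂ) :
    Integrable fun t => f t * g (z - t) :=
  hc.convolutionExists_right (ContinuousLinearMap.mul ℝ ℂ) hf hg z

lemma contDiff_planeConv {n : ℕ∞} (hg : ContDiff ℝ n g) (hc : HasCompactSupport g) :
    ContDiff ℝ n (planeConv f g) :=
  hc.contDiff_convolution_right (ContinuousLinearMap.mul ℝ ℂ) hf hg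

lemma fderiv_planeConv_apply (hg : ContDiff ℝ 1 g) (hc : HasCompactSupport g) (z v : ℂ) :
    fderiv ℝ (planeConv f g) z v = planeConv f (fun x => fderiv ℝ g x v) z := by
  have h := hc.hasFDerivAt_convolution_right (ContinuousLinearMap.mul ℝ ℂ) hf hg z
  rw [planeConv, h.fderiv, convolution_precompR_apply _ hf (hc.fderiv ℝ)
    (hg.continuous_fderiv one_ne_zero)]
  rfl

lemma planeConv_fderiv_comb (hg : ContDiff ℝ 1 g) (hc : HasCompactSupport g) (a b z : ℂ) :
    a * (fderiv ℝ (planeConv f g) z 1 + b * fderiv ℝ (planeConv f g) z Complex.I) =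
      planeConv f (fun x => a * (fderiv ℝ g x 1 + b * fderiv ℝ g x Complex.I)) z := by
  have hint (v : ℂ) := integrable_mul_comp_sub hf (continuous_fderiv_apply_const hg v)
    (hc.fderiv_apply ℝ v) z
  simp only [fderiv_planeConv_apply hf hg hc, planeConv_apply]
  rw [← integral_const_mul b, ← integral_add (hint 1) ((hint Complex.I).const_mul b),
    ← integral_const_mul]
  exact integral_congr_ae (Eventually.of_forall fun t => by ring)

lemma wirtinger_planeConv (hg : ContDiff ℝ 1 g) (hc : HasCompactSupport g) :
    wirtinger (planeConv f g) = planeConv f (wirtinger g) := funext fun z => by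
  simpa only [wirtinger, sub_eq_add_neg, neg_mul] using!
    planeConv_fderiv_comb hf hg hc (1 / 2) (-Complex.I) z

lemma dbar_planeConv (hg : ContDiff ℝ 1 g) (hc : HasCompactSupport g) :
    dbar (planeConv f g) = planeConv f (dbar g) := funext fun z => by
  simpa only [dbar] using! planeConv_fderiv_comb hf hg hc (1 / 2) Complex.I z

lemma wirtinger_iterate_planeConv {n : ℕ} (hg : ContDiff ℝ n g) (hc : HasCompactSupport g) :
    wirtinger^[n] (planeConv f g) = planeConv f (wirtinger^[n] g) := by
  induction n generalizing g with
  | zero => rfl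
  | succ n ih =>
    rw [Function.iterate_succ_apply, Function.iterate_succ_apply,
      wirtinger_planeConv hf (hg.of_le (by norm_cast; omega)) hc,
      ih (contDiff_wirtinger hg (by norm_cast)) (hasCompactSupport_wirtinger hc)]

lemma planeConv_assoc (hg : Continuous g) (hgc : HasCompactSupport g) (hh : Continuous h)
    (hhc : HasCompactSupport h) :
    planeConv (planeConv f g) h = planeConv f (planeConv g h) := by
  ext z
  refine convolution_assoc (ContinuousLinearMap.mul ℝ ℂ) (ContinuousLinearMap.mul ℝ ℂ)
    (ContinuousLinearMap.mul ℝ ℂ) (ContinuousLinearMap.mul ℝ ℂ) mul_assoc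
    hf.aestronglyMeasurable hg.aestronglyMeasurable hh.aestronglyMeasurable
    (Eventually.of_forall fun y => hgc.convolutionExists_right _ hf hg y)
    (Eventually.of_forall fun y => hhc.norm.convolutionExists_right _
      hg.norm.locallyIntegrable hh.norm y) ?_
  have hfnorm : LocallyIntegrable fun x => ‖f x‖ := fun x =>
    let ⟨U, hU, hint⟩ := hf x
    ⟨U, hU, hint.norm⟩
  exact (hgc.norm.convolution _ hhc.norm).convolutionExists_right _ hfnorm
    (hhc.norm.continuous_convolution_right _ hg.norm.locallyIntegrable hh.norm) z

omit hf

lemma locallyIntegrable_ofReal {u : ℂ → ℝ} (hu : LocallyIntegrable u) :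
    LocallyIntegrable fun w => (u w : ℂ) := fun x =>
  let ⟨U, hU, hint⟩ := hu x
  ⟨U, hU, hint.ofReal⟩

/-- The mollifier as a complex function, so that `mollify s f = planeConv f (complexMollifier s)`
for complex `f`. -/
def complexMollifier (s : ℝ) (z : ℂ) : ℂ := (mollifier s z : ℂ)

lemma contDiff_complexMollifier (s : ℝ) : ContDiff ℝ ∞ (complexMollifier s) :=
  Complex.ofRealCLM.contDiff.comp (contDiff_mollifier s)

lemma hasCompactSupport_complexMollifier {s : ℝ} (hs : 0 < s) :
    HasCompactSupport (complexMollifier s) :=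
  (hasCompactSupport_mollifier hs).comp_left (g := fun x : ℝ => (x : ℂ)) Complex.ofReal_zero

lemma planeConv_complexMollifier (s : ℝ) (f : ℂ → ℂ) :
    planeConv f (complexMollifier s) = mollify s f := by
  ext z
  rw [planeConv_apply, mollify, ← integral_add_left_eq_self _ z]
  refine integral_congr_ae (Eventually.of_forall fun w => ?_)
  dsimp only
  rw [complexMollifier, Complex.real_smul, mul_comm, sub_add_cancel_left, mollifier_neg]

lemma mollify_ofReal (s : ℝ) (u : ℂ → ℝ) (z : ℂ) :
    mollify s (fun w => (u w : ℂ)) z = ((mollify s u z : ℝ) : ℂ) := by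
  rw [mollify, mollify, ← integral_complex_ofReal]
  simp only [Complex.real_smul, smul_eq_mul, Complex.ofReal_mul]

lemma contDiff_mollify {s : ℝ} (hs : 0 < s) {u : ℂ → ℝ} (hu : LocallyIntegrable u) :
    ContDiff ℝ ∞ (mollify s u) := by
  have hre : mollify s u =
      fun z => Complex.reCLM (planeConv (fun w => (u w : ℂ)) (complexMollifier s) z) := by
    ext z
    rw [planeConv_complexMollifier, mollify_ofReal, Complex.reCLM_apply, Complex.ofReal_re]
  rw [hre]
  exact Complex.reCLM.contDiff.comp (contDiff_planeConv (n := ⊤) (locallyIntegrable_ofReal hu)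
    (contDiff_complexMollifier s) (hasCompactSupport_complexMollifier hs))

end Convolution

section CauchyTransform

/-- The Cauchy kernel `1 / (π z)`, the fundamental solution of `∂̄`. -/
def cauchyKernel (z : ℂ) : ℂ := 1 / (Real.pi * z)

lemma locallyIntegrable_cauchyKernel : LocallyIntegrable cauchyKernel := by
  refine locallyIntegrable_of_norm_le_rpow (C := 1 / Real.pi) (α := 1) (by simp) (by simp)
    (Eventually.of_forall fun z => ?_) ?_
  · rw [cauchyKernel, norm_div, norm_mul, norm_one, Complex.norm_real,
      Real.norm_of_nonneg Real.pi_pos.le, Real.rpow_neg_one]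
    exact le_of_eq (by field_simp)
  · exact (by fun_prop : Measurable fun z : ℂ => 1 / ((Real.pi : ℂ) * z)).aestronglyMeasurable

lemma integrableOn_polarCoord_target {G : ℝ × ℝ → ℂ} (hG : Continuous G) {R : ℝ}
    (hzero : ∀ p : ℝ × ℝ, R < p.1 → G p = 0) : IntegrableOn G polarCoord.target := by
  have hcompact : IntegrableOn G (Set.Icc (0 : ℝ) R ×ˢ Set.Icc (-Real.pi) Real.pi) :=
    hG.continuousOn.integrableOn_compact (isCompact_Icc.prod isCompact_Icc)
  refine hcompact.of_forall_sdiff_eq_zero polarCoord.open_target.measurableSet fun p hp => ?_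
  rw [polarCoord_target] at hp
  obtain ⟨⟨hp₁, hp₂⟩, hpnot⟩ := hp
  by_contra hne
  exact hpnot ⟨⟨le_of_lt hp₁, not_lt.1 fun h => hne (hzero p h)⟩, hp₂.1.le, hp₂.2.le⟩

variable {F : ℂ → ℂ} (hF : ContDiff ℝ 1 F)
include hF

lemma integral_angular_fderiv_eq_zero {ρ : ℝ} (hρ : ρ ≠ 0) :
    ∫ θ in Set.Ioo (-Real.pi) Real.pi,
      fderiv ℝ F (circleMap 0 ρ θ) (circleMap 0 1 θ * Complex.I) = 0 := by
  have hderiv (θ : ℝ) : HasDerivAt (fun θ => F (circleMap 0 ρ θ))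
      (ρ • fderiv ℝ F (circleMap 0 ρ θ) (circleMap 0 1 θ * Complex.I)) θ := by
    have h := ((hF.differentiable one_ne_zero) (circleMap 0 ρ θ)).hasFDerivAt.comp_hasDerivAt θ
      (hasDerivAt_circleMap 0 ρ θ)
    rw [← map_smul]
    convert! h using 2
    simp only [circleMap_zero, Complex.real_smul, Complex.ofReal_one]
    ring
  have hcont : Continuous fun θ : ℝ =>
      fderiv ℝ F (circleMap 0 ρ θ) (circleMap 0 1 θ * Complex.I) :=
    ((hF.continuous_fderiv one_ne_zero).comp (continuous_circleMap 0 ρ)).clm_apply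
      ((continuous_circleMap 0 1).mul continuous_const)
  have hperiod := intervalIntegral.integral_eq_sub_of_hasDerivAt (fun θ _ => hderiv θ)
    ((hcont.const_smul ρ).intervalIntegrable (-Real.pi) Real.pi)
  rw [intervalIntegral.integral_smul,
    show circleMap 0 ρ Real.pi = circleMap 0 ρ (-Real.pi) by simp [circleMap_zero, Complex.exp_neg],
    sub_self] at hperiod
  rw [← integral_Ioc_eq_integral_Ioo,
    ← intervalIntegral.integral_of_le (by linarith [Real.pi_pos])]
  exact (smul_eq_zero.1 hperiod).resolve_left hρ

variable (hc : HasCompactSupport F)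
include hc

lemma integral_radial_fderiv_eq (θ : ℝ) :
    ∫ ρ in Set.Ioi (0 : ℝ), fderiv ℝ F (circleMap 0 ρ θ) (circleMap 0 1 θ) = -F 0 := by
  have hray : Topology.IsClosedEmbedding fun ρ : ℝ => circleMap 0 ρ θ := by
    refine (Isometry.of_dist_eq fun ρ ρ' => ?_).isClosedEmbedding
    rw [dist_eq_norm, circleMap_zero, circleMap_zero, ← sub_mul, norm_mul,
      Complex.norm_exp_ofReal_mul_I, mul_one, ← Complex.ofReal_sub, Complex.norm_real, dist_eq_norm]
  have hderiv (ρ : ℝ) : HasDerivAt (fun ρ : ℝ => F (circleMap 0 ρ θ))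
      (fderiv ℝ F (circleMap 0 ρ θ) (circleMap 0 1 θ)) ρ := by
    refine ((hF.differentiable one_ne_zero) (circleMap 0 ρ θ)).hasFDerivAt.comp_hasDerivAt ρ ?_
    simpa [circleMap_zero] using!
      (Complex.ofRealCLM.hasDerivAt (x := ρ)).mul_const (Complex.exp (θ * Complex.I))
  have hint : Integrable fun ρ : ℝ => fderiv ℝ F (circleMap 0 ρ θ) (circleMap 0 1 θ) :=
    ((continuous_fderiv_apply_const hF _).comp hray.continuous).integrable_of_hasCompactSupport
      ((hc.fderiv_apply ℝ _).comp_isClosedEmbedding hray)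
  have hlim : Tendsto (fun ρ : ℝ => F (circleMap 0 ρ θ)) atTop (𝓝 0) :=
    ((hc.comp_isClosedEmbedding hray).is_zero_at_infty).mono_left atTop_le_cocompact
  rw [integral_Ioi_of_hasDerivAt_of_tendsto' (fun ρ _ => hderiv ρ) hint.integrableOn hlim]
  simp [circleMap_zero]

omit hF hc in
lemma smul_cauchyKernel_mul_dbar (F : ℂ → ℂ) {ρ : ℝ} (hρ : ρ ≠ 0) (θ : ℝ) :
    ρ • (cauchyKernel (circleMap 0 ρ θ) * dbar F (circleMap 0 ρ θ)) =
      (1 / (2 * Real.pi) : ℂ) * (fderiv ℝ F (circleMap 0 ρ θ) (circleMap 0 1 θ) +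
        Complex.I * fderiv ℝ F (circleMap 0 ρ θ) (circleMap 0 1 θ * Complex.I)) := by
  have hρ' : (ρ : ℂ) ≠ 0 := mod_cast hρ
  have hpi : (Real.pi : ℂ) ≠ 0 := mod_cast Real.pi_ne_zero
  have hne : circleMap 0 1 θ ≠ 0 := by simp
  have hunit : circleMap 0 1 θ * conj (circleMap 0 1 θ) = 1 := by
    rw [Complex.mul_conj, Complex.normSq_eq_norm_sq]
    simp
  have hkernel : (ρ : ℂ) * cauchyKernel (circleMap 0 ρ θ) =
      1 / Real.pi * conj (circleMap 0 1 θ) := by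
    rw [cauchyKernel, show circleMap 0 ρ θ = ρ * circleMap 0 1 θ by simp [circleMap_zero]]
    field_simp
    rw [hunit]
  rw [fderiv_apply_eq_wirtinger_add_dbar, fderiv_apply_eq_wirtinger_add_dbar, map_mul,
    Complex.conj_I, Complex.real_smul, ← mul_assoc, hkernel]
  field_simp
  linear_combination (conj (circleMap 0 1 θ) * dbar F (circleMap 0 ρ θ) -
    circleMap 0 1 θ * wirtinger F (circleMap 0 ρ θ)) * Complex.I_sq

lemma integrableOn_fderiv_circleMap {v : ℝ → ℂ} (hv : Continuous v) :
    IntegrableOn (fun p : ℝ × ℝ => fderiv ℝ F (circleMap 0 p.1 p.2) (v p.2)) polarCoord.target := by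
  obtain ⟨R, hR⟩ := (hc.fderiv ℝ).isCompact.isBounded.subset_ball (0 : ℂ)
  have hfderiv : Continuous fun p : ℝ × ℝ => fderiv ℝ F (circleMap 0 p.1 p.2) := by
    have := hF.continuous_fderiv one_ne_zero
    simp only [circleMap_zero]
    fun_prop
  refine integrableOn_polarCoord_target (R := R) (hfderiv.clm_apply (hv.comp continuous_snd))
    fun p hp => ?_
  rw [image_eq_zero_of_notMem_tsupport (f := fderiv ℝ F), _root_.zero_apply]
  intro hmem
  have hlt := hR hmem
  rw [mem_ball_zero_iff, norm_circleMap_zero] at hlt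
  exact absurd (hp.trans_le (le_abs_self _)) hlt.not_gt

lemma setIntegral_angular_fderiv_eq_zero : ∫ p in polarCoord.target,
    fderiv ℝ F (circleMap 0 p.1 p.2) (circleMap 0 1 p.2 * Complex.I) = 0 := by
  have hint := integrableOn_fderiv_circleMap hF hc (v := fun θ => circleMap 0 1 θ * Complex.I)
    ((continuous_circleMap 0 1).mul continuous_const)
  rw [polarCoord_target, Measure.volume_eq_prod] at hint ⊢
  rw [setIntegral_prod _ hint]
  exact setIntegral_eq_zero_of_forall_eq_zero fun ρ hρ =>
    integral_angular_fderiv_eq_zero hF (ne_of_gt hρ)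

lemma setIntegral_radial_fderiv_eq : ∫ p in polarCoord.target,
    fderiv ℝ F (circleMap 0 p.1 p.2) (circleMap 0 1 p.2) = -(2 * Real.pi) * F 0 := by
  have hint := integrableOn_fderiv_circleMap hF hc (continuous_circleMap 0 1)
  rw [polarCoord_target, Measure.volume_eq_prod] at hint ⊢
  rw [← setIntegral_prod_swap]
  rw [setIntegral_prod (fun q : ℝ × ℝ => fderiv ℝ F (circleMap 0 q.swap.1 q.swap.2)
    (circleMap 0 1 q.swap.2)) hint.swap]
  simp only [Prod.swap_prod_mk, integral_radial_fderiv_eq hF hc]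
  have hlength : volume.real (Set.Ioo (-Real.pi) Real.pi) = 2 * Real.pi := by
    rw [Real.volume_real_Ioo_of_le (by linarith [Real.pi_pos])]
    ring
  rw [setIntegral_const, hlength, Complex.real_smul]
  push_cast
  ring

lemma integral_cauchyKernel_mul_dbar : ∫ w, cauchyKernel w * dbar F w = -F 0 := by
  have hpolar : ∫ w, cauchyKernel w * dbar F w = ∫ p in polarCoord.target,
      (1 / (2 * Real.pi) : ℂ) * (fderiv ℝ F (circleMap 0 p.1 p.2) (circleMap 0 1 p.2) +
        Complex.I * fderiv ℝ F (circleMap 0 p.1 p.2) (circleMap 0 1 p.2 * Complex.I)) := by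
    rw [← Complex.integral_comp_polarCoord_symm]
    refine setIntegral_congr_fun polarCoord.open_target.measurableSet fun p hp => ?_
    rw [polarCoord_target] at hp
    simp only [complex_polarCoord_symm_eq_circleMap]
    exact smul_cauchyKernel_mul_dbar F (ne_of_gt hp.1) p.2
  have hrad := integrableOn_fderiv_circleMap hF hc (continuous_circleMap 0 1)
  have hang := integrableOn_fderiv_circleMap hF hc (v := fun θ => circleMap 0 1 θ * Complex.I)
    ((continuous_circleMap 0 1).mul continuous_const)
  rw [hpolar, integral_const_mul, integral_add hrad (hang.const_mul _), integral_const_mul,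
    setIntegral_angular_fderiv_eq_zero hF hc, setIntegral_radial_fderiv_eq hF hc]
  have hpi : (Real.pi : ℂ) ≠ 0 := mod_cast Real.pi_ne_zero
  field_simp
  ring

lemma planeConv_cauchyKernel_dbar : planeConv cauchyKernel (dbar F) = F := by
  ext z
  have hreflect (t : ℂ) : dbar (fun w => F (z - w)) t = -dbar F (z - t) := by
    have h := dbar_comp_affine (hF.differentiable one_ne_zero) (-1) z t
    simpa only [neg_smul, one_smul, neg_add_eq_sub, Complex.ofReal_neg, Complex.ofReal_one,
      neg_one_mul] using h
  have h := integral_cauchyKernel_mul_dbar (F := fun w => F (z - w)) (by fun_prop)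
    (hc.comp_homeomorph (Homeomorph.subLeft z))
  simp only [hreflect, mul_neg, integral_neg, neg_inj, sub_zero] at h
  exact h

lemma dbar_planeConv_cauchyKernel : dbar (planeConv cauchyKernel F) = F := by
  rw [dbar_planeConv locallyIntegrable_cauchyKernel hF hc, planeConv_cauchyKernel_dbar hF hc]

omit hF hc

lemma exists_norm_planeConv_cauchyKernel_le (r R : ℝ) : ∃ C : ℝ, 0 < C ∧
    ∀ (a : ℂ) (g : ℂ → ℂ) (B : ℝ), (∀ w, ‖g w‖ ≤ B) → (∀ w, R < ‖w - a‖ → g w = 0) →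
      ∀ z ∈ Metric.ball a r, ‖planeConv cauchyKernel g z‖ ≤ C * B := by
  have hint : IntegrableOn cauchyKernel (Metric.closedBall 0 (r + R)) :=
    locallyIntegrable_cauchyKernel.integrableOn_isCompact (isCompact_closedBall _ _)
  have hnonneg : 0 ≤ ∫ t in Metric.closedBall 0 (r + R), ‖cauchyKernel t‖ :=
    integral_nonneg fun _ => norm_nonneg _
  refine ⟨(∫ t in Metric.closedBall 0 (r + R), ‖cauchyKernel t‖) + 1, by linarith,
    fun a g B hg hzero z hz => ?_⟩
  have hB : 0 ≤ B := (norm_nonneg _).trans (hg a)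
  rw [mem_ball_iff_norm] at hz
  have hvanish : ∀ t ∉ Metric.closedBall (0 : ℂ) (r + R), cauchyKernel t * g (z - t) = 0 := by
    intro t ht
    rw [mem_closedBall_zero_iff, not_le] at ht
    have htri : ‖t‖ ≤ ‖z - a‖ + ‖z - t - a‖ := by
      simpa only [sub_sub_sub_cancel_right, sub_sub_cancel] using norm_sub_le (z - a) (z - t - a)
    rw [hzero _ (by linarith), mul_zero]
  calc ‖planeConv cauchyKernel g z‖
      ≤ ∫ t in Metric.closedBall 0 (r + R), ‖cauchyKernel t‖ * B := by
        rw [planeConv_apply, ← setIntegral_eq_integral_of_forall_compl_eq_zero hvanish]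
        refine norm_integral_le_of_norm_le (hint.norm.mul_const B)
          (Eventually.of_forall fun t => ?_)
        rw [norm_mul]
        exact mul_le_mul_of_nonneg_left (hg _) (norm_nonneg _)
    _ ≤ _ := by
        rw [integral_mul_const]
        exact mul_le_mul_of_nonneg_right (le_add_of_nonneg_right zero_le_one) hB

end CauchyTransform

section DistributionalLaplacian

lemma mollify_mollify_comm {f : ℂ → ℂ} (hf : LocallyIntegrable f) {s t : ℝ} (hs : 0 < s)
    (ht : 0 < t) : mollify t (mollify s f) = mollify s (mollify t f) := by
  simp only [← planeConv_complexMollifier]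
  rw [planeConv_assoc hf (contDiff_complexMollifier s).continuous
      (hasCompactSupport_complexMollifier hs) (contDiff_complexMollifier t).continuous
      (hasCompactSupport_complexMollifier ht),
    planeConv_assoc hf (contDiff_complexMollifier t).continuous
      (hasCompactSupport_complexMollifier ht) (contDiff_complexMollifier s).continuous
      (hasCompactSupport_complexMollifier hs), planeConv_comm (complexMollifier s)]

lemma contDiff_one_complexMollifier (s : ℝ) : ContDiff ℝ 1 (complexMollifier s) :=
  (contDiff_complexMollifier s).of_le (by norm_cast)

lemma wirtinger_mollify {f : ℂ → ℂ} (hf : LocallyIntegrable f) {s : ℝ} (hs : 0 < s) :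
    wirtinger (mollify s f) = planeConv f (wirtinger (complexMollifier s)) := by
  rw [← planeConv_complexMollifier, wirtinger_planeConv hf (contDiff_one_complexMollifier s)
    (hasCompactSupport_complexMollifier hs)]

lemma mollify_wirtinger_mollify {f : ℂ → ℂ} (hf : LocallyIntegrable f) {s t : ℝ} (hs : 0 < s)
    (ht : 0 < t) : mollify t (wirtinger (mollify s f)) =
      planeConv f (wirtinger (planeConv (complexMollifier t) (complexMollifier s))) := by
  rw [wirtinger_mollify hf hs, ← planeConv_complexMollifier, planeConv_assoc hf
      (contDiff_wirtinger (m := 0) (contDiff_one_complexMollifier s) (by norm_num)).continuous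
      (hasCompactSupport_wirtinger (hasCompactSupport_complexMollifier hs))
      (contDiff_complexMollifier t).continuous (hasCompactSupport_complexMollifier ht),
    planeConv_comm (wirtinger _),
    wirtinger_planeConv (contDiff_complexMollifier t).continuous.locallyIntegrable
      (contDiff_one_complexMollifier s) (hasCompactSupport_complexMollifier hs)]

lemma contDiff_mollify_complex {f : ℂ → ℂ} (hf : LocallyIntegrable f) {s : ℝ} (hs : 0 < s) :
    ContDiff ℝ ∞ (mollify s f) := by
  rw [← planeConv_complexMollifier]
  exact contDiff_planeConv hf (contDiff_complexMollifier s) (hasCompactSupport_complexMollifier hs)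

lemma mollify_sub {E : Type*} [NormedAddCommGroup E] [NormedSpace ℝ E] {f g : ℂ → E}
    (hf : LocallyIntegrable f) (hg : LocallyIntegrable g) {s : ℝ} (hs : 0 < s) (z : ℂ) :
    mollify s (fun w => f w - g w) z = mollify s f z - mollify s g z := by
  simp only [mollify, smul_sub]
  exact integral_sub (integrable_mollifier_smul hs hf z) (integrable_mollifier_smul hs hg z)

lemma re_mollify {f : ℂ → ℂ} (hf : LocallyIntegrable f) {s : ℝ} (hs : 0 < s) (z : ℂ) :
    (mollify s f z).re = mollify s (fun w => (f w).re) z := by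
  rw [mollify, ← Complex.reCLM_apply,
    ← Complex.reCLM.integral_comp_comm (integrable_mollifier_smul hs hf z)]
  simp only [Complex.reCLM_apply, Complex.smul_re, mollify]

lemma quarterLaplacian_mollify {φ L : ℂ → ℝ} (h : IsDistribLaplacian φ L) {s : ℝ} (hs : 0 < s)
    (z : ℂ) : quarterLaplacian (mollify s φ) z = mollify s L z := by
  have hm : ContDiff ℝ 2 (mollifier s) := (contDiff_mollifier s).of_le (by norm_cast)
  have hmc : ContDiff ℝ 2 (complexMollifier s) := contDiff_ofReal_comp hm
  have hφ := locallyIntegrable_ofReal h.1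
  have hreflect : ∀ t, quarterLaplacian (mollifier s) (z - t) =
      quarterLaplacian (fun w => mollifier s (w - z)) t := fun t => by
    have haff := quarterLaplacian_comp_affine hm (-1) z t
    simp only [neg_smul, one_smul, neg_sq, one_pow, one_mul, neg_add_eq_sub] at haff
    rw [← haff]
    exact congrArg (quarterLaplacian · t) (funext fun w => by rw [← neg_sub, mollifier_neg])
  have hconv : dbar (wirtinger fun w => ((mollify s φ w : ℝ) : ℂ)) z =
      ((∫ t, φ t * quarterLaplacian (fun w => mollifier s (w - z)) t : ℝ) : ℂ) := by
    simp only [← mollify_ofReal]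
    change dbar (wirtinger (mollify s fun w => (φ w : ℂ))) z = _
    rw [wirtinger_mollify hφ hs, dbar_planeConv hφ (contDiff_wirtinger hmc (by norm_num))
      (hasCompactSupport_wirtinger (hasCompactSupport_complexMollifier hs)), planeConv_apply,
      ← integral_complex_ofReal]
    refine integral_congr_ae (Eventually.of_forall fun t => ?_)
    dsimp only
    rw [← hreflect, Complex.ofReal_mul, ← dbar_wirtinger_ofReal hm.contDiffAt]
    rfl
  rw [dbar_wirtinger_ofReal ((contDiff_mollify hs h.1).of_le (by norm_cast)).contDiffAt,
    Complex.ofReal_inj] at hconv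
  have hsupp : HasCompactSupport fun w => mollifier s (w - z) :=
    (hasCompactSupport_mollifier hs).comp_homeomorph (Homeomorph.subRight z)
  have hsmooth : ContDiff ℝ ∞ fun w => mollifier s (w - z) :=
    (contDiff_mollifier s).comp (contDiff_id.sub contDiff_const)
  rw [hconv, h.2.2 _ hsmooth hsupp, mollify, ← integral_add_left_eq_self _ z]
  simp only [add_sub_cancel_left, smul_eq_mul, mul_comm]

lemma quarterLaplacian_eq_of_isDistribLaplacian {φ L : ℂ → ℝ} (h : IsDistribLaplacian φ L)
    (hL : Continuous L) (hφ : ContDiff ℝ 2 φ) : quarterLaplacian φ = L := by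
  have hcont := continuous_quarterLaplacian hφ
  refine (hcont.ae_eq_iff_eq volume hL).1 (ae_eq_of_integral_contDiff_smul_eq
    hcont.locallyIntegrable hL.locallyIntegrable fun η hη hc => ?_)
  simp only [smul_eq_mul]
  rw [integral_mul_quarterLaplacian_comm hφ (hη.of_le (by norm_cast)) hc, h.2.2 η hη hc]
  simp only [mul_comm]

/-- The real linear functional `v ↦ 2 Re (q v)`: the differential of a real-valued function with
Wirtinger derivative `q`. -/
def reMul (q : ℂ) : ℂ →L[ℝ] ℝ := Complex.reCLM.comp ((2 : ℝ) • ContinuousLinearMap.mul ℝ ℂ q)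

lemma reMul_apply (q v : ℂ) : reMul q v = 2 * (q * v).re := by simp [reMul]

lemma norm_reMul_le (q : ℂ) : ‖reMul q‖ ≤ 2 * ‖q‖ := by
  refine ContinuousLinearMap.opNorm_le_bound _ (by positivity) fun v => ?_
  rw [reMul_apply, norm_mul, Real.norm_eq_abs, Real.norm_eq_abs, abs_two, mul_assoc, ← norm_mul]
  exact mul_le_mul_of_nonneg_left (Complex.abs_re_le_norm _) two_pos.le

lemma reMul_sub (q r : ℂ) : reMul (q - r) = reMul q - reMul r := by
  ext v
  simp only [reMul_apply, _root_.sub_apply, sub_mul, Complex.sub_re, mul_sub]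

lemma contDiff_reMul {n : WithTop ℕ∞} : ContDiff ℝ n reMul :=
  contDiff_const.clm_comp ((ContinuousLinearMap.mul ℝ ℂ).contDiff.const_smul (2 : ℝ))

lemma fderiv_eq_reMul {u : ℂ → ℝ} {z : ℂ} (hu : DifferentiableAt ℝ u z) :
    fderiv ℝ u z = reMul (wirtinger (fun w => (u w : ℂ)) z) := by
  ext v
  rw [fderiv_apply_eq_re_wirtinger hu, reMul_apply, mul_assoc, ← Complex.re_ofReal_mul,
    Complex.ofReal_ofNat]

lemma wirtinger_of_hasFDerivAt {u : ℂ → ℝ} {z q : ℂ} (hu : HasFDerivAt u (reMul q) z) :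
    wirtinger (fun w => (u w : ℂ)) z = q := by
  rw [wirtinger, fderiv_ofReal_comp hu.differentiableAt, fderiv_ofReal_comp hu.differentiableAt,
    hu.fderiv, reMul_apply, reMul_apply]
  apply Complex.ext <;> simp

lemma hasFDerivAt_re {H : ℂ → ℂ} {H' w : ℂ} (hH : HasDerivAt H H' w) :
    HasFDerivAt (fun w => (H w).re) (reMul (H' / 2)) w := by
  have h := Complex.reCLM.hasFDerivAt.comp w (hH.hasFDerivAt.restrictScalars ℝ)
  refine h.congr_fderiv (ContinuousLinearMap.ext fun v => ?_)
  rw [reMul_apply, ← Complex.re_ofReal_mul]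
  simp only [ContinuousLinearMap.comp_apply, Complex.reCLM_apply,
    ContinuousLinearMap.coe_restrictScalars', ContinuousLinearMap.toSpanSingleton_apply,
    smul_eq_mul, Complex.ofReal_ofNat]
  congr 1
  ring

lemma hasFDerivAt_norm_sq (w : ℂ) : HasFDerivAt (fun w : ℂ => ‖w‖ ^ 2) (reMul (conj w)) w := by
  refine (hasStrictFDerivAt_norm_sq w).hasFDerivAt.congr_fderiv
    (ContinuousLinearMap.ext fun v => ?_)
  simp [reMul_apply, Complex.inner]
  ring

lemma hasFDerivAt_sub_taylor {u : ℂ → ℝ} (hu : ContDiff ℝ 2 u) (z w : ℂ) :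
    HasFDerivAt (fun w => u (z + w) - (u z + 2 * wirtinger (fun w => (u w : ℂ)) z * w +
        wirtinger (wirtinger fun w => (u w : ℂ)) z * w ^ 2).re - quarterLaplacian u z * ‖w‖ ^ 2)
      (reMul (wirtinger (fun w => (u w : ℂ)) (z + w) - wirtinger (fun w => (u w : ℂ)) z -
        fderiv ℝ (wirtinger fun w => (u w : ℂ)) z w)) w := by
  set p := wirtinger fun w => (u w : ℂ) with hp
  have hdu : DifferentiableAt ℝ u (z + w) := hu.differentiable two_ne_zero _
  have hu' : HasFDerivAt (fun w => u (z + w)) (reMul (p (z + w))) w := by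
    rw [hp, ← fderiv_eq_reMul hdu]
    exact (hasFDerivAt_comp_add_left z).2 hdu.hasFDerivAt
  have hH : HasDerivAt (fun w => u z + 2 * p z * w + wirtinger p z * w ^ 2)
      (2 * p z * 1 + wirtinger p z * (2 * w)) w := by
    simpa using! (((hasDerivAt_id w).const_mul (2 * p z)).const_add (u z : ℂ)).add
      ((hasDerivAt_pow 2 w).const_mul (wirtinger p z))
  refine ((hu'.sub (hasFDerivAt_re hH)).sub
    ((hasFDerivAt_norm_sq w).const_mul (quarterLaplacian u z))).congr_fderiv
    (ContinuousLinearMap.ext fun v => ?_)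
  rw [fderiv_apply_eq_wirtinger_add_dbar, dbar_wirtinger_ofReal hu.contDiffAt]
  simp only [_root_.sub_apply, _root_.smul_apply, reMul_apply, smul_eq_mul]
  rw [← sub_eq_zero]
  simp
  ring

lemma sub_taylor_isLittleO {u : ℂ → ℝ} (hu : ContDiff ℝ 2 u) (z : ℂ) :
    (fun w => u (z + w) - (u z + 2 * wirtinger (fun w => (u w : ℂ)) z * w +
        wirtinger (wirtinger fun w => (u w : ℂ)) z * w ^ 2).re - quarterLaplacian u z * ‖w‖ ^ 2)
      =o[𝓝 0] fun w => ‖w‖ ^ 2 := by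
  have hdiff : DifferentiableAt ℝ (wirtinger fun w => (u w : ℂ)) z :=
    (contDiff_wirtinger (m := 1) (contDiff_ofReal_comp hu) (by norm_num)).differentiable
      one_ne_zero z
  refine Asymptotics.isLittleO_iff.2 fun ε hε => ?_
  obtain ⟨η, hη, hball⟩ := Metric.eventually_nhds_iff_ball.1
    ((hasFDerivAt_iff_isLittleO_nhds_zero.1 hdiff.hasFDerivAt).def (half_pos hε))
  filter_upwards [Metric.ball_mem_nhds 0 hη] with w hw
  have hmvt := (convex_closedBall (0 : ℂ) ‖w‖).norm_image_sub_le_of_norm_hasFDerivWithin_le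
    (C := ε * ‖w‖) (fun x _ => (hasFDerivAt_sub_taylor hu z x).hasFDerivWithinAt) (fun x hx => ?_)
    (Metric.mem_closedBall_self (norm_nonneg w)) (mem_closedBall_zero_iff.2 le_rfl)
  · simpa [mul_assoc, pow_two] using hmvt
  · have hxw := mem_closedBall_zero_iff.1 hx
    have hx := hball x (mem_ball_zero_iff.2 (hxw.trans_lt (mem_ball_zero_iff.1 hw)))
    calc _ ≤ 2 * (ε / 2 * ‖x‖) := (norm_reMul_le _).trans (by gcongr)
      _ = ε * ‖x‖ := by ring
      _ ≤ ε * ‖w‖ := by gcongr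

/-- Near a point where `Δu < 0` the second-order expansion puts `u` below the real part of a
holomorphic function, with equality only at the point: the mean value inequality fails there. -/
lemma quarterLaplacian_nonneg_of_le_mollify {u : ℂ → ℝ} (hu : ContDiff ℝ 2 u) {z : ℂ}
    (hmean : ∀ t, 0 < t → u z ≤ mollify t u z) : 0 ≤ quarterLaplacian u z := by
  by_contra! hneg
  set H : ℂ → ℂ := fun w => u z + 2 * wirtinger (fun w => (u w : ℂ)) z * (w - z) +
    wirtinger (wirtinger fun w => (u w : ℂ)) z * (w - z) ^ 2 with hH
  have hHdiff : Differentiable ℂ H := by fun_prop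
  obtain ⟨η, hη, hball⟩ := Metric.eventually_nhds_iff_ball.1
    ((sub_taylor_isLittleO hu z).def (half_pos (neg_pos.2 hneg)))
  have hs : 0 < η / 2 := half_pos hη
  have hcont : Continuous fun w => (H w).re := Complex.continuous_re.comp hHdiff.continuous
  have hpos : 0 < mollify (η / 2) (fun w => (H w).re - u w) z := by
    refine mollify_pos (f := fun w => (H w).re - u w) hs (hcont.sub hu.continuous) (by simp [hH])
      fun w hw0 hw => ?_
    have htaylor := (le_abs_self _).trans (hball w (mem_ball_zero_iff.2 (by linarith)))
    have hquad : 0 < -quarterLaplacian u z / 2 * ‖w‖ ^ 2 :=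
      mul_pos (half_pos (neg_pos.2 hneg)) (pow_pos (norm_pos_iff.2 hw0) 2)
    rw [norm_pow, norm_norm] at htaylor
    simp only [hH, add_sub_cancel_left]
    linarith
  have hhol : mollify (η / 2) (fun w => (H w).re) z = u z := by
    rw [← re_mollify hHdiff.continuous.locallyIntegrable hs,
      mollify_eq_self_of_differentiableOn hs (half_lt_self hη) hHdiff.differentiableOn]
    simp [hH]
  rw [mollify_sub hcont.locallyIntegrable hu.continuous.locallyIntegrable hs, hhol] at hpos
  linarith [hmean _ hs]

lemma Subharmonic.mollify_le_mollify_mollify {φ : ℂ → ℝ} (hφ : Subharmonic φ)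
    (hint : LocallyIntegrable φ) {s t : ℝ} (hs : 0 < s) (ht : 0 < t) (z : ℂ) :
    mollify s φ z ≤ mollify t (mollify s φ) z := by
  have hcomm : mollify t (mollify s φ) z = mollify s (mollify t φ) z := by
    have h := congrFun (mollify_mollify_comm (locallyIntegrable_ofReal hint) hs ht) z
    simp only [funext (mollify_ofReal _ φ), mollify_ofReal] at h
    exact_mod_cast h
  rw [hcomm]
  refine integral_mono (integrable_mollifier_smul hs hint z)
    (integrable_mollifier_smul hs (contDiff_mollify ht hint).continuous.locallyIntegrable z)
    fun w => ?_
  exact smul_le_smul_of_nonneg_left (hφ.le_mollify ht hint _) (mollifier_nonneg hs w)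

lemma Subharmonic.distribLaplacian_nonneg {φ L : ℂ → ℝ} (hφ : Subharmonic φ)
    (h : IsDistribLaplacian φ L) (hL : Continuous L) (z : ℂ) : 0 ≤ L z := by
  refine ge_of_tendsto (tendsto_mollify_of_continuous hL z) ?_
  filter_upwards [self_mem_nhdsWithin] with s hs
  rw [← quarterLaplacian_mollify h hs]
  exact quarterLaplacian_nonneg_of_le_mollify ((contDiff_mollify hs h.1).of_le (by norm_cast))
    fun t ht => hφ.mollify_le_mollify_mollify h.1 hs ht z

end DistributionalLaplacian

section WirtingerDecomposition

/-- A density `L`, cut off smoothly to a neighbourhood of the point `a`. -/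
def localized (L : ℂ → ℝ) (a w : ℂ) : ℂ := (cutoff 3 (w - a) : ℂ) * (L w : ℂ)

/-- The Cauchy transform of a density `L` cut off near `a`: near `a` it solves `∂̄ c = L`. -/
def localCauchy (L : ℂ → ℝ) (a : ℂ) : ℂ → ℂ := planeConv cauchyKernel (localized L a)

lemma localized_eq_zero (L : ℂ → ℝ) {a w : ℂ} (hw : 6 ≤ ‖w - a‖) : localized L a w = 0 := by
  rw [localized, cutoff_eq_zero three_pos (by linarith), Complex.ofReal_zero, zero_mul]

lemma hasCompactSupport_localized (L : ℂ → ℝ) (a : ℂ) : HasCompactSupport (localized L a) :=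
  HasCompactSupport.intro (isCompact_closedBall a 6) fun _ hw =>
    localized_eq_zero L (not_le.1 (mt mem_closedBall_iff_norm.2 hw)).le

variable {φ L : ℂ → ℝ}

lemma contDiff_localized {m : ℕ∞} (hL : ContDiff ℝ m L) (a : ℂ) : ContDiff ℝ m (localized L a) :=
  (contDiff_ofReal_comp ((contDiff_cutoff 3).comp (contDiff_id.sub contDiff_const))).mul
    (contDiff_ofReal_comp hL)

lemma contDiff_localCauchy {m : ℕ∞} (hL : ContDiff ℝ m L) (a : ℂ) :
    ContDiff ℝ m (localCauchy L a) :=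
  contDiff_planeConv locallyIntegrable_cauchyKernel (contDiff_localized hL a)
    (hasCompactSupport_localized L a)

lemma mollify_localized {s : ℝ} (hs : 0 < s) (hs1 : s < 1) {a z : ℂ} (hz : z ∈ Metric.ball a 2) :
    mollify s (localized L a) z = (mollify s L z : ℝ) := by
  rw [← mollify_ofReal]
  refine integral_congr_ae (Eventually.of_forall fun w => ?_)
  dsimp only
  rcases lt_or_ge ‖w‖ s with hw | hw
  · have hnear : ‖z + w - a‖ ≤ 3 := by
      rw [add_sub_right_comm]
      have hza := mem_ball_iff_norm.1 hz
      exact (norm_add_le _ _).trans (by linarith)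
    rw [localized, cutoff_eq_one three_pos hnear, Complex.ofReal_one, one_mul]
  · rw [mollifier_eq_zero hs hw, zero_smul, zero_smul]

lemma tendstoUniformlyOn_mollify (a : ℂ) {c : ℂ → ℂ} (hc : Continuous c) :
    TendstoUniformlyOn (fun s => mollify s c) c (𝓝[>] 0) (Metric.ball a 1) := by
  have huc := (isCompact_closedBall a 2).uniformContinuousOn_of_continuous hc.continuousOn
  refine Metric.tendstoUniformlyOn_iff.2 fun ε hε => ?_
  obtain ⟨η, hη, hclose⟩ := Metric.uniformContinuousOn_iff.1 huc (ε / 2) (half_pos hε)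
  filter_upwards [Ioo_mem_nhdsGT hη, Ioo_mem_nhdsGT one_pos] with s hs hs1 w hw
  rw [dist_comm, dist_eq_norm]
  refine (norm_mollify_sub_le hs.1 hc.locallyIntegrable fun v hv => ?_).trans_lt (half_lt_self hε)
  have hw := Metric.mem_ball.1 hw
  have hwv : dist (w + v) w = ‖v‖ := by simp [dist_eq_norm]
  rw [← dist_eq_norm]
  refine (hclose _ (Metric.mem_closedBall.2 ?_) _ (Metric.mem_closedBall.2 ?_) ?_).le
  · linarith [dist_triangle (w + v) w a, hs1.2]
  · linarith
  · linarith [hs.2]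

variable (hL : Continuous L)
include hL

lemma continuous_localized (a : ℂ) : Continuous (localized L a) :=
  (contDiff_localized (m := 0) (contDiff_zero.2 hL) a).continuous

lemma continuous_localCauchy (a : ℂ) : Continuous (localCauchy L a) :=
  (contDiff_localCauchy (m := 0) (contDiff_zero.2 hL) a).continuous

lemma dbar_mollify_localCauchy {s : ℝ} (hs : 0 < s) (a : ℂ) :
    dbar (mollify s (localCauchy L a)) = mollify s (localized L a) := by
  have hint := (continuous_localized hL a).locallyIntegrable (μ := volume)
  have hsupp := hasCompactSupport_localized L a
  simp only [← planeConv_complexMollifier]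
  rw [localCauchy, planeConv_assoc locallyIntegrable_cauchyKernel (continuous_localized hL a)
    hsupp (contDiff_complexMollifier s).continuous (hasCompactSupport_complexMollifier hs)]
  exact dbar_planeConv_cauchyKernel
    (contDiff_planeConv (n := 1) hint (contDiff_one_complexMollifier s)
      (hasCompactSupport_complexMollifier hs))
    (hasCompactSupport_planeConv hsupp (hasCompactSupport_complexMollifier hs))

variable (h : IsDistribLaplacian φ L)
include h

section Mollified

variable {s t : ℝ} (hs : 0 < s) (ht : 0 < t)
include hs

/-- By the Cauchy transform, `∂φ - c` is `∂̄`-closed near `a` after mollification. -/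
lemma differentiableOn_wirtinger_mollify_sub (hs1 : s < 1) (a : ℂ) :
    DifferentiableOn ℂ (fun w => wirtinger (mollify s fun x => (φ x : ℂ)) w -
      mollify s (localCauchy L a) w) (Metric.ball a 2) := fun z hz => by
  have hφ := locallyIntegrable_ofReal h.1
  have hφs : ContDiff ℝ 2 (mollify s φ) := (contDiff_mollify hs h.1).of_le (by norm_cast)
  have hd₁ : DifferentiableAt ℝ (wirtinger (mollify s fun x => (φ x : ℂ))) z :=
    (contDiff_wirtinger (m := 1) (contDiff_mollify_complex hφ hs) (by norm_cast)).differentiable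
      one_ne_zero z
  have hd₂ : DifferentiableAt ℝ (mollify s (localCauchy L a)) z :=
    (contDiff_mollify_complex (continuous_localCauchy hL a).locallyIntegrable hs).differentiable
      (by simp) z
  refine (differentiableAt_of_dbar_eq_zero (hd₁.sub hd₂) ?_).differentiableWithinAt
  have hdbar : dbar (wirtinger (mollify s fun x => (φ x : ℂ))) z = (mollify s L z : ℝ) := by
    rw [funext (mollify_ofReal s φ), dbar_wirtinger_ofReal hφs.contDiffAt,
      quarterLaplacian_mollify h hs]
  refine (dbar_sub hd₁ hd₂).trans ?_
  rw [hdbar, dbar_mollify_localCauchy hL hs, mollify_localized hs hs1 hz, sub_self]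

include ht in
/-- On holomorphic functions mollification is the identity, and the two mollifications commute. -/
lemma wirtinger_mollify_sub_eq (hs1 : s < 1) (ht1 : t < 1) {a z : ℂ} (hz : z ∈ Metric.ball a 1) :
    wirtinger (mollify s fun x => (φ x : ℂ)) z - mollify s (localCauchy L a) z =
      wirtinger (mollify t fun x => (φ x : ℂ)) z - mollify t (localCauchy L a) z := by
  have hφ := locallyIntegrable_ofReal h.1
  have hc := (continuous_localCauchy hL a).locallyIntegrable (μ := volume)
  have hball : Metric.ball z 1 ⊆ Metric.ball a 2 :=
    Metric.ball_subset_ball' (by linarith [Metric.mem_ball.1 hz])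
  have hint : ∀ {s}, 0 < s → LocallyIntegrable (wirtinger (mollify s fun x => (φ x : ℂ))) ∧
      LocallyIntegrable (mollify s (localCauchy L a)) := fun hs =>
    ⟨(contDiff_wirtinger (m := 0) (contDiff_mollify_complex hφ hs)
      (by norm_cast)).continuous.locallyIntegrable,
      (contDiff_mollify_complex hc hs).continuous.locallyIntegrable⟩
  rw [← mollify_eq_self_of_differentiableOn ht ht1
      ((differentiableOn_wirtinger_mollify_sub hL h hs hs1 a).mono hball),
    ← mollify_eq_self_of_differentiableOn hs hs1
      ((differentiableOn_wirtinger_mollify_sub hL h ht ht1 a).mono hball),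
    mollify_sub (hint hs).1 (hint hs).2 ht, mollify_sub (hint ht).1 (hint ht).2 hs,
    mollify_wirtinger_mollify hφ hs ht, mollify_wirtinger_mollify hφ ht hs,
    mollify_mollify_comm hc hs ht, planeConv_comm (complexMollifier t)]

end Mollified

lemma Subharmonic.exists_hasFDerivAt (hφ : Subharmonic φ) (a : ℂ) :
    ∃ k : ℂ → ℂ, DifferentiableOn ℂ k (Metric.ball a 1) ∧
      ∀ z ∈ Metric.ball a 1, HasFDerivAt φ (reMul (k z + localCauchy L a z)) z := by
  set k : ℂ → ℂ := fun w => wirtinger (mollify (1 / 2) fun x => (φ x : ℂ)) w -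
    mollify (1 / 2) (localCauchy L a) w with hk
  have hfderiv : ∀ᶠ s in 𝓝[>] (0 : ℝ), ∀ z ∈ Metric.ball a 1,
      HasFDerivAt (mollify s φ) (reMul (k z + mollify s (localCauchy L a) z)) z := by
    filter_upwards [Ioo_mem_nhdsGT one_pos] with s hs z hz
    have hd : DifferentiableAt ℝ (mollify s φ) z :=
      (contDiff_mollify hs.1 h.1).differentiable (by simp) z
    have heq := wirtinger_mollify_sub_eq hL h hs.1 one_half_pos hs.2 one_half_lt_one hz
    simp only [hk]
    rw [← heq, sub_add_cancel, funext (mollify_ofReal s φ), ← fderiv_eq_reMul hd]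
    exact hd.hasFDerivAt
  refine ⟨k, (differentiableOn_wirtinger_mollify_sub hL h one_half_pos one_half_lt_one a).mono
    (Metric.ball_subset_ball one_le_two), fun z hz => ?_⟩
  have hball := Metric.isOpen_ball.mem_nhds hz
  refine hasFDerivAt_of_tendstoUniformlyOnFilter (l := 𝓝[>] (0 : ℝ))
    (f := fun s => mollify s φ) (f' := fun s w => reMul (k w + mollify s (localCauchy L a) w))
    (g' := fun w => reMul (k w + localCauchy L a w)) ?_ ?_
    (Eventually.of_forall fun y => hφ.tendsto_mollify h.1 y)
  · have hunif : TendstoUniformlyOn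
        (fun s w => reMul (k w + mollify s (localCauchy L a) w))
        (fun w => reMul (k w + localCauchy L a w)) (𝓝[>] 0) (Metric.ball a 1) := by
      refine Metric.tendstoUniformlyOn_iff.2 fun ε hε => ?_
      filter_upwards [Metric.tendstoUniformlyOn_iff.1
        (tendstoUniformlyOn_mollify a (continuous_localCauchy hL a)) _ (half_pos hε)] with s hs w hw
      rw [dist_eq_norm, ← reMul_sub, add_sub_add_left_eq_sub]
      have hdist := hs w hw
      rw [dist_eq_norm] at hdist
      linarith [norm_reMul_le (localCauchy L a w - mollify s (localCauchy L a) w)]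
    exact hunif.tendstoUniformlyOnFilter.mono_right (le_principal_iff.2 hball)
  · filter_upwards [hfderiv.prod_mk hball] with n hn using hn.1 _ hn.2

omit hL in
lemma Subharmonic.contDiff_succ {m : ℕ} (hφ : Subharmonic φ) (hL : ContDiff ℝ m L) :
    ContDiff ℝ (m + 1) φ := by
  refine contDiff_succ_iff_fderiv.2 ⟨fun a => ?_, fun hω => absurd hω (by simp),
    contDiff_iff_contDiffAt.2 fun a => ?_⟩ <;>
    obtain ⟨k, hk, hderiv⟩ := hφ.exists_hasFDerivAt hL.continuous h a
  · exact (hderiv a (Metric.mem_ball_self one_pos)).differentiableAt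
  · have hball : Metric.ball a 1 ∈ 𝓝 a := Metric.ball_mem_nhds a one_pos
    have hfderiv : fderiv ℝ φ =ᶠ[𝓝 a] fun z => reMul (k z + localCauchy L a z) := by
      filter_upwards [hball] with z hz using (hderiv z hz).fderiv
    have hkr : ContDiffAt ℝ m k a := (hk.analyticAt hball).contDiffAt.restrict_scalars ℝ
    exact (contDiff_reMul.contDiffAt.comp a
      (hkr.add (contDiff_localCauchy (m := m) hL a).contDiffAt)).congr_of_eventuallyEq hfderiv

lemma Subharmonic.continuous (hφ : Subharmonic φ) : Continuous φ :=
  (hφ.contDiff_succ (m := 0) h (contDiff_zero.2 hL)).continuous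

end WirtingerDecomposition

section BoundedDerivatives

lemma exists_forall_norm_le {F : ℕ → ℂ → ℂ} {m : ℕ} (hF : ∀ i ≤ m, ∃ C : ℝ, ∀ w, ‖F i w‖ ≤ C) :
    ∃ B : ℝ, ∀ i ≤ m, ∀ w, ‖F i w‖ ≤ B := by
  have hbdd : BddAbove (⋃ i ∈ Set.Iic m, Set.range fun w => ‖F i w‖) :=
    (Set.finite_Iic m).bddAbove_biUnion.2 fun i hi =>
      (hF i hi).imp fun _ hC => Set.forall_mem_range.2 hC
  obtain ⟨B, hB⟩ := hbdd
  exact ⟨B, fun i hi w => hB (Set.mem_biUnion (Set.mem_Iic.2 hi) (Set.mem_range_self w))⟩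

lemma norm_wirtinger_iterate_mul_le {i : ℕ} {a b : ℂ → ℂ} {A B : ℝ} (ha : ContDiff ℝ i a)
    (hb : ContDiff ℝ i b) (hA : ∀ l ≤ i, ∀ w, ‖wirtinger^[l] a w‖ ≤ A)
    (hB : ∀ l ≤ i, ∀ w, ‖wirtinger^[l] b w‖ ≤ B) (w : ℂ) :
    ‖wirtinger^[i] (fun w => a w * b w) w‖ ≤ 2 ^ i * (A * B) := by
  induction i generalizing a b with
  | zero =>
    have hAw := hA 0 le_rfl w
    simp only [Function.iterate_zero, id, norm_mul, pow_zero, one_mul] at hAw ⊢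
    exact mul_le_mul hAw (hB 0 le_rfl w) (norm_nonneg _) ((norm_nonneg _).trans hAw)
  | succ i ih =>
    have ha' : ContDiff ℝ i a := ha.of_le (by norm_cast; omega)
    have hb' : ContDiff ℝ i b := hb.of_le (by norm_cast; omega)
    have hda : ContDiff ℝ i (wirtinger a) := contDiff_wirtinger ha (by simp)
    have hdb : ContDiff ℝ i (wirtinger b) := contDiff_wirtinger hb (by simp)
    have hleibniz : wirtinger (fun w => a w * b w) =
        fun w => wirtinger a w * b w + a w * wirtinger b w := funext fun w =>
      wirtinger_mul (ha.differentiable (by simp) w) (hb.differentiable (by simp) w)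
    rw [Function.iterate_succ_apply, hleibniz, wirtinger_iterate_add
      (hda.mul hb').contDiffAt (ha'.mul hdb).contDiffAt]
    calc _ ≤ 2 ^ i * (A * B) + 2 ^ i * (A * B) := norm_add_le_of_le
          (ih hda hb' (fun l hl => hA (l + 1) (by omega)) fun l hl => hB l (by omega))
          (ih ha' hdb (fun l hl => hA l (by omega)) fun l hl => hB (l + 1) (by omega))
      _ = 2 ^ (i + 1) * (A * B) := by ring

lemma wirtinger_iterate_comp_sub_const (f : ℂ → ℂ) (a : ℂ) (i : ℕ) :
    wirtinger^[i] (fun w => f (w - a)) = fun w => wirtinger^[i] f (w - a) := by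
  induction i with
  | zero => rfl
  | succ i ih =>
    rw [Function.iterate_succ_apply', ih, Function.iterate_succ_apply']
    ext w
    simp only [wirtinger, fderiv_comp_sub]

lemma exists_norm_wirtinger_iterate_le_of_hasCompactSupport {f : ℂ → ℂ} {i : ℕ}
    (hf : ContDiff ℝ i f) (hc : HasCompactSupport f) :
    ∃ C : ℝ, ∀ w, ‖wirtinger^[i] f w‖ ≤ C := by
  have hcont : ContDiff ℝ (0 : ℕ) (wirtinger^[i] f) := contDiff_iff_contDiffAt.2 fun z =>
    contDiffAt_wirtinger_iterate (by rw [zero_add]; exact hf.contDiffAt)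
  have hsupp : HasCompactSupport (wirtinger^[i] f) :=
    Function.Iterate.rec HasCompactSupport hc (fun _ => hasCompactSupport_wirtinger) i
  exact hsupp.exists_bound_of_continuous hcont.continuous

/-- `L` is of class `C^m`, and `∂^j L` is bounded for all `j ≤ m` (in particular `L` is). -/
structure HasBoundedDerivs (m : ℕ) (L : ℂ → ℝ) : Prop where
  contDiff : ContDiff ℝ m L
  bounded : ∀ j ≤ m, ∃ C : ℝ, ∀ z, ‖wirtinger^[j] (fun w => (L w : ℂ)) z‖ ≤ C

variable {L : ℂ → ℝ} {m : ℕ} (hL : HasBoundedDerivs m L)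
include hL

lemma HasBoundedDerivs.exists_abs_le : ∃ M : ℝ, ∀ z, |L z| ≤ M :=
  (hL.bounded 0 m.zero_le).imp fun _ hM z => by simpa using hM z

lemma HasBoundedDerivs.exists_norm_wirtinger_iterate_localized_le :
    ∃ B : ℝ, ∀ i ≤ m, ∀ a w, ‖wirtinger^[i] (localized L a) w‖ ≤ B := by
  have hcutoff : ∀ {i : ℕ}, ContDiff ℝ i fun w => (cutoff 3 w : ℂ) := fun {i} =>
    contDiff_ofReal_comp (contDiff_cutoff (n := i) 3)
  obtain ⟨A, hA⟩ := exists_forall_norm_le (m := m) fun i _ =>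
    exists_norm_wirtinger_iterate_le_of_hasCompactSupport (hcutoff (i := i))
      ((hasCompactSupport_cutoff three_pos).comp_left Complex.ofReal_zero)
  obtain ⟨D, hD⟩ := exists_forall_norm_le hL.bounded
  have hAD : 0 ≤ A * D :=
    mul_nonneg ((norm_nonneg _).trans (hA 0 m.zero_le 0)) ((norm_nonneg _).trans (hD 0 m.zero_le 0))
  refine ⟨2 ^ m * (A * D), fun i hi a w => ?_⟩
  have htranslate : ContDiff ℝ i fun w => (cutoff 3 (w - a) : ℂ) :=
    hcutoff.comp (contDiff_id.sub contDiff_const)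
  refine (norm_wirtinger_iterate_mul_le (A := A) (B := D) htranslate
    ((contDiff_ofReal_comp hL.contDiff).of_le (by exact_mod_cast hi)) (fun l hl w => ?_)
    (fun l hl => hD l (hl.trans hi)) w).trans ?_
  · rw [wirtinger_iterate_comp_sub_const fun w => (cutoff 3 w : ℂ)]
    exact hA l (hl.trans hi) _
  · gcongr
    exact one_le_two

lemma HasBoundedDerivs.exists_norm_wirtinger_iterate_localCauchy_le :
    ∃ B : ℝ, ∀ i ≤ m, ∀ a, ∀ z ∈ Metric.ball a 1, ‖wirtinger^[i] (localCauchy L a) z‖ ≤ B := by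
  obtain ⟨B, hB⟩ := hL.exists_norm_wirtinger_iterate_localized_le
  obtain ⟨C, -, hC⟩ := exists_norm_planeConv_cauchyKernel_le 1 6
  refine ⟨C * B, fun i hi a z hz => ?_⟩
  rw [localCauchy, wirtinger_iterate_planeConv locallyIntegrable_cauchyKernel
    ((contDiff_localized (m := m) hL.contDiff a).of_le (by exact_mod_cast hi))
    (hasCompactSupport_localized L a)]
  refine hC a _ B (hB i hi a) (fun w hw => ?_) z hz
  have hzero : localized L a =ᶠ[𝓝 w] fun _ => 0 := by
    have hopen : IsOpen {w : ℂ | 6 < ‖w - a‖} := isOpen_lt continuous_const (by fun_prop)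
    filter_upwards [hopen.mem_nhds hw] with x hx using localized_eq_zero L (le_of_lt hx)
  have hfixed : Function.IsFixedPt wirtinger fun _ => 0 := funext fun w => by simp [wirtinger]
  rw [(wirtinger_iterate_eventuallyEq hzero i).eq_of_nhds, hfixed.iterate i]

end BoundedDerivatives

section Gauge

lemma wirtinger_iterate_polynomial (P : Polynomial ℂ) (i : ℕ) :
    wirtinger^[i] (fun w => P.eval w) = fun w => (Polynomial.derivative^[i] P).eval w := by
  induction i with
  | zero => rfl
  | succ i ih =>
    rw [Function.iterate_succ_apply', ih, Function.iterate_succ_apply']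
    ext w
    rw [wirtinger_holomorphic (Polynomial.differentiableAt _), Polynomial.deriv]

lemma exists_polynomial_iterate_derivative_eq (n : ℕ) (α : ℕ → ℂ) {B : ℝ}
    (hB : ∀ i < n, ‖α i‖ ≤ B) :
    ∃ P : Polynomial ℂ, (∀ i < n, (Polynomial.derivative^[i] P).eval 0 = α i) ∧
      ∀ z : ℂ, ‖z‖ ≤ 1 → ‖P.eval z‖ ≤ n * B := by
  refine ⟨∑ i ∈ Finset.range n, Polynomial.monomial i (α i / i.factorial), fun i hi => ?_,
    fun z hz => ?_⟩
  · rw [← Polynomial.coeff_zero_eq_eval_zero, Polynomial.coeff_iterate_derivative, zero_add,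
      Polynomial.finsetSum_coeff]
    simp only [Polynomial.coeff_monomial, Finset.sum_ite_eq', Finset.mem_range, hi, if_true,
      Nat.descFactorial_self, nsmul_eq_mul]
    exact mul_div_cancel₀ _ (by exact_mod_cast i.factorial_ne_zero)
  · have hterm : ∀ i ∈ Finset.range n,
        ‖(Polynomial.monomial i (α i / i.factorial)).eval z‖ ≤ B := fun i hi => by
      have hfact : (1 : ℝ) ≤ i.factorial := by exact_mod_cast i.factorial_pos
      rw [Polynomial.eval_monomial, norm_mul, norm_div, norm_pow, Complex.norm_natCast]
      calc ‖α i‖ / i.factorial * ‖z‖ ^ i ≤ ‖α i‖ / i.factorial * 1 := by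
            gcongr
            exact pow_le_one₀ (norm_nonneg _) hz
        _ ≤ ‖α i‖ := by
            rw [mul_one]
            exact div_le_self (norm_nonneg _) hfact
        _ ≤ B := hB i (Finset.mem_range.1 hi)
    rw [Polynomial.eval_finsetSum]
    simpa using (norm_sum_le _ _).trans (Finset.sum_le_card_nsmul _ _ _ hterm)

variable {φ L : ℂ → ℝ} {m : ℕ}

lemma exists_holomorphic_hasFDerivAt_sub_re {k c Q : ℂ → ℂ} {a : ℂ} {ρ : ℝ}
    (hk : DifferentiableOn ℂ k (Metric.ball a ρ)) (hQ : Differentiable ℂ Q)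
    (hφ : ∀ z ∈ Metric.ball a ρ, HasFDerivAt φ (reMul (k z + c z)) z) :
    ∃ g : ℂ → ℂ, DifferentiableOn ℂ g (Metric.ball a ρ) ∧ φ a = (g a).re ∧
      ∀ z ∈ Metric.ball a ρ, HasFDerivAt (fun w => φ w - (g w).re) (reMul (c z + Q z)) z := by
  obtain ⟨g₀, hg₀⟩ := ((hk.sub hQ.differentiableOn).const_mul (2 : ℂ)).isExactOn_ball
  have hg : ∀ z ∈ Metric.ball a ρ,
      HasDerivAt (fun z => g₀ z - g₀ a + φ a) (2 * (k z - Q z)) z := fun z hz =>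
    ((hg₀ z hz).sub_const _).add_const _
  refine ⟨_, fun z hz => (hg z hz).differentiableAt.differentiableWithinAt, by simp,
    fun z hz => ((hφ z hz).sub (hasFDerivAt_re (hg z hz))).congr_fderiv ?_⟩
  rw [← reMul_sub, mul_div_cancel_left₀ _ two_ne_zero]
  congr 1
  ring

/-- Adding to the holomorphic part the Taylor polynomial `Q` of `-c` at `a` moves all of `φ` but
a bounded remainder into `Re g`, and makes that remainder flat in the `∂`-directions. -/
theorem Subharmonic.exists_gauge (hφ : Subharmonic φ) (h : IsDistribLaplacian φ L)
    (hL : HasBoundedDerivs m L) :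
    ∃ C : ℝ, 0 < C ∧ ∀ a : ℂ, ∃ g : ℂ → ℂ, DifferentiableOn ℂ g (Metric.ball a 1) ∧
      φ a = (g a).re ∧ (∀ z ∈ Metric.ball a 1, |φ z - (g z).re| ≤ C) ∧
      ∀ i ≤ m, wirtinger^[i] (wirtinger fun w => ((φ w - (g w).re : ℝ) : ℂ)) a = 0 := by
  obtain ⟨B, hB⟩ := hL.exists_norm_wirtinger_iterate_localCauchy_le
  have hB₀ : 0 ≤ B :=
    (norm_nonneg _).trans (hB 0 m.zero_le 0 0 (Metric.mem_ball_self one_pos))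
  set K : ℝ := 2 * (B + (m + 1 : ℕ) * B)
  have hK₀ : 0 ≤ K := by positivity
  refine ⟨K + 1, by positivity, fun a => ?_⟩
  have ha : a ∈ Metric.ball a 1 := Metric.mem_ball_self one_pos
  set c := localCauchy L a
  obtain ⟨k, hk, hderiv⟩ := hφ.exists_hasFDerivAt hL.contDiff.continuous h a
  obtain ⟨P, hP, hPB⟩ := exists_polynomial_iterate_derivative_eq (m + 1)
    (fun i => -wirtinger^[i] c a) (B := B) fun i hi => by
      rw [norm_neg]
      exact hB i (Nat.lt_succ_iff.1 hi) a a ha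
  set Q : ℂ → ℂ := fun w => P.eval (w - a)
  have hQ : Differentiable ℂ Q := P.differentiable.comp (differentiable_id.sub_const a)
  obtain ⟨g, hg, hga, hrem⟩ := exists_holomorphic_hasFDerivAt_sub_re hk hQ hderiv
  refine ⟨g, hg, hga, fun z hz => ?_, fun i hi => ?_⟩
  · have hbound : ∀ x ∈ Metric.ball a 1, ‖reMul (c x + Q x)‖ ≤ K := fun x hx =>
      (norm_reMul_le _).trans <| mul_le_mul_of_nonneg_left (norm_add_le_of_le
        (hB 0 m.zero_le a x hx) (hPB _ (mem_ball_iff_norm.1 hx).le)) two_pos.le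
    have hlip := (convex_ball a 1).norm_image_sub_le_of_norm_hasFDerivWithin_le
      (fun x hx => (hrem x hx).hasFDerivWithinAt) hbound ha hz
    rw [← hga, sub_self, sub_zero, Real.norm_eq_abs] at hlip
    nlinarith [mem_ball_iff_norm.1 hz]
  · have heq : (wirtinger fun w => ((φ w - (g w).re : ℝ) : ℂ)) =ᶠ[𝓝 a] fun w => c w + Q w := by
      filter_upwards [Metric.ball_mem_nhds a one_pos] with w hw
        using wirtinger_of_hasFDerivAt (hrem w hw)
    rw [(wirtinger_iterate_eventuallyEq heq i).eq_of_nhds, wirtinger_iterate_add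
      ((contDiff_localCauchy (m := m) hL.contDiff a).contDiffAt.of_le (by exact_mod_cast hi))
      (contDiff_real_of_entire hQ).contDiffAt,
      wirtinger_iterate_comp_sub_const (fun w => P.eval w), wirtinger_iterate_polynomial]
    dsimp only
    rw [sub_self, hP i (Nat.lt_succ_iff.2 hi), add_neg_cancel]

end Gauge

section LocalEstimates

lemma integrableOn_sq_norm {F : ℂ → ℂ} {a : ℂ} {R : ℝ} (hR : R < 1)
    (hF : DifferentiableOn ℂ F (Metric.ball a 1)) :
    IntegrableOn (fun w => ‖F w‖ ^ 2) (Metric.ball a R) := by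
  have hcont : ContinuousOn (fun w => ‖F w‖ ^ 2) (Metric.closedBall a R) :=
    (hF.continuousOn.mono (Metric.closedBall_subset_ball hR)).norm.pow 2
  exact (hcont.integrableOn_compact (isCompact_closedBall a R)).mono_set
    Metric.ball_subset_closedBall

lemma sq_norm_taylor_le {F : ℂ → ℂ} {a z : ℂ} (m : ℕ) (hz : ‖z - a‖ ≤ 1) :
    ‖∑ j ∈ Finset.range m, (j.factorial : ℂ)⁻¹ • (z - a) ^ j • iteratedDeriv j F a‖ ^ 2 ≤
      m * ∑ j ∈ Finset.range m, ‖iteratedDeriv j F a‖ ^ 2 := by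
  have hterm : ∀ j ∈ Finset.range m,
      ‖(j.factorial : ℂ)⁻¹ • (z - a) ^ j • iteratedDeriv j F a‖ ≤ ‖iteratedDeriv j F a‖ :=
    fun j _ => by
      have hj : (1 : ℝ) ≤ j.factorial := by exact_mod_cast j.factorial_pos
      rw [norm_smul, norm_smul, norm_inv, norm_pow, Complex.norm_natCast, ← mul_assoc]
      exact mul_le_of_le_one_left (norm_nonneg _) (mul_le_one₀ (inv_le_one_of_one_le₀ hj)
        (by positivity) (pow_le_one₀ (norm_nonneg _) hz))
  refine (pow_le_pow_left₀ (norm_nonneg _) (norm_sum_le_of_le _ hterm) 2).trans ?_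
  simpa using sq_sum_le_card_mul_sum_sq (s := Finset.range m) (f := fun j => ‖iteratedDeriv j F a‖)

section Disc

variable {R : ℝ} (hR₀ : 0 < R) (hR : R < 1)
include hR₀ hR

lemma exists_sq_norm_le_integral : ∃ C : ℝ, 0 < C ∧
    ∀ (F : ℂ → ℂ) (a : ℂ), DifferentiableOn ℂ F (Metric.ball a 1) →
    ∀ z ∈ Metric.closedBall a (R / 2), ‖F z‖ ^ 2 ≤ C * ∫ w in Metric.ball a R, ‖F w‖ ^ 2 := by
  have hs : 0 < R / 2 := half_pos hR₀
  obtain ⟨C, hC⟩ :=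
    (hasCompactSupport_mollifier hs).exists_bound_of_continuous (continuous_mollifier (R / 2))
  have hC₀ : 0 < C := (mollifier_pos hs (by simpa using hs)).trans_le ((le_abs_self _).trans (hC 0))
  refine ⟨C, hC₀, fun F a hF z hz => ?_⟩
  rw [mem_closedBall_iff_norm] at hz
  have hsub : Metric.ball z (1 - R / 2) ⊆ Metric.ball a 1 :=
    Metric.ball_subset_ball' (by rw [dist_eq_norm]; linarith)
  have hmean : mollify (R / 2) (fun w => F w ^ 2) z = F z ^ 2 :=
    mollify_eq_self_of_differentiableOn hs (R := 1 - R / 2) (by linarith) ((hF.pow 2).mono hsub)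
  rw [← norm_pow, ← hmean, mollify, ← integral_const_mul,
    ← integral_indicator Metric.isOpen_ball.measurableSet,
    ← integral_add_left_eq_self ((Metric.ball a R).indicator fun w => C * ‖F w‖ ^ 2) z]
  have hint : Integrable ((Metric.ball a R).indicator fun w => C * ‖F w‖ ^ 2) :=
    (integrable_indicator_iff Metric.isOpen_ball.measurableSet).2
      ((integrableOn_sq_norm hR hF).const_mul C)
  refine norm_integral_le_of_norm_le (hint.comp_add_left z) (Eventually.of_forall fun w => ?_)
  rw [norm_smul, norm_pow]
  rcases lt_or_ge ‖w‖ (R / 2) with hw | hw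
  · have hmem : z + w ∈ Metric.ball a R := by
      rw [mem_ball_iff_norm, add_sub_right_comm]
      linarith [norm_add_le (z - a) w]
    rw [Set.indicator_of_mem hmem]
    exact mul_le_mul_of_nonneg_right (hC w) (by positivity)
  · rw [mollifier_eq_zero hs hw, norm_zero, zero_mul]
    exact Set.indicator_nonneg (fun _ _ => by positivity) _

section Taylor

variable {F : ℂ → ℂ} {a z : ℂ} {S : ℝ} (hF : DifferentiableOn ℂ F (Metric.ball a 1))
  (hS : ∀ z ∈ Metric.closedBall a (R / 2), ‖F z‖ ≤ S)
include hF hS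

lemma norm_iteratedDeriv_le (j : ℕ) :
    ‖iteratedDeriv j F a‖ ≤ j.factorial * S / (R / 2) ^ j :=
  Complex.norm_iteratedDeriv_le_of_forall_mem_sphere_norm_le j (half_pos hR₀)
    ((hF.mono (Metric.closedBall_subset_ball (by linarith))).diffContOnCl_ball subset_rfl)
    fun z hz => hS z (Metric.sphere_subset_closedBall hz)

lemma norm_taylor_term_le (j : ℕ) :
    ‖(j.factorial : ℂ)⁻¹ • (z - a) ^ j • iteratedDeriv j F a‖ ≤ S * (‖z - a‖ / (R / 2)) ^ j := by
  have hj : (j.factorial : ℝ) ≠ 0 := by exact_mod_cast j.factorial_ne_zero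
  rw [norm_smul, norm_smul, norm_inv, norm_pow, Complex.norm_natCast]
  calc (j.factorial : ℝ)⁻¹ * (‖z - a‖ ^ j * ‖iteratedDeriv j F a‖)
      ≤ (j.factorial : ℝ)⁻¹ * (‖z - a‖ ^ j * (j.factorial * S / (R / 2) ^ j)) := by
        gcongr
        exact norm_iteratedDeriv_le hR₀ hR hF hS j
    _ = S * (‖z - a‖ / (R / 2)) ^ j := by
        generalize R / 2 = ρ
        rw [div_pow, inv_mul_eq_iff_eq_mul₀ hj]
        ring

lemma norm_sub_taylor_le (m : ℕ) (hz : ‖z - a‖ ≤ R / 4) :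
    ‖F z - ∑ j ∈ Finset.range m, (j.factorial : ℂ)⁻¹ • (z - a) ^ j • iteratedDeriv j F a‖ ≤
      2 * S * (‖z - a‖ / (R / 2)) ^ m := by
  have hS₀ : 0 ≤ S := (norm_nonneg _).trans (hS a (Metric.mem_closedBall_self (by positivity)))
  set q := ‖z - a‖ / (R / 2)
  have hq₀ : 0 ≤ q := by positivity
  have hq : q ≤ 1 / 2 := by
    rw [div_le_iff₀ (half_pos hR₀)]
    linarith
  have hgeo : HasSum (fun j => S * q ^ (j + m)) (S * q ^ m * (1 - q)⁻¹) :=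
    ((hasSum_geometric_of_lt_one hq₀ (by linarith)).mul_left (S * q ^ m)).congr_fun fun j => by ring
  have htail := (hasSum_nat_add_iff' m).2
    (Complex.hasSum_taylorSeries_on_ball hF (mem_ball_iff_norm.2 (by linarith)))
  refine (htail.norm_le_of_bounded hgeo fun j =>
    norm_taylor_term_le hR₀ hR hF hS (j + m)).trans ?_
  have hinv : (1 - q)⁻¹ ≤ 2 := by
    rw [inv_le_comm₀ (by linarith) two_pos]
    linarith
  calc S * q ^ m * (1 - q)⁻¹ ≤ S * q ^ m * 2 := by gcongr
    _ = 2 * S * q ^ m := by ring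

lemma sq_norm_le_jet (m : ℕ) (hz : ‖z - a‖ ≤ R / 4) :
    ‖F z‖ ^ 2 ≤ 2 * m * ∑ j ∈ Finset.range m, ‖iteratedDeriv j F a‖ ^ 2 +
      8 * S ^ 2 * (2 / R) ^ (2 * m) * ‖z - a‖ ^ (2 * m) := by
  set T := ∑ j ∈ Finset.range m, (j.factorial : ℂ)⁻¹ • (z - a) ^ j • iteratedDeriv j F a
  have hT : ‖T‖ ^ 2 ≤ m * ∑ j ∈ Finset.range m, ‖iteratedDeriv j F a‖ ^ 2 :=
    sq_norm_taylor_le m (by linarith)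
  have hrem : ‖F z - T‖ ^ 2 ≤ 4 * S ^ 2 * (2 / R) ^ (2 * m) * ‖z - a‖ ^ (2 * m) :=
    calc ‖F z - T‖ ^ 2 ≤ (2 * S * (‖z - a‖ / (R / 2)) ^ m) ^ 2 :=
          pow_le_pow_left₀ (norm_nonneg _) (norm_sub_taylor_le hR₀ hR hF hS m hz) 2
      _ = 4 * S ^ 2 * (2 / R) ^ (2 * m) * ‖z - a‖ ^ (2 * m) := by
          rw [show ‖z - a‖ / (R / 2) = 2 / R * ‖z - a‖ by field_simp, mul_pow (2 / R)]
          ring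
  have htriangle : ‖F z‖ ≤ ‖F z - T‖ + ‖T‖ := by simpa using norm_add_le (F z - T) T
  nlinarith [norm_nonneg (F z), sq_nonneg (‖F z - T‖ - ‖T‖)]

end Taylor

lemma exists_jet_estimates (n : ℕ) : ∃ C : ℝ, 0 < C ∧
    ∀ (F : ℂ → ℂ) (a : ℂ), DifferentiableOn ℂ F (Metric.ball a 1) →
      (∀ j ≤ n, ‖iteratedDeriv j F a‖ ^ 2 ≤ C * ∫ w in Metric.ball a R, ‖F w‖ ^ 2) ∧
      ∀ k ≤ n, ∀ z, ‖z - a‖ ≤ R / 4 → ‖F z‖ ^ 2 ≤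
        C * ∑ j ∈ Finset.range k, ‖iteratedDeriv j F a‖ ^ 2 +
        C * ‖z - a‖ ^ (2 * k) * ∫ w in Metric.ball a R, ‖F w‖ ^ 2 := by
  obtain ⟨C₁, hC₁, hmean⟩ := exists_sq_norm_le_integral hR₀ hR
  set T : ℝ := (2 / R) ^ (2 * n)
  have hT {k : ℕ} (hk : k ≤ n) : (2 / R) ^ (2 * k) ≤ T :=
    pow_le_pow_right₀ ((one_le_div hR₀).2 (by linarith)) (by omega)
  have hC : 0 < C₁ * T * (n.factorial ^ 2 + 8) := by positivity
  refine ⟨C₁ * T * (n.factorial ^ 2 + 8) + 2 * n, by positivity, fun F a hF => ?_⟩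
  set I := ∫ w in Metric.ball a R, ‖F w‖ ^ 2
  have : 0 ≤ I := integral_nonneg fun _ => by positivity
  have hS : ∀ z ∈ Metric.closedBall a (R / 2), ‖F z‖ ≤ √(C₁ * I) := fun z hz =>
    Real.le_sqrt_of_sq_le (hmean F a hF z hz)
  have hS_sq : √(C₁ * I) ^ 2 = C₁ * I := Real.sq_sqrt (by positivity)
  refine ⟨fun j hj => ?_, fun k hk z hz => ?_⟩
  · calc ‖iteratedDeriv j F a‖ ^ 2 ≤ (j.factorial * √(C₁ * I) / (R / 2) ^ j) ^ 2 :=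
          pow_le_pow_left₀ (norm_nonneg _) (norm_iteratedDeriv_le hR₀ hR hF hS j) 2
      _ = C₁ * (2 / R) ^ (2 * j) * j.factorial ^ 2 * I := by
          rw [div_pow, mul_pow, hS_sq, ← inv_div R 2, inv_pow, ← pow_mul, mul_comm j]
          ring
      _ ≤ C₁ * T * n.factorial ^ 2 * I := by
          gcongr
          exact hT hj
      _ ≤ (C₁ * T * (n.factorial ^ 2 + 8) + 2 * n) * I := by
          gcongr
          have : 0 ≤ C₁ * T * 8 := by positivity
          linarith [Nat.cast_nonneg (α := ℝ) n]
  · refine (sq_norm_le_jet hR₀ hR hF hS k hz).trans (add_le_add ?_ ?_)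
    · gcongr
      have : (k : ℝ) ≤ n := by exact_mod_cast hk
      linarith
    · calc 8 * √(C₁ * I) ^ 2 * (2 / R) ^ (2 * k) * ‖z - a‖ ^ (2 * k)
          = C₁ * (2 / R) ^ (2 * k) * 8 * ‖z - a‖ ^ (2 * k) * I := by
            rw [hS_sq]
            ring
        _ ≤ (C₁ * T * (n.factorial ^ 2 + 8) + 2 * n) * ‖z - a‖ ^ (2 * k) * I := by
            gcongr
            have := mul_le_mul_of_nonneg_left (hT hk) hC₁.le
            have : 0 ≤ C₁ * T * n.factorial ^ 2 := by positivity
            linarith [Nat.cast_nonneg (α := ℝ) n]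

end Disc

lemma sq_norm_mul_gaugeFactor (f g : ℂ → ℂ) (z : ℂ) :
    ‖f z * gaugeFactor g z‖ ^ 2 = ‖f z‖ ^ 2 * Real.exp (-(g z).re) := by
  rw [norm_mul, norm_gaugeFactor, mul_pow, ← Real.exp_nat_mul]
  congr 2
  push_cast
  ring

lemma exp_neg_le_exp_mul_exp_neg {x y C : ℝ} (h : |x - y| ≤ C) :
    Real.exp (-y) ≤ Real.exp C * Real.exp (-x) := by
  rw [← Real.exp_add]
  exact Real.exp_le_exp.2 (by linarith [(abs_le.1 h).2])

lemma setIntegral_sq_norm_mul_gaugeFactor_le {φ : ℂ → ℝ} {f g : ℂ → ℂ} {a : ℂ} {R C : ℝ}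
    (hR : R < 1) (hφ : Continuous φ)
    (hf : Differentiable ℂ f) (hg : DifferentiableOn ℂ g (Metric.ball a 1))
    (hclose : ∀ z ∈ Metric.ball a 1, |φ z - (g z).re| ≤ C) :
    ∫ w in Metric.ball a R, ‖f w * gaugeFactor g w‖ ^ 2 ≤
      Real.exp C * ∫ w in Metric.ball a R, ‖f w‖ ^ 2 * Real.exp (-φ w) := by
  have hF : DifferentiableOn ℂ (fun w => f w * gaugeFactor g w) (Metric.ball a 1) :=
    hf.differentiableOn.mul (hg.neg.div_const 2).cexp
  have hint : IntegrableOn (fun w => ‖f w‖ ^ 2 * Real.exp (-φ w)) (Metric.ball a R) :=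
    (((hf.continuous.norm.pow 2).mul hφ.neg.rexp).continuousOn.integrableOn_compact
      (isCompact_closedBall a R)).mono_set Metric.ball_subset_closedBall
  rw [← integral_const_mul]
  refine setIntegral_mono_on (integrableOn_sq_norm hR hF) (hint.const_mul _)
    Metric.isOpen_ball.measurableSet fun w hw => ?_
  rw [sq_norm_mul_gaugeFactor, mul_left_comm]
  gcongr
  exact exp_neg_le_exp_mul_exp_neg (hclose w (Metric.ball_subset_ball hR.le hw))

lemma Subharmonic.exists_gauged_function {φ L : ℂ → ℝ} {m : ℕ} (hφ : Subharmonic φ)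
    (h : IsDistribLaplacian φ L) (hL : HasBoundedDerivs m L) : ∃ E : ℝ, 1 ≤ E ∧
    ∀ (f : ℂ → ℂ), Differentiable ℂ f → ∀ a : ℂ, ∃ F : ℂ → ℂ,
      DifferentiableOn ℂ F (Metric.ball a 1) ∧
      (∀ j ≤ m + 1,
        ‖(dbarStar φ)^[j] f a‖ ^ 2 * Real.exp (-φ a) = ‖iteratedDeriv j F a‖ ^ 2) ∧
      (∀ R < 1, ∫ w in Metric.ball a R, ‖F w‖ ^ 2 ≤
        E * ∫ w in Metric.ball a R, ‖f w‖ ^ 2 * Real.exp (-φ w)) ∧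
      ∀ z ∈ Metric.ball a 1, ‖f z‖ ^ 2 * Real.exp (-φ z) ≤ E * ‖F z‖ ^ 2 := by
  obtain ⟨G, hG, hgauge⟩ := hφ.exists_gauge h hL
  refine ⟨Real.exp G, Real.one_le_exp hG.le, fun f hf a => ?_⟩
  obtain ⟨g, hg, hga, hclose, hflat⟩ := hgauge a
  refine ⟨fun w => f w * gaugeFactor g w,
    hf.differentiableOn.mul (hg.neg.div_const 2).cexp, fun j hj => ?_, fun R hR => ?_,
    fun z hz => ?_⟩
  · exact sq_norm_dbarStar_iterate_of_gauge (hφ.contDiff_succ h hL.contDiff).contDiffAt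
      (hg.analyticAt (Metric.ball_mem_nhds a one_pos)) (hf.analyticAt a) hga
      (fun i hi => hflat i (Nat.lt_succ_iff.1 hi)) hj
  · exact setIntegral_sq_norm_mul_gaugeFactor_le hR (hφ.continuous hL.contDiff.continuous h) hf hg
      hclose
  · have hweight : Real.exp (-φ z) ≤ Real.exp G * Real.exp (-(g z).re) :=
      exp_neg_le_exp_mul_exp_neg ((abs_sub_comm _ _).trans_le (hclose z hz))
    rw [sq_norm_mul_gaugeFactor, mul_left_comm]
    gcongr

theorem Subharmonic.exists_local_estimates {φ L : ℂ → ℝ} {m : ℕ} {R : ℝ} (hR₀ : 0 < R)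
    (hR : R < 1) (hφ : Subharmonic φ) (h : IsDistribLaplacian φ L) (hL : HasBoundedDerivs m L) :
    ∃ C : ℝ, 0 < C ∧ ∀ (f : ℂ → ℂ), Differentiable ℂ f → ∀ a : ℂ,
      (∀ j ≤ m + 1, ‖(dbarStar φ)^[j] f a‖ ^ 2 * Real.exp (-φ a) ≤
        C * ∫ w in Metric.ball a R, ‖f w‖ ^ 2 * Real.exp (-φ w)) ∧
      ∀ k ≤ m + 2, ∀ z, ‖z - a‖ ≤ R / 4 → ‖f z‖ ^ 2 * Real.exp (-φ z) ≤
        C * ∑ j ∈ Finset.range k, ‖(dbarStar φ)^[j] f a‖ ^ 2 * Real.exp (-φ a) +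
        C * ‖z - a‖ ^ (2 * k) * ∫ w in Metric.ball a R, ‖f w‖ ^ 2 * Real.exp (-φ w) := by
  obtain ⟨E, hE, hgauge⟩ := hφ.exists_gauged_function h hL
  obtain ⟨C, hC, hjet⟩ := exists_jet_estimates hR₀ hR (m + 2)
  refine ⟨E * (C * E), by positivity, fun f hf a => ?_⟩
  obtain ⟨F, hF, hjet_eq, hint, hweight⟩ := hgauge f hf a
  obtain ⟨hderiv, htaylor⟩ := hjet F a hF
  set N := ∫ w in Metric.ball a R, ‖f w‖ ^ 2 * Real.exp (-φ w)
  have : 0 ≤ N := integral_nonneg fun _ => by positivity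
  have hFN : ∫ w in Metric.ball a R, ‖F w‖ ^ 2 ≤ E * N := hint R hR
  refine ⟨fun j hj => ?_, fun k hk z hz => ?_⟩
  · rw [hjet_eq j hj]
    calc ‖iteratedDeriv j F a‖ ^ 2 ≤ C * (E * N) := (hderiv j (by omega)).trans (by gcongr)
      _ ≤ E * (C * (E * N)) := le_mul_of_one_le_left (by positivity) hE
      _ = E * (C * E) * N := by ring
  · rw [Finset.sum_congr rfl fun j hj => hjet_eq j (by have := Finset.mem_range.1 hj; omega)]
    set J := ∑ j ∈ Finset.range k, ‖iteratedDeriv j F a‖ ^ 2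
    have : 0 ≤ J := Finset.sum_nonneg fun _ _ => by positivity
    calc ‖f z‖ ^ 2 * Real.exp (-φ z) ≤ E * ‖F z‖ ^ 2 :=
          hweight z (mem_ball_iff_norm.2 (by linarith))
      _ ≤ E * (C * J + C * ‖z - a‖ ^ (2 * k) * (E * N)) := by
          gcongr
          exact (htaylor k hk z hz).trans (by gcongr)
      _ ≤ E * (C * E * J + C * ‖z - a‖ ^ (2 * k) * (E * N)) := by
          gcongr
          exact le_mul_of_one_le_right hC.le hE
      _ = E * (C * E) * J + E * (C * E) * ‖z - a‖ ^ (2 * k) * N := by ring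

end LocalEstimates

section WeightedPositivity

variable {φ L v κ : ℂ → ℝ} {f : ℂ → ℂ} {M s : ℝ}

lemma integral_mollified_weight_nonneg (hs : 0 < s) (h : IsDistribLaplacian φ L)
    (hf : Differentiable ℂ f) (hv : ContDiff ℝ 2 v) (hκ : ContDiff ℝ 2 κ) (hc : HasCompactSupport κ)
    (hκ₀ : 0 ≤ κ) :
    0 ≤ ∫ z, (κ z * (mollify s L z + quarterLaplacian v z) + quarterLaplacian κ z) *
      (‖f z‖ ^ 2 * Real.exp (-(mollify s φ z + v z))) := by
  have hφs : ContDiff ℝ 2 (mollify s φ) := (contDiff_mollify hs h.1).of_le (by norm_cast)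
  have hΔ : ∀ z, quarterLaplacian (fun w => mollify s φ w + v w) z =
      mollify s L z + quarterLaplacian v z := fun z => by
    rw [quarterLaplacian_add hφs.contDiffAt hv.contDiffAt, quarterLaplacian_mollify h hs]
  simpa only [hΔ] using integral_weight_nonneg_of_contDiff hf (hφs.add hv) hκ hc hκ₀

lemma norm_mollified_weight_le (hs : 0 < s) (hφ : Subharmonic φ) (hint : LocallyIntegrable φ)
    (hM : ∀ z, |L z| ≤ M) (hκ₀ : 0 ≤ κ) (z : ℂ) :
    ‖(κ z * (mollify s L z + quarterLaplacian v z) + quarterLaplacian κ z) *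
        (‖f z‖ ^ 2 * Real.exp (-(mollify s φ z + v z)))‖ ≤
      (κ z * (M + |quarterLaplacian v z|) + |quarterLaplacian κ z|) *
        (‖f z‖ ^ 2 * Real.exp (-(φ z + v z))) := by
  have hL : |mollify s L z| ≤ M :=
    (Real.norm_eq_abs _).symm.trans_le (norm_mollify_le hs fun w _ => hM (z + w))
  have hfactor : |κ z * (mollify s L z + quarterLaplacian v z) + quarterLaplacian κ z| ≤
      κ z * (M + |quarterLaplacian v z|) + |quarterLaplacian κ z| := by
    refine (abs_add_le _ _).trans (add_le_add_left ?_ _)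
    rw [abs_mul, abs_of_nonneg (hκ₀ z)]
    exact mul_le_mul_of_nonneg_left ((abs_add_le _ _).trans (add_le_add_left hL _)) (hκ₀ z)
  have hweight : ‖f z‖ ^ 2 * Real.exp (-(mollify s φ z + v z)) ≤
      ‖f z‖ ^ 2 * Real.exp (-(φ z + v z)) := by
    gcongr
    exact hφ.le_mollify hs hint z
  rw [norm_mul, Real.norm_eq_abs, Real.norm_of_nonneg (by positivity)]
  exact mul_le_mul hfactor hweight (by positivity) ((abs_nonneg _).trans hfactor)

theorem Subharmonic.integral_weight_nonneg (hφ : Subharmonic φ) (h : IsDistribLaplacian φ L)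
    (hL : Continuous L) (hM : ∀ z, |L z| ≤ M) (hf : Differentiable ℂ f) (hv : ContDiff ℝ 2 v)
    (hκ : ContDiff ℝ 2 κ) (hc : HasCompactSupport κ) (hκ₀ : 0 ≤ κ) :
    0 ≤ ∫ z, (κ z * (L z + quarterLaplacian v z) + quarterLaplacian κ z) *
      (‖f z‖ ^ 2 * Real.exp (-(φ z + v z))) := by
  have hφc : Continuous φ := hφ.continuous hL h
  have hfc := hf.continuous
  have hκc := hκ.continuous
  have hvc := hv.continuous
  have hΔv := continuous_quarterLaplacian hv
  have hΔκ := continuous_quarterLaplacian hκ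
  refine ge_of_tendsto (tendsto_integral_filter_of_dominated_convergence
    (l := 𝓝[>] (0 : ℝ)) (F := fun s z =>
      (κ z * (mollify s L z + quarterLaplacian v z) + quarterLaplacian κ z) *
        (‖f z‖ ^ 2 * Real.exp (-(mollify s φ z + v z)))) _ ?_
    (eventually_mem_nhdsWithin.mono fun s hs => .of_forall
      (norm_mollified_weight_le hs hφ h.1 hM hκ₀)) ?_ (.of_forall fun z => ?_))
    (eventually_mem_nhdsWithin.mono fun s hs =>
      integral_mollified_weight_nonneg hs h hf hv hκ hc hκ₀)
  · refine eventually_mem_nhdsWithin.mono fun s hs => ?_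
    have hLs := (contDiff_mollify hs h.2.1).continuous
    have hφs := (contDiff_mollify hs h.1).continuous
    exact Continuous.aestronglyMeasurable (by fun_prop)
  · exact Continuous.integrable_of_hasCompactSupport (by fun_prop)
      (hc.mul_right.add (hasCompactSupport_quarterLaplacian hc).abs).mul_right
  · have hlimL := tendsto_mollify_of_continuous hL z
    have hlimφ := hφ.tendsto_mollify h.1 z
    exact (((hlimL.add_const _).const_mul _).add_const _).mul
      (((Real.continuous_exp.tendsto _).comp (hlimφ.add_const _).neg).const_mul _)

end WeightedPositivity

section RegularizedLog

lemma deriv_smoothTransition_of_nonpos {x : ℝ} (hx : x ≤ 0) : deriv Real.smoothTransition x = 0 :=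
  IsLocalMin.deriv_eq_zero <| .of_forall fun y => by
    rw [Real.smoothTransition.zero_of_nonpos hx]
    exact Real.smoothTransition.nonneg y

lemma deriv_smoothTransition_of_one_le {x : ℝ} (hx : 1 ≤ x) : deriv Real.smoothTransition x = 0 :=
  IsLocalMax.deriv_eq_zero <| .of_forall fun y => by
    rw [Real.smoothTransition.one_of_one_le hx]
    exact Real.smoothTransition.le_one y

lemma exists_deriv_smoothTransition_le : ∃ C, 0 < C ∧ ∀ x, deriv Real.smoothTransition x ≤ C := by
  have hcont : Continuous (deriv Real.smoothTransition) :=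
    (Real.smoothTransition.contDiff (n := 1)).continuous_deriv le_rfl
  have hsupp : HasCompactSupport (deriv Real.smoothTransition) :=
    .intro (isCompact_Icc (a := (0 : ℝ)) (b := 1)) fun x hx => by
      rcases not_and_or.1 hx with h | h
      · exact deriv_smoothTransition_of_nonpos (not_le.1 h).le
      · exact deriv_smoothTransition_of_one_le (not_le.1 h).le
  obtain ⟨C, hC⟩ := hsupp.exists_bound_of_continuous hcont
  exact ⟨max C 1, by positivity, fun x => (le_abs_self _).trans ((hC x).trans (le_max_left _ _))⟩

/-- The continuous function equal to `1` for `t ≤ ρ`, to `0` for `t ≥ T`, and affine in between. -/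
def ramp (ρ T t : ℝ) : ℝ := max 0 (min 1 ((T - t) / (T - ρ)))

/-- The antiderivative of `-ramp ρ T` vanishing for `t ≥ T`. -/
def rampTail (ρ T t : ℝ) : ℝ := ∫ s in t..T, ramp ρ T s

/-- A smooth function equal to `0` for `t ≤ σ / 2` and to `1` for `t ≥ σ`. -/
def smoothSwitch (σ t : ℝ) : ℝ := Real.smoothTransition (2 / σ * t - 1)

/-- The derivative `G'` of `G = regularizedLog ρ T σ`. Where the switch is `1`, the Laplacian
`(t G')'` of the radial potential `G(|z|²)` at `t = |z|²` is `-ramp ρ T t`. -/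
def logSlope (ρ T σ t : ℝ) : ℝ := smoothSwitch σ t * rampTail ρ T t / t

/-- A truncated logarithm: the radial potential `z ↦ regularizedLog ρ T σ (‖z - a‖ ^ 2)` vanishes
for `‖z - a‖ ^ 2 ≥ T`, and its Laplacian is `-1` on the annulus `σ ≤ ‖z - a‖ ^ 2 ≤ ρ`, so that the
mass of a logarithmic pole at `a` is spread out. -/
def regularizedLog (ρ T σ t : ℝ) : ℝ := ∫ s in T..t, logSlope ρ T σ s

variable {ρ T σ τ t : ℝ}

lemma continuous_ramp : Continuous (ramp ρ T) := by
  unfold ramp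
  fun_prop

lemma ramp_nonneg : 0 ≤ ramp ρ T t := le_max_left _ _

lemma ramp_le_one : ramp ρ T t ≤ 1 := max_le zero_le_one (min_le_left _ _)

lemma ramp_eq_one (hρT : ρ < T) (ht : t ≤ ρ) : ramp ρ T t = 1 := by
  have : 1 ≤ (T - t) / (T - ρ) := (one_le_div (by linarith)).2 (by linarith)
  rw [ramp, min_eq_left this, max_eq_right zero_le_one]

lemma ramp_eq_zero (hρT : ρ ≤ T) (ht : T ≤ t) : ramp ρ T t = 0 :=
  max_eq_left ((min_le_right _ _).trans
    (div_nonpos_of_nonpos_of_nonneg (by linarith) (by linarith)))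

lemma hasDerivAt_rampTail (t : ℝ) : HasDerivAt (rampTail ρ T) (-ramp ρ T t) t :=
  intervalIntegral.integral_hasDerivAt_left (continuous_ramp.intervalIntegrable _ _)
    continuous_ramp.stronglyMeasurable.stronglyMeasurableAtFilter continuous_ramp.continuousAt

lemma contDiff_rampTail : ContDiff ℝ 1 (rampTail ρ T) := by
  have hderiv : deriv (rampTail ρ T) = fun t => -ramp ρ T t :=
    funext fun t => (hasDerivAt_rampTail t).deriv
  rw [contDiff_one_iff_deriv, hderiv]
  exact ⟨fun t => (hasDerivAt_rampTail t).differentiableAt, continuous_ramp.neg⟩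

lemma rampTail_eq_zero (hρT : ρ ≤ T) (ht : T ≤ t) : rampTail ρ T t = 0 := by
  rw [rampTail, intervalIntegral.integral_congr (g := fun _ => 0),
    intervalIntegral.integral_zero]
  intro s hs
  rw [Set.uIcc_of_ge ht] at hs
  exact ramp_eq_zero hρT hs.1

lemma rampTail_nonneg (hρT : ρ ≤ T) : 0 ≤ rampTail ρ T t := by
  rcases le_total t T with h | h
  · exact intervalIntegral.integral_nonneg h fun _ _ => ramp_nonneg
  · exact (rampTail_eq_zero hρT h).ge

lemma rampTail_le (hT : 0 ≤ T) (hρT : ρ ≤ T) (ht : 0 ≤ t) : rampTail ρ T t ≤ T := by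
  rcases le_total t T with h | h
  · calc ∫ s in t..T, ramp ρ T s ≤ ∫ _ in t..T, (1 : ℝ) :=
          intervalIntegral.integral_mono_on h (continuous_ramp.intervalIntegrable _ _)
            (continuous_const.intervalIntegrable _ _) fun _ _ => ramp_le_one
      _ ≤ T := by simpa using ht
  · exact (rampTail_eq_zero hρT h).trans_le hT

lemma contDiff_smoothSwitch : ContDiff ℝ 1 (smoothSwitch σ) :=
  Real.smoothTransition.contDiff.comp ((contDiff_const.mul contDiff_id).sub contDiff_const)

lemma smoothSwitch_nonneg : 0 ≤ smoothSwitch σ t := Real.smoothTransition.nonneg _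

lemma smoothSwitch_le_one : smoothSwitch σ t ≤ 1 := Real.smoothTransition.le_one _

lemma smoothSwitch_eq_zero (hσ : 0 < σ) (ht : t ≤ σ / 2) : smoothSwitch σ t = 0 :=
  Real.smoothTransition.zero_of_nonpos (by
    rw [sub_nonpos, div_mul_eq_mul_div, div_le_one hσ]
    linarith)

lemma one_le_two_div_mul_sub_one (hσ : 0 < σ) (ht : σ ≤ t) : 1 ≤ 2 / σ * t - 1 := by
  rw [le_sub_iff_add_le, div_mul_eq_mul_div, le_div_iff₀ hσ]
  linarith

lemma smoothSwitch_eq_one (hσ : 0 < σ) (ht : σ ≤ t) : smoothSwitch σ t = 1 :=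
  Real.smoothTransition.one_of_one_le (one_le_two_div_mul_sub_one hσ ht)

lemma deriv_smoothSwitch : deriv (smoothSwitch σ) t =
    deriv Real.smoothTransition (2 / σ * t - 1) * (2 / σ) := by
  have hinner : HasDerivAt (fun u => 2 / σ * u - 1) (2 / σ) t := by
    simpa using ((hasDerivAt_id t).const_mul (2 / σ)).sub_const 1
  exact ((Real.smoothTransition.contDiff (n := 1)).differentiable one_ne_zero _
    |>.hasDerivAt.comp t hinner).deriv

lemma deriv_smoothSwitch_eq_zero (hσ : 0 < σ) (ht : σ ≤ t) : deriv (smoothSwitch σ) t = 0 := by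
  rw [deriv_smoothSwitch, deriv_smoothTransition_of_one_le (one_le_two_div_mul_sub_one hσ ht),
    zero_mul]

lemma logSlope_eq_zero_of_le (hσ : 0 < σ) (ht : t ≤ σ / 2) : logSlope ρ T σ t = 0 := by
  rw [logSlope, smoothSwitch_eq_zero hσ ht, zero_mul, zero_div]

lemma logSlope_eq_zero_of_ge (hρT : ρ ≤ T) (ht : T ≤ t) : logSlope ρ T σ t = 0 := by
  rw [logSlope, rampTail_eq_zero hρT ht, mul_zero, zero_div]

lemma logSlope_nonneg (hρT : ρ ≤ T) (ht : 0 ≤ t) : 0 ≤ logSlope ρ T σ t :=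
  div_nonneg (mul_nonneg smoothSwitch_nonneg (rampTail_nonneg hρT)) ht

lemma logSlope_le (hT : 0 ≤ T) (hρT : ρ ≤ T) (ht : 0 < t) : logSlope ρ T σ t ≤ T * (1 / t) := by
  rw [mul_one_div]
  exact div_le_div_of_nonneg_right ((mul_le_of_le_one_left (rampTail_nonneg hρT)
    smoothSwitch_le_one).trans (rampTail_le hT hρT ht.le)) ht.le

lemma mul_logSlope (hσ : 0 < σ) (t : ℝ) :
    t * logSlope ρ T σ t = smoothSwitch σ t * rampTail ρ T t := by
  rcases eq_or_ne t 0 with rfl | ht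
  · rw [smoothSwitch_eq_zero hσ (by positivity), zero_mul, zero_mul]
  · exact mul_div_cancel₀ _ ht

lemma contDiff_logSlope (hσ : 0 < σ) : ContDiff ℝ 1 (logSlope ρ T σ) := by
  refine contDiff_iff_contDiffAt.2 fun t => ?_
  rcases eq_or_ne t 0 with rfl | ht
  · exact contDiffAt_const.congr_of_eventuallyEq <|
      (eventually_lt_nhds (half_pos hσ)).mono fun y hy => logSlope_eq_zero_of_le hσ hy.le
  · exact (contDiff_smoothSwitch.contDiffAt.mul contDiff_rampTail.contDiffAt).div contDiffAt_id ht

lemma continuous_logSlope (hσ : 0 < σ) : Continuous (logSlope ρ T σ) :=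
  (contDiff_logSlope hσ).continuous

lemma hasDerivAt_regularizedLog (hσ : 0 < σ) (t : ℝ) :
    HasDerivAt (regularizedLog ρ T σ) (logSlope ρ T σ t) t :=
  have hcont := continuous_logSlope hσ
  intervalIntegral.integral_hasDerivAt_right (hcont.intervalIntegrable _ _)
    hcont.stronglyMeasurable.stronglyMeasurableAtFilter hcont.continuousAt

lemma deriv_regularizedLog (hσ : 0 < σ) : deriv (regularizedLog ρ T σ) = logSlope ρ T σ :=
  funext fun t => (hasDerivAt_regularizedLog hσ t).deriv

lemma contDiff_regularizedLog (hσ : 0 < σ) : ContDiff ℝ 2 (regularizedLog ρ T σ) := by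
  refine (contDiff_succ_iff_deriv (n := 1)).2
    ⟨fun t => (hasDerivAt_regularizedLog hσ t).differentiableAt, by simp, ?_⟩
  rw [deriv_regularizedLog hσ]
  exact contDiff_logSlope hσ

lemma regularizedLog_eq_zero (hρT : ρ ≤ T) (ht : T ≤ t) : regularizedLog ρ T σ t = 0 := by
  rw [regularizedLog, intervalIntegral.integral_congr (g := fun _ => 0),
    intervalIntegral.integral_zero]
  intro s hs
  rw [Set.uIcc_of_le ht] at hs
  exact logSlope_eq_zero_of_ge hρT hs.1

lemma neg_regularizedLog : -regularizedLog ρ T σ t = ∫ s in t..T, logSlope ρ T σ s := by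
  rw [regularizedLog, intervalIntegral.integral_symm, neg_neg]

lemma regularizedLog_nonpos (hρT : ρ ≤ T) (ht : 0 ≤ t) : regularizedLog ρ T σ t ≤ 0 := by
  rcases le_total t T with h | h
  · rw [← neg_nonneg, neg_regularizedLog]
    exact intervalIntegral.integral_nonneg h fun s hs => logSlope_nonneg hρT (ht.trans hs.1)
  · exact (regularizedLog_eq_zero hρT h).le

lemma neg_regularizedLog_le (hσ : 0 < σ) (hρT : ρ ≤ T) (hτ : 0 < τ) (hτT : τ ≤ T) (ht : τ ≤ t) :
    -regularizedLog ρ T σ t ≤ T * Real.log (T / τ) := by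
  have ht₀ : 0 < t := hτ.trans_le ht
  have hT : 0 < T := hτ.trans_le hτT
  rcases le_total t T with h | h
  · have hne : ∀ x ∈ Set.uIcc t T, x ≠ 0 := fun x hx => by
      rw [Set.uIcc_of_le h] at hx
      exact (ht₀.trans_le hx.1).ne'
    rw [neg_regularizedLog]
    calc ∫ s in t..T, logSlope ρ T σ s ≤ ∫ s in t..T, T * (1 / s) :=
          intervalIntegral.integral_mono_on h ((continuous_logSlope hσ).intervalIntegrable _ _)
            ((intervalIntegral.intervalIntegrable_one_div hne continuousOn_id).const_mul T)
            fun s hs => logSlope_le hT.le hρT (ht₀.trans_le hs.1)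
      _ = T * Real.log (T / t) := by
        rw [intervalIntegral.integral_const_mul, integral_one_div_of_pos ht₀ hT]
      _ ≤ T * Real.log (T / τ) := by gcongr
  · rw [regularizedLog_eq_zero hρT h, neg_zero]
    exact mul_nonneg hT.le (Real.log_nonneg ((one_le_div hτ).2 hτT))

lemma regularizedLog_eq_of_le (hσ : 0 < σ) (ht : t ≤ σ / 2) :
    regularizedLog ρ T σ t = regularizedLog ρ T σ (σ / 2) := by
  have hint (a b : ℝ) : IntervalIntegrable (logSlope ρ T σ) volume a b :=
    (continuous_logSlope hσ).intervalIntegrable a b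
  rw [eq_comm, ← sub_eq_zero, regularizedLog, regularizedLog,
    intervalIntegral.integral_interval_sub_left (hint _ _) (hint _ _),
    intervalIntegral.integral_congr (g := fun _ => 0), intervalIntegral.integral_zero]
  intro s hs
  rw [Set.uIcc_of_le ht] at hs
  exact logSlope_eq_zero_of_le hσ hs.2

lemma neg_regularizedLog_le_log_div (hσ : 0 < σ) (hρT : ρ ≤ T) (hσT : σ ≤ T) (t : ℝ) :
    -regularizedLog ρ T σ t ≤ T * Real.log (2 * T / σ) := by
  rw [show 2 * T / σ = T / (σ / 2) by field_simp]
  rcases le_total t (σ / 2) with h | h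
  · rw [regularizedLog_eq_of_le hσ h]
    exact neg_regularizedLog_le hσ hρT (half_pos hσ) (by linarith) le_rfl
  · exact neg_regularizedLog_le hσ hρT (half_pos hσ) (by linarith) h

lemma quarterLaplacian_regularizedLog (hσ : 0 < σ) (a z : ℂ) :
    quarterLaplacian (fun w => regularizedLog ρ T σ (‖w - a‖ ^ 2)) z =
      deriv (smoothSwitch σ) (‖z - a‖ ^ 2) * rampTail ρ T (‖z - a‖ ^ 2) -
        smoothSwitch σ (‖z - a‖ ^ 2) * ramp ρ T (‖z - a‖ ^ 2) := by
  rw [quarterLaplacian_radial (contDiff_regularizedLog hσ), deriv_regularizedLog hσ]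
  set t := ‖z - a‖ ^ 2
  have hslope : HasDerivAt (logSlope ρ T σ) (deriv (logSlope ρ T σ) t) t :=
    ((contDiff_logSlope hσ).differentiable one_ne_zero t).hasDerivAt
  have hswitch : HasDerivAt (smoothSwitch σ) (deriv (smoothSwitch σ) t) t :=
    (contDiff_smoothSwitch.differentiable one_ne_zero t).hasDerivAt
  have hproduct : HasDerivAt (fun u => u * logSlope ρ T σ u)
      (logSlope ρ T σ t + t * deriv (logSlope ρ T σ) t) t := by
    simpa using! (hasDerivAt_id t).mul hslope
  rw [hproduct.unique ((hswitch.mul (hasDerivAt_rampTail t)).congr_of_eventuallyEq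
    (.of_forall (mul_logSlope hσ))), mul_neg, sub_eq_add_neg]

lemma quarterLaplacian_regularizedLog_eq_neg_ramp {a z : ℂ} (hσ : 0 < σ) (hz : σ ≤ ‖z - a‖ ^ 2) :
    quarterLaplacian (fun w => regularizedLog ρ T σ (‖w - a‖ ^ 2)) z =
      -ramp ρ T (‖z - a‖ ^ 2) := by
  rw [quarterLaplacian_regularizedLog hσ, deriv_smoothSwitch_eq_zero hσ hz,
    smoothSwitch_eq_one hσ hz, zero_mul, one_mul, zero_sub]

lemma exists_quarterLaplacian_regularizedLog_le : ∃ C : ℝ, 0 < C ∧ ∀ ρ T σ : ℝ, 0 ≤ T → ρ ≤ T →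
    0 < σ → ∀ a z : ℂ,
      quarterLaplacian (fun w => regularizedLog ρ T σ (‖w - a‖ ^ 2)) z ≤ C * T / σ := by
  obtain ⟨C, hC, hderiv⟩ := exists_deriv_smoothTransition_le
  refine ⟨2 * C, by positivity, fun ρ T σ hT hρT hσ a z => ?_⟩
  rw [quarterLaplacian_regularizedLog hσ, deriv_smoothSwitch]
  set t := ‖z - a‖ ^ 2
  calc deriv Real.smoothTransition (2 / σ * t - 1) * (2 / σ) * rampTail ρ T t -
        smoothSwitch σ t * ramp ρ T t
      ≤ C * (2 / σ) * rampTail ρ T t := by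
        have hgain : deriv Real.smoothTransition (2 / σ * t - 1) * (2 / σ) * rampTail ρ T t ≤
            C * (2 / σ) * rampTail ρ T t := by
          gcongr
          · exact rampTail_nonneg hρT
          · exact hderiv _
        linarith [mul_nonneg (smoothSwitch_nonneg (σ := σ) (t := t))
          (ramp_nonneg (ρ := ρ) (T := T) (t := t))]
    _ ≤ C * (2 / σ) * T := by
        gcongr
        exact rampTail_le hT hρT (by positivity)
    _ = 2 * C * T / σ := by ring

end RegularizedLog

section Counting

variable {s : Set ℂ} {η : ℝ}

lemma sum_setIntegral_ball_le {R : ℝ} (hs : s.Pairwise fun p q => η ≤ dist p q) (hR : 2 * R ≤ η)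
    {g : ℂ → ℝ} (hg : Integrable g) (hg₀ : 0 ≤ g) (F : Finset s) :
    ∑ p ∈ F, ∫ z in Metric.ball (p : ℂ) R, g z ≤ ∫ z, g z := by
  rw [← integral_biUnion_finset F (fun p _ => measurableSet_ball) _ fun p _ => hg.integrableOn]
  · exact setIntegral_le_integral hg (.of_forall hg₀)
  · refine fun p _ q _ hpq => Metric.ball_disjoint_ball ?_
    linarith [hs p.2 q.2 (Subtype.coe_ne_coe.2 hpq)]

lemma volume_real_ball (a : ℂ) {R : ℝ} (hR : 0 ≤ R) :
    volume.real (Metric.ball a R) = R ^ 2 * Real.pi := by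
  simp [Measure.real, Complex.volume_ball, ENNReal.toReal_ofReal hR]

lemma card_le_of_pairwise_le_dist (hη : 0 < η) (hs : s.Pairwise fun p q => η ≤ dist p q) {T : ℝ}
    (hT : 0 ≤ T) (z : ℂ) (F : Finset s) (hF : ∀ p ∈ F, ‖z - p‖ ≤ T) :
    (F.card : ℝ) ≤ ((T + η) / (η / 2)) ^ 2 := by
  have hdisjoint : (F : Set s).PairwiseDisjoint fun p => Metric.ball (p : ℂ) (η / 2) :=
    fun p _ q _ hpq => Metric.ball_disjoint_ball
      ((add_halves η).trans_le (hs p.2 q.2 (Subtype.coe_ne_coe.2 hpq)))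
  have hsubset : ⋃ p ∈ F, Metric.ball (p : ℂ) (η / 2) ⊆ Metric.ball z (T + η) :=
    Set.iUnion₂_subset fun p hp => Metric.ball_subset_ball' (by
      rw [dist_comm, dist_eq_norm]
      linarith [hF p hp])
  have harea := measureReal_mono hsubset (μ := volume) measure_ball_lt_top.ne
  rw [measureReal_biUnion_finset hdisjoint fun _ _ => measurableSet_ball,
    volume_real_ball z (by positivity)] at harea
  simp only [volume_real_ball _ (half_pos hη).le, Finset.sum_const, nsmul_eq_mul,
    ← mul_assoc] at harea
  rw [div_pow, le_div_iff₀ (by positivity)]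
  exact le_of_mul_le_mul_right harea Real.pi_pos

lemma finite_of_pairwise_le_dist (hη : 0 < η) (hs : s.Pairwise fun p q => η ≤ dist p q) (z : ℂ)
    (T : ℝ) : {p : s | ‖z - p‖ ≤ T}.Finite := by
  by_contra hinf
  obtain ⟨k, hk⟩ := exists_nat_gt (((|T| + η) / (η / 2)) ^ 2)
  obtain ⟨F, hF, rfl⟩ := Set.Infinite.exists_subset_card_eq hinf k
  exact hk.not_ge (card_le_of_pairwise_le_dist hη hs (abs_nonneg T) z F
    fun p hp => (hF hp).trans (le_abs_self T))

variable {Λ : MultSet}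

lemma MultSet.mult_le (p : Λ.carrier) : Λ.mult p ≤ Λ.n + 1 :=
  (le_ciSup Λ.bddAbove_mult p).trans le_tsub_add

lemma MultSet.cast_mult_le (p : Λ.carrier) : (Λ.mult p : ℝ) ≤ Λ.n + 1 := by
  exact_mod_cast Λ.mult_le p

lemma MultSet.sum_mult_mul_le (hη : 0 < η) (hs : Λ.carrier.Pairwise fun p q => η ≤ dist p q)
    {T K : ℝ} (hT : 0 ≤ T) (hK : 0 ≤ K) {z : ℂ} {S : Finset Λ.carrier} {b : Λ.carrier → ℝ}
    (hb₀ : ∀ p ∈ S, T < ‖z - p‖ → b p = 0) (hbK : ∀ p ∈ S, b p ≤ K) :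
    ∑ p ∈ S, Λ.mult p * b p ≤ ((T + η) / (η / 2)) ^ 2 * ((Λ.n + 1) * K) := by
  have hcard := card_le_of_pairwise_le_dist hη hs hT z
    (S.filter fun p => ‖z - p‖ ≤ T) fun p hp => (Finset.mem_filter.1 hp).2
  rw [← Finset.sum_filter_of_ne (p := fun p : Λ.carrier => ‖z - p‖ ≤ T) fun p hp hne =>
    not_lt.1 fun hlt => hne (by rw [hb₀ p hp hlt, mul_zero])]
  calc ∑ p ∈ S.filter (fun p : Λ.carrier => ‖z - p‖ ≤ T), Λ.mult p * b p
      ≤ ∑ p ∈ S.filter (fun p : Λ.carrier => ‖z - p‖ ≤ T), (Λ.n + 1) * K :=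
        Finset.sum_le_sum fun p hp => (mul_le_mul_of_nonneg_left
          (hbK p (Finset.mem_filter.1 hp).1) (Nat.cast_nonneg _)).trans
            (mul_le_mul_of_nonneg_right (Λ.cast_mult_le p) hK)
    _ ≤ ((T + η) / (η / 2)) ^ 2 * ((Λ.n + 1) * K) := by
        rw [Finset.sum_const, nsmul_eq_mul]
        gcongr

lemma MultSet.nu_real_ball {r : ℝ} {z : ℂ} {S : Finset Λ.carrier}
    (hS : ∀ p : Λ.carrier, ‖z - p‖ < r → p ∈ S) :
    Λ.nu.real (Metric.ball z r) = ∑ p ∈ S, if ‖z - p‖ < r then (Λ.mult p : ℝ) else 0 := by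
  classical
  have hterm (p : Λ.carrier) : (Λ.mult p • Measure.dirac (p : ℂ)) (Metric.ball z r) =
      if ‖z - p‖ < r then (Λ.mult p : ENNReal) else 0 := by
    rw [Measure.smul_apply, Measure.dirac_apply' _ measurableSet_ball, Set.indicator_apply,
      mem_ball_iff_norm']
    split_ifs <;> simp
  rw [Measure.real, MultSet.nu, Measure.sum_apply _ measurableSet_ball, tsum_congr hterm,
    tsum_eq_sum fun p hp => if_neg (mt (hS p) hp),
    ENNReal.toReal_sum fun p _ => by split_ifs <;> simp]
  exact Finset.sum_congr rfl fun p _ => by split_ifs <;> simp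

lemma MultSet.pi_mul_nuConvChi {r : ℝ} {z : ℂ} {S : Finset Λ.carrier}
    (hS : ∀ p : Λ.carrier, ‖z - p‖ < r → p ∈ S) :
    Real.pi * Λ.nuConvChi r z =
      (∑ p ∈ S, if ‖z - p‖ < r then (Λ.mult p : ℝ) else 0) / r ^ 2 := by
  classical
  have hchi (w : ℂ) : chi r (z - w) =
      (Metric.ball z r).indicator (fun _ => 1 / (Real.pi * r ^ 2)) w := by
    simp only [chi, Set.indicator_apply, mem_ball_iff_norm', zero_sub, norm_neg]
  simp only [MultSet.nuConvChi, hchi]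
  rw [integral_indicator measurableSet_ball, setIntegral_const, Λ.nu_real_ball hS, smul_eq_mul]
  field_simp

lemma MultSet.exists_pi_mul_nuConvChi_le (hη : 0 < η)
    (hs : Λ.carrier.Pairwise fun p q => η ≤ dist p q) {r : ℝ} (hr : 0 ≤ r) :
    ∃ M, ∀ z, Real.pi * Λ.nuConvChi r z ≤ M := by
  refine ⟨((r + η) / (η / 2)) ^ 2 * ((Λ.n + 1) * 1) / r ^ 2, fun z => ?_⟩
  have hfin := finite_of_pairwise_le_dist hη hs z r
  rw [Λ.pi_mul_nuConvChi (S := hfin.toFinset) fun p hp => hfin.mem_toFinset.2 hp.le]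
  refine div_le_div_of_nonneg_right ?_ (sq_nonneg r)
  calc ∑ p ∈ hfin.toFinset, (if ‖z - p‖ < r then (Λ.mult p : ℝ) else 0)
      = ∑ p ∈ hfin.toFinset, Λ.mult p * if ‖z - p‖ < r then (1 : ℝ) else 0 := by
        simp only [mul_ite, mul_one, mul_zero]
    _ ≤ _ := Λ.sum_mult_mul_le hη hs hr zero_le_one (fun p _ hp => if_neg hp.not_gt)
        fun p _ => by split_ifs <;> norm_num

end Counting

section Potential

/-- The potential `c ∑_{λ ∈ S} m_Λ(λ) G(|z - λ|²)` with `G = regularizedLog ρ T σ`, whose Laplacian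
compensates that of the weight away from the points of `S`. -/
def MultSet.potential (Λ : MultSet) (S : Finset Λ.carrier) (c ρ T σ : ℝ) (z : ℂ) : ℝ :=
  c * ∑ p ∈ S, Λ.mult p * regularizedLog ρ T σ (‖z - p‖ ^ 2)

variable {Λ : MultSet} {S : Finset Λ.carrier} {c ρ T σ τ η : ℝ} {z : ℂ}

lemma contDiff_regularizedLog_norm_sub_sq (hσ : 0 < σ) (a : ℂ) :
    ContDiff ℝ 2 fun w : ℂ => regularizedLog ρ T σ (‖w - a‖ ^ 2) :=
  (contDiff_regularizedLog hσ).comp ((contDiff_id.sub contDiff_const).norm_sq ℝ)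

lemma MultSet.contDiff_potential (hσ : 0 < σ) : ContDiff ℝ 2 (Λ.potential S c ρ T σ) :=
  contDiff_const.mul (.sum fun p _ =>
    contDiff_const.mul (contDiff_regularizedLog_norm_sub_sq hσ (p : ℂ)))

lemma MultSet.potential_nonpos (hc : 0 ≤ c) (hρT : ρ ≤ T) : Λ.potential S c ρ T σ z ≤ 0 :=
  mul_nonpos_of_nonneg_of_nonpos hc <| Finset.sum_nonpos fun _ _ =>
    mul_nonpos_of_nonneg_of_nonpos (Nat.cast_nonneg _) (regularizedLog_nonpos hρT (sq_nonneg _))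

lemma MultSet.quarterLaplacian_potential (hσ : 0 < σ) :
    quarterLaplacian (Λ.potential S c ρ T σ) z = c * ∑ p ∈ S, Λ.mult p *
      quarterLaplacian (fun w => regularizedLog ρ T σ (‖w - p‖ ^ 2)) z := by
  have hterm (p : Λ.carrier) :
      ContDiffAt ℝ 2 (fun w : ℂ => regularizedLog ρ T σ (‖w - p‖ ^ 2)) z :=
    (contDiff_regularizedLog_norm_sub_sq hσ (p : ℂ)).contDiffAt
  have hmul (p : Λ.carrier) :
      ContDiffAt ℝ 2 (fun w : ℂ => Λ.mult p * regularizedLog ρ T σ (‖w - p‖ ^ 2)) z :=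
    contDiffAt_const.mul (hterm p)
  unfold MultSet.potential
  rw [quarterLaplacian_const_mul c (ContDiffAt.sum fun p _ => hmul p),
    quarterLaplacian_sum S fun p _ => hmul p]
  simp only [quarterLaplacian_const_mul _ (hterm _)]

lemma MultSet.sum_mult_mul_neg_regularizedLog_le (hη : 0 < η)
    (hs : Λ.carrier.Pairwise fun p q => η ≤ dist p q) (hρT : ρ ≤ T) {K : ℝ} (hK : 0 ≤ K)
    (hG : ∀ p ∈ S, -regularizedLog ρ T σ (‖z - p‖ ^ 2) ≤ K) :
    ∑ p ∈ S, Λ.mult p * -regularizedLog ρ T σ (‖z - p‖ ^ 2) ≤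
      ((√T + η) / (η / 2)) ^ 2 * ((Λ.n + 1) * K) :=
  Λ.sum_mult_mul_le hη hs (Real.sqrt_nonneg T) hK (fun p _ hp => by
    rw [regularizedLog_eq_zero hρT ((Real.sqrt_le_left (norm_nonneg _)).1 hp.le), neg_zero]) hG

lemma MultSet.neg_potential :
    -Λ.potential S c ρ T σ z =
      c * ∑ p ∈ S, Λ.mult p * -regularizedLog ρ T σ (‖z - p‖ ^ 2) := by
  simp only [MultSet.potential, mul_neg, Finset.sum_neg_distrib]

lemma log_two_mul_div_nonneg (hσ : 0 < σ) (hσT : σ ≤ T) : 0 ≤ T * Real.log (2 * T / σ) :=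
  mul_nonneg (by linarith) (Real.log_nonneg ((one_le_div hσ).2 (by linarith)))

lemma MultSet.neg_potential_le (hη : 0 < η) (hs : Λ.carrier.Pairwise fun p q => η ≤ dist p q)
    (hc : 0 ≤ c) (hρT : ρ ≤ T) (hσ : 0 < σ) (hσT : σ ≤ T) :
    -Λ.potential S c ρ T σ z ≤
      c * (((√T + η) / (η / 2)) ^ 2 * ((Λ.n + 1) * (T * Real.log (2 * T / σ)))) := by
  rw [MultSet.neg_potential]
  exact mul_le_mul_of_nonneg_left (Λ.sum_mult_mul_neg_regularizedLog_le hη hs hρT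
    (log_two_mul_div_nonneg hσ hσT) fun p _ => neg_regularizedLog_le_log_div hσ hρT hσT _) hc

lemma half_le_norm_sub_of_ne {s : Set ℂ} (hs : s.Pairwise fun p q => η ≤ dist p q) {p q : s}
    (hpq : q ≠ p) (hz : ‖z - p‖ ≤ η / 2) : η / 2 ≤ ‖z - q‖ := by
  have hsep := hs q.2 p.2 (Subtype.coe_ne_coe.2 hpq)
  have htriangle := dist_triangle_left (q : ℂ) p z
  rw [dist_eq_norm z, dist_eq_norm z] at htriangle
  linarith

lemma MultSet.neg_potential_le_of_norm_sub_le (hη : 0 < η)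
    (hs : Λ.carrier.Pairwise fun p q => η ≤ dist p q) (hc : 0 ≤ c) (hρT : ρ ≤ T) (hσ : 0 < σ)
    (hσT : σ ≤ T) (hτ : 0 < τ) (hτT : τ ≤ T) (hτη : τ ≤ (η / 2) ^ 2) {p : Λ.carrier}
    (hz : ‖z - p‖ ≤ η / 2) :
    -Λ.potential S c ρ T σ z ≤
      c * (((√T + η) / (η / 2)) ^ 2 * ((Λ.n + 1) * (T * Real.log (T / τ))) +
        Λ.mult p * (T * Real.log (2 * T / σ))) := by
  classical
  have hothers := Λ.sum_mult_mul_neg_regularizedLog_le (S := S.erase p) (σ := σ) (z := z) hη hs hρT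
    (mul_nonneg (hτ.le.trans hτT) (Real.log_nonneg ((one_le_div hτ).2 hτT))) fun q hq =>
      neg_regularizedLog_le hσ hρT hτ hτT (hτη.trans (pow_le_pow_left₀ (by positivity)
        (half_le_norm_sub_of_ne hs (Finset.ne_of_mem_erase hq) hz) 2))
  have hpole : Λ.mult p * -regularizedLog ρ T σ (‖z - p‖ ^ 2) ≤
      Λ.mult p * (T * Real.log (2 * T / σ)) :=
    mul_le_mul_of_nonneg_left (neg_regularizedLog_le_log_div hσ hρT hσT _) (Nat.cast_nonneg _)
  have hsum : ∑ q ∈ S, Λ.mult q * -regularizedLog ρ T σ (‖z - q‖ ^ 2) ≤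
      ∑ q ∈ insert p (S.erase p), Λ.mult q * -regularizedLog ρ T σ (‖z - q‖ ^ 2) :=
    Finset.sum_le_sum_of_subset_of_nonneg (Finset.insert_erase_subset p S) fun q _ _ =>
      mul_nonneg (Nat.cast_nonneg _) (neg_nonneg.2 (regularizedLog_nonpos hρT (sq_nonneg _)))
  rw [Finset.sum_insert (Finset.notMem_erase p S)] at hsum
  rw [MultSet.neg_potential]
  exact mul_le_mul_of_nonneg_left (by linarith) hc

lemma MultSet.quarterLaplacian_potential_le_neg_nuConvChi {r : ℝ} (hc : 0 ≤ c) (hr : 0 < r)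
    (hrT : r ^ 2 < T) (hσ : 0 < σ) (hz : ∀ p : Λ.carrier, 1 ≤ Λ.mult p → σ ≤ ‖z - p‖ ^ 2)
    (hS : ∀ p : Λ.carrier, ‖z - p‖ < r → p ∈ S) :
    quarterLaplacian (Λ.potential S c (r ^ 2) T σ) z ≤
      -(c * r ^ 2 * (Real.pi * Λ.nuConvChi r z)) := by
  have hterm (p : Λ.carrier) :
      Λ.mult p * quarterLaplacian (fun w => regularizedLog (r ^ 2) T σ (‖w - p‖ ^ 2)) z ≤
        -if ‖z - p‖ < r then (Λ.mult p : ℝ) else 0 := by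
    rcases Nat.eq_zero_or_pos (Λ.mult p) with hp | hp
    · simp [hp]
    · rw [quarterLaplacian_regularizedLog_eq_neg_ramp hσ (hz p hp)]
      split_ifs with hpr
      · rw [ramp_eq_one hrT (by gcongr), mul_neg_one]
      · rw [mul_neg, neg_zero, neg_nonpos]
        exact mul_nonneg (Nat.cast_nonneg _) ramp_nonneg
  rw [Λ.quarterLaplacian_potential hσ, Λ.pi_mul_nuConvChi hS, mul_assoc,
    mul_div_cancel₀ _ (by positivity), ← mul_neg, ← Finset.sum_neg_distrib]
  exact mul_le_mul_of_nonneg_left (Finset.sum_le_sum fun p _ => hterm p) hc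

lemma MultSet.quarterLaplacian_potential_le (hc : 0 ≤ c) (hσ : 0 < σ) {p : Λ.carrier}
    (hz : ∀ q : Λ.carrier, q ≠ p → σ ≤ ‖z - q‖ ^ 2) {K : ℝ} (hK₀ : 0 ≤ K)
    (hK : quarterLaplacian (fun w => regularizedLog ρ T σ (‖w - p‖ ^ 2)) z ≤ K) :
    quarterLaplacian (Λ.potential S c ρ T σ) z ≤ c * (Λ.mult p * K) := by
  classical
  have hterm (q : Λ.carrier) :
      Λ.mult q * quarterLaplacian (fun w => regularizedLog ρ T σ (‖w - q‖ ^ 2)) z ≤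
        if q = p then Λ.mult p * K else 0 := by
    split_ifs with hqp
    · rw [hqp]
      gcongr
    · rw [quarterLaplacian_regularizedLog_eq_neg_ramp hσ (hz q hqp), mul_neg, neg_nonpos]
      exact mul_nonneg (Nat.cast_nonneg _) ramp_nonneg
  rw [Λ.quarterLaplacian_potential hσ]
  refine mul_le_mul_of_nonneg_left ((Finset.sum_le_sum fun q _ => hterm q).trans ?_) hc
  rw [Finset.sum_ite_eq']
  split_ifs
  · exact le_rfl
  · positivity

end Potential

section CompensatingPotential

/-- A potential `v ≤ 0` such that the weight `φ + v` is superharmonic on `B(0, R)` away from the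
`ε`-discs around the points of `Λ`, where `L = Δφ`. On these discs `e^{-v}` may be large, but not
larger than the vanishing order `m_Λ(λ)` of a function at `λ` can absorb. -/
structure IsCompensatingPotential (Λ : MultSet) (L : ℂ → ℝ) (R ε γ B D E : ℝ) (v : ℂ → ℝ) :
    Prop where
  contDiff : ContDiff ℝ 2 v
  nonpos : v ≤ 0
  exp_neg_le : ∀ z, Real.exp (-v z) ≤ B
  exp_neg_mul_pow_le : ∀ p : Λ.carrier, 1 ≤ Λ.mult p → ∀ z : ℂ, ‖z - p‖ < ε →
    Real.exp (-v z) * ε ^ (2 * Λ.mult p) ≤ E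
  laplacian_le_far : ∀ z : ℂ, ‖z‖ ≤ R → (∀ p : Λ.carrier, 1 ≤ Λ.mult p → ε ≤ ‖z - p‖) →
    L z + quarterLaplacian v z ≤ -γ
  laplacian_le_near : ∀ z : ℂ, ∀ p : Λ.carrier, ‖z - p‖ < ε → L z + quarterLaplacian v z ≤ D

lemma exp_mul_log_mul_pow_le {q X ε : ℝ} {k m : ℕ} (hk : 1 ≤ k) (hkm : k ≤ m) (hq₀ : 0 ≤ q)
    (hq₁ : q ≤ 1) (hX : 0 < X) (hε : 0 < ε) (hε₁ : ε ≤ 1) :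
    Real.exp (k * (q * Real.log (X / ε ^ 2))) * ε ^ (2 * k) ≤
      max 1 X ^ m * ε ^ (2 * (1 - q)) := by
  have hk₁ : (1 : ℝ) ≤ k := by exact_mod_cast hk
  have hsplit : Real.exp (k * (q * Real.log (X / ε ^ 2))) * ε ^ (2 * k) =
      X ^ (k * q) * ε ^ (2 * k * (1 - q)) := by
    rw [Real.log_div hX.ne' (by positivity), Real.log_pow, ← Real.rpow_natCast ε (2 * k),
      Real.rpow_def_of_pos hX, Real.rpow_def_of_pos hε, Real.rpow_def_of_pos hε, ← Real.exp_add,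
      ← Real.exp_add]
    push_cast
    ring_nf
  have hexponent : k * q ≤ m :=
    (mul_le_of_le_one_right k.cast_nonneg hq₁).trans (Nat.cast_le.2 hkm)
  have hbase : X ^ (k * q) ≤ max 1 X ^ m := by
    calc X ^ (k * q) ≤ max 1 X ^ (k * q) := by
          gcongr
          exact le_max_right _ _
      _ ≤ max 1 X ^ (m : ℝ) := Real.rpow_le_rpow_of_exponent_le (le_max_left _ _) hexponent
      _ = max 1 X ^ m := Real.rpow_natCast _ _
  have hradius : ε ^ (2 * k * (1 - q)) ≤ ε ^ (2 * (1 - q)) :=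
    Real.rpow_le_rpow_of_exponent_ge hε hε₁
      (mul_le_mul_of_nonneg_right (by linarith) (sub_nonneg.2 hq₁))
  rw [hsplit]
  gcongr

variable {Λ : MultSet} {L : ℂ → ℝ} {η M δ r c T : ℝ}

lemma exists_potential_parameters (hM : 0 ≤ M) (hδ : 0 < δ) (hr : 0 < r) :
    ∃ c T : ℝ, 0 < c ∧ r ^ 2 < T ∧ c * T < 1 ∧ c * r ^ 2 * (M + δ) = M + δ / 2 := by
  have hsum : 0 < M + δ := by linarith
  have hθ : (M + δ / 2) / (M + δ) < 1 := (div_lt_one hsum).2 (by linarith)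
  have hc : 0 < (M + δ / 2) / (M + δ) / r ^ 2 := by positivity
  have hcr : (M + δ / 2) / (M + δ) / r ^ 2 * r ^ 2 = (M + δ / 2) / (M + δ) :=
    div_mul_cancel₀ _ (by positivity)
  obtain ⟨T, hrT, hT⟩ := exists_between ((lt_div_iff₀' hc).2 (hcr.trans_lt hθ))
  exact ⟨_, T, hc, hrT, (lt_div_iff₀' hc).1 hT, by rw [hcr, div_mul_cancel₀ _ hsum.ne']⟩

lemma MultSet.add_quarterLaplacian_potential_le_neg (hc : 0 ≤ c) (hr : 0 < r) (hrT : r ^ 2 < T)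
    (hcT : c * T ≤ 1) (hcM : c * r ^ 2 * (M + δ) = M + δ / 2) {S : Finset Λ.carrier} {σ : ℝ}
    {z : ℂ} (hLM : L z ≤ M) (hdens : L z + δ ≤ Real.pi * Λ.nuConvChi r z) (hσ : 0 < σ)
    (hz : ∀ p : Λ.carrier, 1 ≤ Λ.mult p → σ ≤ ‖z - p‖ ^ 2)
    (hS : ∀ p : Λ.carrier, ‖z - p‖ < r → p ∈ S) :
    L z + quarterLaplacian (Λ.potential S c (r ^ 2) T σ) z ≤ -(δ / 2) := by
  have hcr : c * r ^ 2 ≤ 1 := (mul_le_mul_of_nonneg_left hrT.le hc).trans hcT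
  calc L z + quarterLaplacian (Λ.potential S c (r ^ 2) T σ) z
      ≤ L z + -(c * r ^ 2 * (Real.pi * Λ.nuConvChi r z)) := by
        gcongr
        exact Λ.quarterLaplacian_potential_le_neg_nuConvChi hc hr hrT hσ hz hS
    _ ≤ L z + -(c * r ^ 2 * (L z + δ)) := by gcongr
    _ = (1 - c * r ^ 2) * L z - c * r ^ 2 * δ := by ring
    _ ≤ (1 - c * r ^ 2) * M - c * r ^ 2 * δ := by gcongr
    _ = -(δ / 2) := by linarith

lemma MultSet.add_quarterLaplacian_potential_le_div {C : ℝ} (hC : 0 ≤ C)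
    (hs : Λ.carrier.Pairwise fun p q => η ≤ dist p q) (hc : 0 ≤ c) (hT : 0 ≤ T) (hM : 0 ≤ M)
    {ρ : ℝ} (hGC : ∀ σ > 0, ∀ a z : ℂ,
      quarterLaplacian (fun w => regularizedLog ρ T σ (‖w - a‖ ^ 2)) z ≤ C * T / σ)
    {S : Finset Λ.carrier} {ε : ℝ} (hε : 0 < ε) (hε₁ : ε ≤ 1) (hεη : 2 * ε ≤ η) {z : ℂ}
    (hLM : L z ≤ M) {p : Λ.carrier} (hz : ‖z - p‖ < ε) :
    L z + quarterLaplacian (Λ.potential S c ρ T (ε ^ 2)) z ≤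
      (M + c * ((Λ.n + 1) * (C * T))) / ε ^ 2 := by
  have hothers (q : Λ.carrier) (hqp : q ≠ p) : ε ^ 2 ≤ ‖z - q‖ ^ 2 :=
    pow_le_pow_left₀ hε.le (le_trans (by linarith)
      (half_le_norm_sub_of_ne hs hqp (by linarith))) 2
  have hM' : M ≤ M / ε ^ 2 :=
    (le_div_iff₀ (by positivity)).2 (mul_le_of_le_one_right hM (pow_le_one₀ hε.le hε₁))
  calc L z + quarterLaplacian (Λ.potential S c ρ T (ε ^ 2)) z
      ≤ M / ε ^ 2 + c * (Λ.mult p * (C * T / ε ^ 2)) :=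
        add_le_add (hLM.trans hM') (Λ.quarterLaplacian_potential_le hc (by positivity) hothers
          (by positivity) (hGC _ (by positivity) _ _))
    _ ≤ M / ε ^ 2 + c * ((Λ.n + 1) * (C * T / ε ^ 2)) := by
        gcongr
        exact Λ.cast_mult_le p
    _ = (M + c * ((Λ.n + 1) * (C * T))) / ε ^ 2 := by ring

lemma MultSet.exp_neg_potential_mul_pow_le (hη : 0 < η)
    (hs : Λ.carrier.Pairwise fun p q => η ≤ dist p q) (hc : 0 ≤ c) {ρ τ : ℝ} (hρT : ρ ≤ T)
    (hcT : c * T ≤ 1) (hτ : 0 < τ) (hτT : τ ≤ T) (hτη : τ ≤ (η / 2) ^ 2) {S : Finset Λ.carrier}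
    {ε : ℝ} (hε : 0 < ε) (hε₁ : ε ≤ 1) (hεη : 2 * ε ≤ η) (hεT : ε ^ 2 ≤ T) {p : Λ.carrier}
    (hp : 1 ≤ Λ.mult p) {z : ℂ} (hz : ‖z - p‖ < ε) :
    Real.exp (-Λ.potential S c ρ T (ε ^ 2) z) * ε ^ (2 * Λ.mult p) ≤
      Real.exp (c * (((√T + η) / (η / 2)) ^ 2 * ((Λ.n + 1) * (T * Real.log (T / τ))))) *
        (max 1 (2 * T) ^ (Λ.n + 1)) * ε ^ (2 * (1 - c * T)) := by
  have hT : 0 < T := hτ.trans_le hτT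
  set b := c * (((√T + η) / (η / 2)) ^ 2 * ((Λ.n + 1) * (T * Real.log (T / τ))))
  have hneg : -Λ.potential S c ρ T (ε ^ 2) z ≤
      b + Λ.mult p * (c * T * Real.log (2 * T / ε ^ 2)) := by
    have hzη : ‖z - p‖ ≤ η / 2 := by linarith
    refine (Λ.neg_potential_le_of_norm_sub_le hη hs hc hρT (by positivity) hεT hτ hτT hτη
      hzη).trans_eq ?_
    ring
  calc Real.exp (-Λ.potential S c ρ T (ε ^ 2) z) * ε ^ (2 * Λ.mult p)
      ≤ Real.exp (b + Λ.mult p * (c * T * Real.log (2 * T / ε ^ 2))) * ε ^ (2 * Λ.mult p) := by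
        gcongr
    _ = Real.exp b * (Real.exp (Λ.mult p * (c * T * Real.log (2 * T / ε ^ 2))) *
          ε ^ (2 * Λ.mult p)) := by rw [Real.exp_add, mul_assoc]
    _ ≤ Real.exp b * (max 1 (2 * T) ^ (Λ.n + 1) * ε ^ (2 * (1 - c * T))) :=
        mul_le_mul_of_nonneg_left (exp_mul_log_mul_pow_le hp (Λ.mult_le p) (by positivity) hcT
          (by positivity) hε hε₁) (Real.exp_nonneg b)
    _ = _ := by ring

theorem exists_isCompensatingPotential (hη : 0 < η)
    (hs : Λ.carrier.Pairwise fun p q => η ≤ dist p q) (hM : 0 ≤ M) (hLM : ∀ z, L z ≤ M)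
    (hδ : 0 < δ) (hr : 0 < r) (hdens : ∀ z, L z + δ ≤ Real.pi * Λ.nuConvChi r z) :
    ∃ s A W : ℝ, 0 < s ∧ 0 < A ∧ 0 < W ∧ ∀ ε, 0 < ε → ε ≤ 1 → ε ≤ r → 2 * ε ≤ η →
      ∃ B : ℝ, 0 < B ∧ ∀ R : ℝ, ∃ v : ℂ → ℝ,
        IsCompensatingPotential Λ L R ε (δ / 2) B (A / ε ^ 2) (W * ε ^ s) v := by
  obtain ⟨c, T, hc, hrT, hcT, hcM⟩ := exists_potential_parameters hM hδ hr
  obtain ⟨C, hC, hlaplacian⟩ := exists_quarterLaplacian_regularizedLog_le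
  have hT : 0 < T := (sq_nonneg r).trans_lt hrT
  set τ := min T ((η / 2) ^ 2)
  have hτ : 0 < τ := lt_min hT (by positivity)
  refine ⟨2 * (1 - c * T), M + c * ((Λ.n + 1) * (C * T)),
    Real.exp (c * (((√T + η) / (η / 2)) ^ 2 * ((Λ.n + 1) * (T * Real.log (T / τ))))) *
      max 1 (2 * T) ^ (Λ.n + 1), by linarith, by positivity, by positivity,
    fun ε hε hε₁ hεr hεη => ⟨Real.exp (c * (((√T + η) / (η / 2)) ^ 2 *
      ((Λ.n + 1) * (T * Real.log (2 * T / ε ^ 2))))), Real.exp_pos _, fun R => ?_⟩⟩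
  have hεT : ε ^ 2 ≤ T := (pow_le_pow_left₀ hε.le hεr 2).trans hrT.le
  have hfinite := finite_of_pairwise_le_dist hη hs 0 (R + r)
  refine ⟨Λ.potential hfinite.toFinset c (r ^ 2) T (ε ^ 2), ?_⟩
  exact {
    contDiff := Λ.contDiff_potential (by positivity)
    nonpos := fun z => Λ.potential_nonpos hc.le hrT.le
    exp_neg_le := fun z => Real.exp_le_exp.2
      (Λ.neg_potential_le hη hs hc.le hrT.le (by positivity) hεT)
    exp_neg_mul_pow_le := fun p hp z hz => Λ.exp_neg_potential_mul_pow_le hη hs hc.le hrT.le hcT.le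
      hτ (min_le_left _ _) (min_le_right _ _) hε hε₁ hεη hεT hp hz
    laplacian_le_far := fun z hzR hz => Λ.add_quarterLaplacian_potential_le_neg hc.le hr hrT hcT.le
      hcM (hLM z) (hdens z) (by positivity) (fun p hp => pow_le_pow_left₀ hε.le (hz p hp) 2)
      fun p hp => hfinite.mem_toFinset.2 (by
        rw [Set.mem_ofPred_eq, zero_sub, norm_neg]
        linarith [norm_le_norm_add_norm_sub z (p : ℂ)])
    laplacian_le_near := fun z p hz => Λ.add_quarterLaplacian_potential_le_div hC.le hs hc.le hT.le
      hM (fun σ hσ => hlaplacian (r ^ 2) T σ hT.le hrT.le hσ) hε hε₁ hεη (hLM z) hz }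

end CompensatingPotential

section CutoffEstimate

variable {Λ : MultSet} {φ L v : ℂ → ℝ} {f : ℂ → ℂ} {H : Λ.carrier → ℝ} {S : Finset Λ.carrier}
  {ε γ B D E : ℝ}

lemma IsCompensatingPotential.mul_laplacian_mul_le {R k u w : ℝ} {z : ℂ}
    (hv : IsCompensatingPotential Λ L R ε γ B D E v) (hγ : 0 ≤ γ) (hD : 0 ≤ D) (hk₀ : 0 ≤ k)
    (hk₁ : k ≤ 1) (hkR : R ≤ ‖z‖ → k = 0) (hw : 0 ≤ w) (hwu : w ≤ u) (hH₀ : 0 ≤ H)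
    (hH : ∀ p, 1 ≤ Λ.mult p → ‖z - p‖ < ε → u ≤ H p)
    (hS : ∀ p : Λ.carrier, ‖(p : ℂ)‖ ≤ R + ε → p ∈ S) :
    k * (L z + quarterLaplacian v z) * u ≤ -(γ * (k * w)) +
      ∑ p ∈ S, (Metric.ball (p : ℂ) ε).indicator (fun _ => (D + γ) * H p) z := by
  have hterm : ∀ p ∈ S, 0 ≤ (Metric.ball (p : ℂ) ε).indicator (fun _ => (D + γ) * H p) z :=
    fun p _ => Set.indicator_nonneg (fun _ _ => mul_nonneg (add_nonneg hD hγ) (hH₀ p)) z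
  rcases le_or_gt R ‖z‖ with hz | hz
  · simpa [hkR hz] using Finset.sum_nonneg hterm
  have hku : 0 ≤ k * u := mul_nonneg hk₀ (hw.trans hwu)
  have hkw : γ * (k * w) ≤ γ * (k * u) := by gcongr
  by_cases hfar : ∀ p : Λ.carrier, 1 ≤ Λ.mult p → ε ≤ ‖z - p‖
  · have hlaplacian := mul_le_mul_of_nonneg_left (hv.laplacian_le_far z hz.le hfar) hku
    linarith [Finset.sum_nonneg hterm]
  · push Not at hfar
    obtain ⟨p, hp, hpz⟩ := hfar
    have hpS : p ∈ S := hS p (by linarith [norm_le_norm_add_norm_sub z (p : ℂ)])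
    have hsum := Finset.single_le_sum hterm hpS
    rw [Set.indicator_of_mem (mem_ball_iff_norm.2 hpz)] at hsum
    have hlaplacian := mul_le_mul_of_nonneg_left (hv.laplacian_le_near z p hpz) hku
    have hpeak : (D + γ) * (k * u) ≤ (D + γ) * H p := mul_le_mul_of_nonneg_left
      ((mul_le_of_le_one_left (hw.trans hwu) hk₁).trans (hH p hp hpz)) (add_nonneg hD hγ)
    linarith

lemma mul_exp_neg_add (x a b : ℝ) :
    x * Real.exp (-(a + b)) = Real.exp (-b) * (x * Real.exp (-a)) := by
  rw [neg_add, Real.exp_add]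
  ring

lemma IsCompensatingPotential.cutoff_weight_le {ℓ K x a : ℝ} {z : ℂ} (hℓ : 0 < ℓ)
    (hK : |quarterLaplacian (cutoff ℓ) z| ≤ K)
    (hv : IsCompensatingPotential Λ L (2 * ℓ) ε γ B D E v) (hγ : 0 ≤ γ) (hD : 0 ≤ D) (hx : 0 ≤ x)
    (hH₀ : 0 ≤ H)
    (hH : ∀ p, 1 ≤ Λ.mult p → ‖z - p‖ < ε → x * Real.exp (-(a + v z)) ≤ H p)
    (hS : ∀ p : Λ.carrier, ‖(p : ℂ)‖ ≤ 2 * ℓ + ε → p ∈ S) :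
    (cutoff ℓ z * (L z + quarterLaplacian v z) + quarterLaplacian (cutoff ℓ) z) *
        (x * Real.exp (-(a + v z))) ≤
      -(γ * (cutoff ℓ z * (x * Real.exp (-a)))) +
        ∑ p ∈ S, (Metric.ball (p : ℂ) ε).indicator (fun _ => (D + γ) * H p) z +
        K * B * (x * Real.exp (-a)) := by
  have hw : 0 ≤ x * Real.exp (-a) := by positivity
  have hwu : x * Real.exp (-a) ≤ x * Real.exp (-(a + v z)) := by
    rw [mul_exp_neg_add]
    exact le_mul_of_one_le_left hw (Real.one_le_exp (neg_nonneg.2 (hv.nonpos z)))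
  have huB : x * Real.exp (-(a + v z)) ≤ B * (x * Real.exp (-a)) := by
    rw [mul_exp_neg_add]
    exact mul_le_mul_of_nonneg_right (hv.exp_neg_le z) hw
  have hcutoff : quarterLaplacian (cutoff ℓ) z * (x * Real.exp (-(a + v z))) ≤
      K * (B * (x * Real.exp (-a))) :=
    mul_le_mul ((le_abs_self _).trans hK) huB (hw.trans hwu) ((abs_nonneg _).trans hK)
  linarith [hv.mul_laplacian_mul_le hγ hD (cutoff_nonneg ℓ z) (cutoff_le_one ℓ z)
    (cutoff_eq_zero hℓ) hw hwu hH₀ hH hS]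

lemma IsCompensatingPotential.mul_exp_neg_add_le {R x a i j : ℝ} {p : Λ.carrier} {z : ℂ}
    (hv : IsCompensatingPotential Λ L R ε γ B D E v) (hp : 1 ≤ Λ.mult p) (hz : ‖z - p‖ < ε)
    (hj : 0 ≤ j) (hi : 0 ≤ i) (hx : x * Real.exp (-a) ≤ j + ε ^ (2 * Λ.mult p) * i) :
    x * Real.exp (-(a + v z)) ≤ B * j + E * i :=
  calc x * Real.exp (-(a + v z)) = Real.exp (-v z) * (x * Real.exp (-a)) := mul_exp_neg_add _ _ _
    _ ≤ Real.exp (-v z) * (j + ε ^ (2 * Λ.mult p) * i) :=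
        mul_le_mul_of_nonneg_left hx (Real.exp_nonneg _)
    _ = Real.exp (-v z) * j + Real.exp (-v z) * ε ^ (2 * Λ.mult p) * i := by ring
    _ ≤ B * j + E * i := add_le_add (mul_le_mul_of_nonneg_right (hv.exp_neg_le z) hj)
        (mul_le_mul_of_nonneg_right (hv.exp_neg_mul_pow_le p hp z hz) hi)

lemma integral_sum_indicator_ball (hε : 0 ≤ ε) (c : Λ.carrier → ℝ) :
    ∫ z, ∑ p ∈ S, (Metric.ball (p : ℂ) ε).indicator (fun _ => c p) z =
      ε ^ 2 * Real.pi * ∑ p ∈ S, c p := by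
  rw [integral_finsetSum S fun p _ => (integrable_indicator_iff measurableSet_ball).2
    (integrableOn_const measure_ball_lt_top.ne), Finset.mul_sum]
  refine Finset.sum_congr rfl fun p _ => ?_
  rw [integral_indicator measurableSet_ball, setIntegral_const, volume_real_ball _ hε, smul_eq_mul]

lemma Subharmonic.integral_cutoff_mul_le (hφ : Subharmonic φ) (h : IsDistribLaplacian φ L)
    (hL : Continuous L) {M : ℝ} (hM : ∀ z, |L z| ≤ M) (hf : MemFock φ f) {ℓ K : ℝ} (hℓ : 0 < ℓ)
    (hK : ∀ z, |quarterLaplacian (cutoff ℓ) z| ≤ K)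
    (hv : IsCompensatingPotential Λ L (2 * ℓ) ε γ B D E v) (hε : 0 ≤ ε) (hγ : 0 ≤ γ) (hD : 0 ≤ D)
    (hH₀ : 0 ≤ H) (hH : ∀ p : Λ.carrier, 1 ≤ Λ.mult p → ∀ z : ℂ, ‖z - p‖ < ε →
      ‖f z‖ ^ 2 * Real.exp (-(φ z + v z)) ≤ H p)
    (hS : ∀ p : Λ.carrier, ‖(p : ℂ)‖ ≤ 2 * ℓ + ε → p ∈ S) :
    γ * ∫ z, cutoff ℓ z * (‖f z‖ ^ 2 * Real.exp (-φ z)) ≤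
      (D + γ) * (ε ^ 2 * Real.pi) * ∑ p ∈ S, H p + K * B * fockNormSq φ f := by
  have hφc : Continuous φ := hφ.continuous hL h
  have hfc : Continuous f := hf.1.continuous
  have hvc : Continuous v := hv.contDiff.continuous
  have hκ : ContDiff ℝ 2 (cutoff ℓ) := contDiff_cutoff ℓ (n := 2)
  have hκc : Continuous (cutoff ℓ) := hκ.continuous
  have hκs := hasCompactSupport_cutoff hℓ
  have hΔv := continuous_quarterLaplacian hv.contDiff
  have hΔκ := continuous_quarterLaplacian hκ
  have hint₁ : Integrable fun z => -(γ * (cutoff ℓ z * (‖f z‖ ^ 2 * Real.exp (-φ z)))) :=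
    Continuous.integrable_of_hasCompactSupport (by fun_prop) hκs.mul_right.mul_left.neg
  have hint₂ : Integrable fun z =>
      ∑ p ∈ S, (Metric.ball (p : ℂ) ε).indicator (fun _ => (D + γ) * H p) z :=
    integrable_finsetSum S fun p _ => (integrable_indicator_iff measurableSet_ball).2
      (integrableOn_const measure_ball_lt_top.ne)
  have hint₃ : Integrable fun z => K * B * (‖f z‖ ^ 2 * Real.exp (-φ z)) := hf.2.const_mul _
  have hint : Integrable fun z => (cutoff ℓ z * (L z + quarterLaplacian v z) +
      quarterLaplacian (cutoff ℓ) z) * (‖f z‖ ^ 2 * Real.exp (-(φ z + v z))) :=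
    Continuous.integrable_of_hasCompactSupport (by fun_prop)
      (hκs.mul_right.add (hasCompactSupport_quarterLaplacian hκs)).mul_right
  have hintegral := (hφ.integral_weight_nonneg h hL hM hf.1 hv.contDiff hκ hκs
    (cutoff_nonneg ℓ)).trans (integral_mono hint ((hint₁.add hint₂).add hint₃) fun z =>
      hv.cutoff_weight_le hℓ (hK z) hγ hD (sq_nonneg _) hH₀ (fun p hp hz => hH p hp z hz) hS)
  rw [integral_add' (hint₁.add hint₂) hint₃, integral_add' hint₁ hint₂, integral_neg,
    integral_const_mul, integral_const_mul, integral_sum_indicator_ball hε,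
    ← Finset.mul_sum] at hintegral
  rw [fockNormSq]
  linarith

lemma tendsto_integral_cutoff_mul {g : ℂ → ℝ} (hg : Integrable g) :
    Tendsto (fun ℓ : ℝ => ∫ z, cutoff ℓ z * g z) atTop (𝓝 (∫ z, g z)) := by
  refine tendsto_integral_filter_of_dominated_convergence (fun z => ‖g z‖)
    (.of_forall fun ℓ => (contDiff_cutoff ℓ (n := 0)).continuous.aestronglyMeasurable.mul
      hg.aestronglyMeasurable) (.of_forall fun ℓ => .of_forall fun z => ?_) hg.norm
    (.of_forall fun z => ?_)
  · rw [norm_mul, Real.norm_of_nonneg (cutoff_nonneg ℓ z)]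
    exact mul_le_of_le_one_left (norm_nonneg _) (cutoff_le_one ℓ z)
  · refine tendsto_const_nhds.congr' ?_
    filter_upwards [eventually_ge_atTop ‖z‖, eventually_gt_atTop 0] with ℓ hz hℓ
    rw [cutoff_eq_one hℓ hz, one_mul]

end CutoffEstimate

section Sampling

variable {Λ : MultSet} {φ L : ℂ → ℝ} {f : ℂ → ℂ} {I J : Λ.carrier → ℝ} {η ε γ B D E : ℝ}

theorem Subharmonic.mul_fockNormSq_le_tsum (hφ : Subharmonic φ) (h : IsDistribLaplacian φ L)
    (hL : Continuous L) {M : ℝ} (hM : ∀ z, |L z| ≤ M) (hη : 0 < η)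
    (hs : Λ.carrier.Pairwise fun p q => η ≤ dist p q)
    (hpot : ∀ R, ∃ v, IsCompensatingPotential Λ L R ε γ B D E v) (hε : 0 ≤ ε) (hγ : 0 ≤ γ)
    (hD : 0 ≤ D) (hE : 0 ≤ E) (hf : MemFock φ f) (hJ₀ : 0 ≤ J) (hI₀ : 0 ≤ I)
    (hJ : Summable J) (hI : Summable I)
    (hlocal : ∀ p : Λ.carrier, 1 ≤ Λ.mult p → ∀ z : ℂ, ‖z - p‖ < ε →
      ‖f z‖ ^ 2 * Real.exp (-φ z) ≤ J p + ε ^ (2 * Λ.mult p) * I p) :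
    γ * fockNormSq φ f ≤
      (D + γ) * (ε ^ 2 * Real.pi) * (B * ∑' p, J p + E * ∑' p, I p) := by
  obtain ⟨C, -, hcutoff⟩ := exists_abs_quarterLaplacian_cutoff_le
  have hbound : ∀ ℓ : ℝ, 0 < ℓ →
      γ * ∫ z, cutoff ℓ z * (‖f z‖ ^ 2 * Real.exp (-φ z)) ≤
        (D + γ) * (ε ^ 2 * Real.pi) * (B * ∑' p, J p + E * ∑' p, I p) +
          C / ℓ ^ 2 * (B * fockNormSq φ f) := fun ℓ hℓ => by
    obtain ⟨v, hv⟩ := hpot (2 * ℓ)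
    have hfinite := finite_of_pairwise_le_dist hη hs 0 (2 * ℓ + ε)
    have hB : 0 ≤ B := (Real.exp_nonneg _).trans (hv.exp_neg_le 0)
    have hH₀ : 0 ≤ fun p => B * J p + E * I p := fun p =>
      add_nonneg (mul_nonneg hB (hJ₀ p)) (mul_nonneg hE (hI₀ p))
    have hestimate := hφ.integral_cutoff_mul_le h hL hM hf hℓ (hcutoff ℓ) hv hε hγ hD hH₀
      (fun p hp z hz => hv.mul_exp_neg_add_le hp hz (hJ₀ p) (hI₀ p) (hlocal p hp z hz))
      (S := hfinite.toFinset) fun p hp => hfinite.mem_toFinset.2 (by simpa using hp)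
    have hsum := ((hJ.mul_left B).add (hI.mul_left E)).sum_le_tsum hfinite.toFinset
      fun p _ => hH₀ p
    rw [(hJ.mul_left B).tsum_add (hI.mul_left E), tsum_mul_left, tsum_mul_left] at hsum
    rw [← mul_assoc (C / ℓ ^ 2)]
    exact hestimate.trans (by gcongr)
  have hlimit := ((tendsto_const_nhds (x := C)).div_atTop
    (tendsto_pow_atTop two_ne_zero)).mul_const (B * fockNormSq φ f)
  have := le_of_tendsto_of_tendsto ((tendsto_integral_cutoff_mul hf.2).const_mul γ)
    (hlimit.const_add _) ((eventually_gt_atTop 0).mono hbound)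
  rwa [zero_mul, add_zero] at this

lemma MultSet.sampleEnergy_nonneg : 0 ≤ Λ.sampleEnergy φ f :=
  fun _ => Finset.sum_nonneg fun _ _ => by positivity

lemma summable_tsum_le_of_le_setIntegral_ball {g : ℂ → ℝ} {R C : ℝ} {T : Λ.carrier → ℝ}
    (hs : Λ.carrier.Pairwise fun p q => η ≤ dist p q) (hR : 2 * R ≤ η) (hg : Integrable g)
    (hg₀ : 0 ≤ g) (hC : 0 ≤ C) (hT₀ : 0 ≤ T)
    (hT : ∀ p, T p ≤ C * ∫ z in Metric.ball (p : ℂ) R, g z) :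
    Summable T ∧ ∑' p, T p ≤ C * ∫ z, g z := by
  have hbound : ∀ F : Finset Λ.carrier, ∑ p ∈ F, T p ≤ C * ∫ z, g z := fun F =>
    calc ∑ p ∈ F, T p ≤ ∑ p ∈ F, C * ∫ z in Metric.ball (p : ℂ) R, g z :=
          Finset.sum_le_sum fun p _ => hT p
      _ = C * ∑ p ∈ F, ∫ z in Metric.ball (p : ℂ) R, g z := by rw [Finset.mul_sum]
      _ ≤ _ := mul_le_mul_of_nonneg_left (sum_setIntegral_ball_le hs hR hg hg₀ F) hC
  have hsummable := summable_of_sum_le hT₀ hbound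
  exact ⟨hsummable, hsummable.tsum_le_of_sum_le hbound⟩

lemma exists_pos_le_mul_rpow_le {s x y : ℝ} (K : ℝ) (hs : 0 < s) (hx : 0 < x) (hy : 0 < y) :
    ∃ ε, 0 < ε ∧ ε ≤ x ∧ K * ε ^ s ≤ y := by
  have hlimit : Tendsto (fun ε : ℝ => K * ε ^ s) (𝓝[>] 0) (𝓝 0) := by
    have hcont : ContinuousAt (fun ε : ℝ => K * ε ^ s) 0 :=
      (Real.continuousAt_rpow_const 0 s (.inr hs.le)).const_mul K
    have := hcont.tendsto
    rw [Real.zero_rpow hs.ne', mul_zero] at this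
    exact this.mono_left nhdsWithin_le_nhds
  obtain ⟨ε, hε, hεx, hεy⟩ := (eventually_mem_nhdsWithin.and
    ((eventually_nhdsWithin_of_eventually_nhds (eventually_lt_nhds hx)).and
      (hlimit.eventually_lt_const hy))).exists
  exact ⟨ε, hε, hεx.le, hεy.le⟩

end Sampling

section SamplingInequalities

variable {Λ : MultSet} {φ L : ℂ → ℝ} {η δ r : ℝ}

lemma MultSet.sampleEnergy_le {f : ℂ → ℂ} {p : Λ.carrier} {Q : ℝ} (hQ : 0 ≤ Q)
    (h : ∀ j < Λ.mult p, ‖(dbarStar φ)^[j] f p‖ ^ 2 * Real.exp (-φ p) ≤ Q) :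
    Λ.sampleEnergy φ f p ≤ (Λ.n + 1) * Q :=
  calc Λ.sampleEnergy φ f p ≤ (Finset.range (Λ.mult p)).card • Q :=
        Finset.sum_le_card_nsmul _ _ _ fun j hj => h j (Finset.mem_range.1 hj)
    _ = Λ.mult p * Q := by rw [Finset.card_range, nsmul_eq_mul]
    _ ≤ (Λ.n + 1) * Q := mul_le_mul_of_nonneg_right (Λ.cast_mult_le p) hQ

variable (hφ : Subharmonic φ) (h : IsDistribLaplacian φ L) (hL : HasBoundedDerivs (Λ.n - 1) L)
  (hη : 0 < η) (hs : Λ.carrier.Pairwise fun p q => η ≤ dist p q)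
include hφ h hL

lemma Subharmonic.exists_sampleEnergy_estimates {R : ℝ} (hR₀ : 0 < R) (hR : R < 1) :
    ∃ C : ℝ, 0 < C ∧ ∀ (f : ℂ → ℂ), Differentiable ℂ f → ∀ p : Λ.carrier,
      Λ.sampleEnergy φ f p ≤ (Λ.n + 1) * C *
        ∫ w in Metric.ball (p : ℂ) R, ‖f w‖ ^ 2 * Real.exp (-φ w) ∧
      ∀ z : ℂ, ‖z - p‖ ≤ R / 4 → ‖f z‖ ^ 2 * Real.exp (-φ z) ≤ C * Λ.sampleEnergy φ f p +
        ‖z - p‖ ^ (2 * Λ.mult p) *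
          (C * ∫ w in Metric.ball (p : ℂ) R, ‖f w‖ ^ 2 * Real.exp (-φ w)) := by
  obtain ⟨C, hC, hlocal⟩ := exists_local_estimates hR₀ hR hφ h hL
  refine ⟨C, hC, fun f hf p => ⟨?_, fun z hz => ?_⟩⟩
  · rw [mul_assoc]
    refine MultSet.sampleEnergy_le (by positivity) fun j hj => (hlocal f hf p).1 j ?_
    have := Λ.mult_le p
    omega
  · refine ((hlocal f hf p).2 (Λ.mult p) ?_ z hz).trans_eq ?_
    · have := Λ.mult_le p
      omega
    · rw [MultSet.sampleEnergy]
      ring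

include hη hs

theorem Subharmonic.exists_tsum_sampleEnergy_le :
    ∃ B, 0 < B ∧ ∀ f, MemFock φ f → Summable (Λ.sampleEnergy φ f) ∧
      ∑' p, Λ.sampleEnergy φ f p ≤ B * fockNormSq φ f := by
  obtain ⟨R, hR₀, hR⟩ := exists_between (show 0 < min 1 (η / 2) by positivity)
  obtain ⟨C, hC, hlocal⟩ :=
    hφ.exists_sampleEnergy_estimates h hL hR₀ (hR.trans_le (min_le_left _ _))
  exact ⟨(Λ.n + 1) * C, by positivity, fun f hf => summable_tsum_le_of_le_setIntegral_ball hs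
    (by linarith [min_le_right 1 (η / 2)]) hf.2 (fun z => by positivity) (by positivity)
    MultSet.sampleEnergy_nonneg fun p => (hlocal f hf.1 p).1⟩

lemma Subharmonic.mul_fockNormSq_le_tsum_sampleEnergy {R C ε γ B D E : ℝ} {f : ℂ → ℂ}
    (hf : MemFock φ f) (hRη : 2 * R ≤ η) (hεR : ε ≤ R / 4) (hC : 0 ≤ C)
    (hlocal : ∀ p : Λ.carrier, ∀ z : ℂ, ‖z - p‖ ≤ R / 4 → ‖f z‖ ^ 2 * Real.exp (-φ z) ≤
      C * Λ.sampleEnergy φ f p + ‖z - p‖ ^ (2 * Λ.mult p) *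
        (C * ∫ w in Metric.ball (p : ℂ) R, ‖f w‖ ^ 2 * Real.exp (-φ w)))
    (hpot : ∀ R, ∃ v, IsCompensatingPotential Λ L R ε γ B D E v) (hε : 0 ≤ ε) (hγ : 0 ≤ γ)
    (hD : 0 ≤ D) (hE : 0 ≤ E) :
    γ * fockNormSq φ f ≤ (D + γ) * (ε ^ 2 * Real.pi) *
      (B * (C * ∑' p, Λ.sampleEnergy φ f p) + E * (C * fockNormSq φ f)) := by
  obtain ⟨M, hM⟩ := hL.exists_abs_le
  obtain ⟨_, -, hbessel⟩ := hφ.exists_tsum_sampleEnergy_le h hL hη hs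
  have hw₀ : 0 ≤ fun z => ‖f z‖ ^ 2 * Real.exp (-φ z) := fun z => by positivity
  have hI₀ : ∀ p : Λ.carrier, 0 ≤ ∫ z in Metric.ball (p : ℂ) R, ‖f z‖ ^ 2 * Real.exp (-φ z) :=
    fun p => integral_nonneg hw₀
  obtain ⟨hI, hIN⟩ := summable_tsum_le_of_le_setIntegral_ball hs hRη hf.2 hw₀ zero_le_one hI₀
    fun p => (one_mul _).ge
  rw [one_mul] at hIN
  have hestimate := hφ.mul_fockNormSq_le_tsum h hL.contDiff.continuous hM hη hs hpot hε hγ hD hE hf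
    (fun p => mul_nonneg hC (MultSet.sampleEnergy_nonneg p)) (fun p => mul_nonneg hC (hI₀ p))
    ((hbessel f hf).1.mul_left C) (hI.mul_left C) fun p _ z hz =>
      (hlocal p z (hz.le.trans hεR)).trans <| add_le_add le_rfl <| mul_le_mul_of_nonneg_right
        (pow_le_pow_left₀ (norm_nonneg _) hz.le _) (mul_nonneg hC (hI₀ p))
  rw [tsum_mul_left, tsum_mul_left] at hestimate
  refine hestimate.trans (mul_le_mul_of_nonneg_left (add_le_add le_rfl ?_) (by positivity))
  exact mul_le_mul_of_nonneg_left (mul_le_mul_of_nonneg_left hIN hC) hE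

theorem Subharmonic.exists_mul_fockNormSq_le (hδ : 0 < δ) (hr : 0 < r)
    (hdens : ∀ z, L z + δ ≤ Real.pi * Λ.nuConvChi r z) :
    ∃ A, 0 < A ∧ ∀ f, MemFock φ f → A * fockNormSq φ f ≤ ∑' p, Λ.sampleEnergy φ f p := by
  have := Real.pi_pos
  obtain ⟨R, hR₀, hR⟩ := exists_between (show 0 < min 1 (η / 2) by positivity)
  obtain ⟨hR₁, hRη⟩ := lt_min_iff.1 hR
  obtain ⟨C, hC, hlocal⟩ := hφ.exists_sampleEnergy_estimates h hL hR₀ hR₁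
  obtain ⟨M, hM⟩ := hL.exists_abs_le
  obtain ⟨s, A, W, hs₀, hA, hW, hpot⟩ := exists_isCompensatingPotential hη hs
    ((abs_nonneg _).trans (hM 0)) (fun z => (le_abs_self _).trans (hM z)) hδ hr hdens
  obtain ⟨ε, hε, hεx, hεs⟩ := exists_pos_le_mul_rpow_le (x := min r (R / 4))
    ((A + δ / 2) * Real.pi * W * C) hs₀ (by positivity) (show 0 < δ / 4 by positivity)
  obtain ⟨hεr, hεR⟩ := le_min_iff.1 hεx
  have hε₁ : ε ≤ 1 := by linarith
  obtain ⟨B, hB, hpot⟩ := hpot ε hε hε₁ hεr (by linarith)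
  refine ⟨δ / 4 / ((A + δ / 2) * Real.pi * (B * C)), by positivity, fun f hf => ?_⟩
  have hE₀ : 0 ≤ ∑' p, Λ.sampleEnergy φ f p := tsum_nonneg MultSet.sampleEnergy_nonneg
  have hN₀ : 0 ≤ fockNormSq φ f := integral_nonneg fun z => by positivity
  have hcoeff : (A / ε ^ 2 + δ / 2) * (ε ^ 2 * Real.pi) ≤ (A + δ / 2) * Real.pi :=
    calc _ = (A + δ / 2 * ε ^ 2) * Real.pi := by field_simp
      _ ≤ (A + δ / 2) * Real.pi := by
        gcongr
        exact mul_le_of_le_one_right (by positivity) (pow_le_one₀ hε.le hε₁)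
  have hestimate := (hφ.mul_fockNormSq_le_tsum_sampleEnergy h hL hη hs hf (by linarith) hεR hC.le
    (fun p => (hlocal f hf.1 p).2) hpot hε.le (by positivity) (by positivity)
    (by positivity)).trans (mul_le_mul_of_nonneg_right hcoeff (by positivity))
  have habsorb := mul_le_mul_of_nonneg_right hεs hN₀
  rw [div_mul_eq_mul_div, div_le_iff₀ (by positivity)]
  linarith

theorem Subharmonic.isSampling (hδ : 0 < δ) (hr : 0 < r)
    (hdens : ∀ z, L z + δ ≤ Real.pi * Λ.nuConvChi r z) : IsSampling Λ φ := by
  obtain ⟨A, hA, hlower⟩ := hφ.exists_mul_fockNormSq_le h hL hη hs hδ hr hdens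
  obtain ⟨B, hB, hupper⟩ := hφ.exists_tsum_sampleEnergy_le h hL hη hs
  exact ⟨A, B, hA, hB, fun f hf => ⟨(hupper f hf).1, hlower f hf, (hupper f hf).2⟩⟩

end SamplingInequalities

section Hypotheses

variable {Λ : MultSet} {φ L : ℂ → ℝ}

lemma contDiff_of_compatible (hcomp : Compatible Λ φ) (hn : 2 ≤ Λ.n) :
    ContDiff ℝ (Λ.n + 1 : ℕ) φ :=
  (hcomp.2 hn).1

lemma quarterLaplacian_eq_of_compatible (h : IsDistribLaplacian φ L) (hcomp : Compatible Λ φ)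
    (hL : Continuous L) (hn : 2 ≤ Λ.n) : quarterLaplacian φ = L :=
  quarterLaplacian_eq_of_isDistribLaplacian h hL
    ((contDiff_of_compatible hcomp hn).of_le (Nat.cast_le.2 (by omega : 2 ≤ Λ.n + 1)))

lemma contDiff_laplacian_of_compatible (h : IsDistribLaplacian φ L) (hcomp : Compatible Λ φ)
    (hL : Continuous L) : ContDiff ℝ (Λ.n - 1 : ℕ) L := by
  rcases le_or_gt 2 Λ.n with hn | hn
  · rw [← quarterLaplacian_eq_of_compatible h hcomp hL hn]
    refine contDiff_quarterLaplacian (contDiff_of_compatible hcomp hn) ?_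
    exact (Nat.cast_add _ _).symm.trans_le (Nat.cast_le.2 (by omega : Λ.n - 1 + 2 ≤ Λ.n + 1))
  · rw [show Λ.n - 1 = 0 by omega]
    exact contDiff_zero.2 hL

lemma exists_norm_wirtinger_iterate_laplacian_le_of_compatible (h : IsDistribLaplacian φ L)
    (hcomp : Compatible Λ φ) (hL : Continuous L) {j : ℕ} (hj : 1 ≤ j) (hjn : j ≤ Λ.n - 1) :
    ∃ C, ∀ z, ‖wirtinger^[j] (fun w => (L w : ℂ)) z‖ ≤ C := by
  have hn : 2 ≤ Λ.n := by omega
  rw [← quarterLaplacian_eq_of_compatible h hcomp hL hn]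
  exact (hcomp.2 hn).2 j hj hjn

lemma Subharmonic.hasBoundedDerivs {m : ℕ} {M : ℝ} (hφ : Subharmonic φ)
    (h : IsDistribLaplacian φ L) (hL : ContDiff ℝ m L) (hM : ∀ z, L z ≤ M)
    (hbounded : ∀ j, 1 ≤ j → j ≤ m → ∃ C, ∀ z, ‖wirtinger^[j] (fun w => (L w : ℂ)) z‖ ≤ C) :
    HasBoundedDerivs m L := by
  refine ⟨hL, fun j hj => ?_⟩
  rcases j.eq_zero_or_pos with rfl | hj₀
  · refine ⟨M, fun z => ?_⟩
    rw [Function.iterate_zero, id, Complex.norm_real,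
      Real.norm_of_nonneg (hφ.distribLaplacian_nonneg h hL.continuous z)]
    exact hM z
  · exact hbounded j hj₀ hj

end Hypotheses

end FockSampling

end

theorem mainTheorem6_general (φ : ℂ → ℝ) (hφ : FockSampling.Subharmonic φ)
    (Λ : FockSampling.MultSet) (hsep : Λ.Separated) (lapφ : ℂ → ℝ)
    (hlap : FockSampling.IsDistribLaplacian φ lapφ) (hlap_contDiff : ContDiff ℝ (Λ.n - 1 : ℕ) lapφ)
    (hlap_bounded : ∀ j, 1 ≤ j → j ≤ Λ.n - 1 →
      ∃ C, ∀ z, ‖FockSampling.wirtinger^[j] (fun w => (lapφ w : ℂ)) z‖ ≤ C)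
    (δ r : ℝ) (hδ : 0 < δ) (hr : 0 < r)
    (hdens : ∀ z : ℂ, Real.pi * Λ.nuConvChi r z > lapφ z + δ) :
    FockSampling.IsSampling Λ φ := by
  obtain ⟨η, hη, hs⟩ := hsep
  obtain ⟨M, hM⟩ := FockSampling.MultSet.exists_pi_mul_nuConvChi_le hη hs hr.le
  have hlap_le : ∀ z, lapφ z ≤ M := fun z => by linarith [hdens z, hM z]
  exact hφ.isSampling hlap (hφ.hasBoundedDerivs hlap hlap_contDiff hlap_le hlap_bounded) hη hs hδ hr
    fun z => (hdens z).le

theorem mainTheorem6 (φ : ℂ → ℝ) (hφ : FockSampling.Subharmonic φ)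
    (Λ : FockSampling.MultSet) (hsep : Λ.Separated) (hcomp : FockSampling.Compatible Λ φ)
    (lapφ : ℂ → ℝ) (hlap : FockSampling.IsDistribLaplacian φ lapφ) (hcont : Continuous lapφ)
    (δ r : ℝ) (hδ : 0 < δ) (hr : 0 < r)
    (hdens : ∀ z : ℂ, Real.pi * Λ.nuConvChi r z > lapφ z + δ) :
    FockSampling.IsSampling Λ φ :=
  mainTheorem6_general φ hφ Λ hsep lapφ hlap
    (FockSampling.contDiff_laplacian_of_compatible hlap hcomp hcont) (fun _ =>
      FockSampling.exists_norm_wirtinger_iterate_laplacian_le_of_compatible hlap hcomp hcont)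
    δ r hδ hr hdens
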